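/- Let $\mathcal H=L^2(\mathbb R)$, let $|n\rangle$ ($n\ge 0$) be the $n$-th normalized Hermite function, $N$ the number operator, $a,a^*$ the ladder operators ($a|n\rangle=\sqrt n\,|n-1\rangle$, $a^*|n\rangle=\sqrt{n+1}\,|n+1\rangle$), $R(\alpha)=e^{i\alpha N}$, $|z\rangle=e^{-|z|^2/2}\sum_n \frac{z^n}{\sqrt{n!}}|n\rangle$ the coherent states, $Q$ and $P$ the position and momentum operators, and $C$ the complex conjugation $(C\psi)(x)=\overline{\psi(x)}$. Let $\mathsf Q_\theta$ be the spectral measure of (the closure of) $Q_\theta=\frac1{\sqrt2}(e^{i\theta}a^*+e^{-i\theta}a)$, $\mathsf Q=\mathsf Q_0$, and let $U_{12}$ be the unitary operator on $\mathcal H\otimes\mathcal H$ with $U_{12}|z\rangle\otimes|w\rangle=|\tfrac1{\sqrt2}(z-w)\rangle\otimes|\tfrac1{\sqrt2}(z+w)\rangle$ for all $z,w\in\mathbb C$. States are positive operators of trace one; observables are normalized positive operator measures on the Borel sets. Fix a phase shift $\theta\in(-\pi,0)\cup(0,\pi)$ and a state $\sigma$ on $\mathcal H$ (the parameter field). The high-amplitude-limit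 observable of eight-port homodyne detection is the observable $\mathsf E_{\theta,\sigma}$ on $\mathbb R^2$ determined by $$\operatorname{tr}[\rho\,\mathsf E_{\theta,\sigma}(X\times Y)]=\operatorname{tr}\big[U_{12}(\rho\otimes\sigma)U_{12}^*\;\mathsf Q(\tfrac1{\sqrt2}X)\otimes\mathsf Q_\theta(\tfrac1{\sqrt2}Y)\big]$$ for all states $\rho$ and all Borel sets $X,Y\subseteq\mathbb R$. Put $W(q,p)=e^{iqp/2}e^{-iqP}e^{ipQ}$, $f_\theta(q,p)=(q,\,q\cos\theta+p\sin\theta)$ and $W_\theta(q,p)=W(f_\theta^{-1}(q,p))$. Define $$(A_\theta\psi)(x)=\sqrt{\tfrac{|\sin\theta|}{1+\cos\theta}}\;\psi\Big(\sqrt{\tfrac{1-\cos\theta}{1+\cos\theta}}\,x\Big),$$ $$V_\theta=R(\tfrac12(\theta-\pi))A_\theta R(\tfrac\theta2)\ \text{ if }\theta\in(0,\pi),\qquad V_\theta=R(\tfrac12(\theta+\pi))A_\theta R(\tfrac\theta2)\ \text{ if }\theta\in(-\pi,0),$$ and $S_\theta(\sigma)=V_\theta\,C\sigma C^{-1}\,V_\theta^*$.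 Then $S_\theta(\sigma)$ is a state; there is exactly one observable $\mathsf E_{\theta,\sigma}$ satisfying the condition above; it is $\theta$-covariant, that is, $W_\theta(q,p)\mathsf E_{\theta,\sigma}(Z)W_\theta(q,p)^*=\mathsf E_{\theta,\sigma}(Z+(q,p))$ for all $(q,p)\in\mathbb R^2$ and all Borel sets $Z\subseteq\mathbb R^2$; and it equals $\mathsf G_\theta^{S_\theta(\sigma)}$, that is, $$\mathsf E_{\theta,\sigma}(Z)=\frac1{2\pi|\sin\theta|}\int_Z W_\theta(q,p)\,S_\theta(\sigma)\,W_\theta(q,p)^*\,dq\,dp$$ for every Borel set $Z\subseteq\mathbb R^2$, the integral being understood in the weak sense. -/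

import Mathlib

open MeasureTheory Polynomial
open scoped TensorProduct Pointwise

noncomputable section

namespace EightPort

/-- polynomial times Gaussian is integrable -/
theorem integrable_poly_gauss (p : ℝ[X]) {b : ℝ} (hb : 0 < b) :
    Integrable fun x : ℝ => p.eval x * Real.exp (-b * x ^ 2) := by
  induction p using Polynomial.induction_on' with
  | add p q hp hq => simpa [add_mul, Pi.add_def] using hp.add hq
  | monomial n a =>
    have := (integrable_rpow_mul_exp_neg_mul_sq hb (s := n)
      (by have := Nat.cast_nonneg (α := ℝ) n; linarith)).const_mul a
    simpa [mul_assoc] using this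

/-- Repeated integration by parts against a Hermite polynomial. -/
theorem integral_mul_hermite (n : ℕ) : ∀ p : ℝ[X],
    ∫ x : ℝ, p.eval x * (aeval x (hermite n) * Real.exp (-(1 / 2) * x ^ 2)) =
      ∫ x : ℝ, (derivative^[n] p).eval x * Real.exp (-(1 / 2) * x ^ 2) := by
  induction n with
  | zero => intro p; simp
  | succ n ih =>
    intro p
    have hd : ∀ x : ℝ, HasDerivAt (fun x : ℝ => aeval x (hermite n) * Real.exp (-(1 / 2) * x ^ 2))
        (-(aeval x (hermite (n + 1)) * Real.exp (-(1 / 2) * x ^ 2))) x := by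
      intro x
      have h1 : HasDerivAt (fun x : ℝ => aeval x (hermite n)) (aeval x (derivative (hermite n))) x :=
        Polynomial.hasDerivAt_aeval _ _
      have h2 : HasDerivAt (fun x : ℝ => Real.exp (-(1 / 2) * x ^ 2))
          (Real.exp (-(1 / 2) * x ^ 2) * (-(1 / 2) * (2 * x))) x := by
        have := ((hasDerivAt_pow 2 x).const_mul (-(1 / 2) : ℝ)).exp
        simpa using this
      refine (h1.mul h2).congr_deriv ?_
      simp only [hermite_succ, map_sub, map_mul, aeval_X]
      ring
    have hI : ∀ (q : ℝ[X]) (r : ℤ[X]),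
        Integrable fun x : ℝ => q.eval x * (aeval x r * Real.exp (-(1 / 2) * x ^ 2)) := by
      intro q r
      have := integrable_poly_gauss (q * r.map (Int.castRingHom ℝ)) (b := 1 / 2) (by norm_num)
      refine this.congr (Filter.Eventually.of_forall fun x => ?_)
      simp [aeval_def, eval_map, mul_assoc]
    have key := integral_mul_deriv_eq_deriv_mul_of_integrable
      (u := fun x : ℝ => p.eval x) (u' := fun x => (derivative p).eval x)
      (fun x _ => p.hasDerivAt x) (fun x _ => hd x)
      (by simpa [Pi.mul_def] using (hI p (hermite (n+1))).neg) (hI _ _) (hI _ _)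
    rw [Function.iterate_succ_apply, ← ih]
    simp only [mul_neg, integral_neg, neg_inj] at key
    exact key

theorem integral_hermite_mul_hermite (m n : ℕ) :
    ∫ x : ℝ, aeval x (hermite m) * (aeval x (hermite n) * Real.exp (-(1 / 2) * x ^ 2)) =
      if m = n then n.factorial * √(2 * Real.pi) else 0 := by
  have main : ∀ m n : ℕ, m ≤ n →
      ∫ x : ℝ, aeval x (hermite m) * (aeval x (hermite n) * Real.exp (-(1 / 2) * x ^ 2)) =
      if m = n then n.factorial * √(2 * Real.pi) else 0 := by
    intro m n hmn
    have h := integral_mul_hermite n ((hermite m).map (Int.castRingHom ℝ))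
    simp only [eval_map, ← algebraMap_int_eq, ← aeval_def] at h
    rw [h]
    rcases hmn.eq_or_lt with rfl | hlt
    · have : derivative^[m] ((hermite m).map (algebraMap ℤ ℝ)) = C (m.factorial : ℝ) := by
        apply Polynomial.ext
        intro k
        rw [Polynomial.coeff_iterate_derivative, coeff_map, coeff_C]
        rcases k with _ | k
        · simp [Nat.descFactorial_self]
        · rw [coeff_hermite_of_lt (by omega)]; simp
      rw [this]
      simp only [eval_C, if_true, integral_const_mul, integral_gaussian]
      congr 2; ring
    · rw [Polynomial.iterate_derivative_eq_zero]
      · simp [hlt.ne]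
      · exact lt_of_le_of_lt natDegree_map_le (by simpa using hlt)
  rcases le_total m n with h | h
  · exact main m n h
  · have := main n m h
    simp only [eq_comm (a := n)] at this
    rw [show (fun x : ℝ => aeval x (hermite m) * (aeval x (hermite n) * Real.exp (-(1 / 2) * x ^ 2)))
      = fun x => aeval x (hermite n) * (aeval x (hermite m) * Real.exp (-(1 / 2) * x ^ 2)) by
        ext; ring, this]
    split_ifs with h
    · rw [h]
    · rfl


/-- The one-mode Hilbert space in the coordinate representation: `L²(ℝ, ℂ)`. -/
abbrev Mode : Type := Lp ℂ 2 (volume : Measure ℝ)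

/-- Hermite function: `(n! √π)^(-1/2) He_n(√2 x) exp(-x²/2)`, with `He_n` the probabilists' Hermite
polynomial; this is the usual `(2ⁿ n! √π)^(-1/2) H_n(x) exp(-x²/2)`. -/
def hermiteFun (n : ℕ) (x : ℝ) : ℝ :=
  (√(n.factorial * √Real.pi))⁻¹ * (aeval (√2 * x) (hermite n) * Real.exp (-(x ^ 2 / 2)))

theorem continuous_hermiteFun (n : ℕ) : Continuous (hermiteFun n) := by
  unfold hermiteFun
  fun_prop

theorem hermiteFun_eq_poly (n : ℕ) :
    ∃ p : ℝ[X], ∀ x, hermiteFun n x = p.eval x * Real.exp (-(x ^ 2 / 2)) := by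
  refine ⟨C (√(n.factorial * √Real.pi))⁻¹ *
    ((hermite n).map (Int.castRingHom ℝ)).comp (C (√2) * X), fun x => ?_⟩
  simp [hermiteFun, eval_comp, eval_map, aeval_def, mul_assoc]

theorem memLp_poly_gauss (p : ℝ[X]) :
    MemLp (fun x : ℝ => ((p.eval x * Real.exp (-(x ^ 2 / 2)) : ℝ) : ℂ)) 2 volume := by
  rw [memLp_two_iff_integrable_sq_norm (by
    apply Continuous.aestronglyMeasurable; fun_prop)]
  refine (integrable_poly_gauss (p ^ 2) one_pos).congr (Filter.Eventually.of_forall fun x => ?_)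
  simp only [Complex.norm_real, Real.norm_eq_abs, sq_abs, mul_pow, ← Real.exp_nat_mul, eval_pow]
  congr 2; push_cast; ring

theorem memLp_hermiteFun (n : ℕ) : MemLp (fun x : ℝ => (hermiteFun n x : ℂ)) 2 volume := by
  obtain ⟨p, hp⟩ := hermiteFun_eq_poly n
  simpa only [hp] using memLp_poly_gauss p

/-- The number state `|n⟩`. -/
def numberState (n : ℕ) : Mode := (memLp_hermiteFun n).toLp _

theorem integral_hermiteFun_mul (m n : ℕ) :
    ∫ x, hermiteFun m x * hermiteFun n x = if m = n then 1 else 0 := by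
  have h2 : (0 : ℝ) < √2 := by positivity
  have h := Measure.integral_comp_mul_left
    (fun x : ℝ => aeval x (hermite m) * (aeval x (hermite n) * Real.exp (-(1 / 2) * x ^ 2))) (√2)
  rw [integral_hermite_mul_hermite] at h
  have e : (fun x => hermiteFun m x * hermiteFun n x) = fun x : ℝ =>
      ((√(m.factorial * √Real.pi))⁻¹ * (√(n.factorial * √Real.pi))⁻¹) *
      (aeval (√2 * x) (hermite m) * (aeval (√2 * x) (hermite n) *
        Real.exp (-(1 / 2) * (√2 * x) ^ 2))) := by
    ext x
    have : Real.exp (-(1 / 2) * (√2 * x) ^ 2) =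
        Real.exp (-(x ^ 2 / 2)) * Real.exp (-(x ^ 2 / 2)) := by
      rw [← Real.exp_add, mul_pow, Real.sq_sqrt (by norm_num)]; congr 1; ring
    rw [this]; unfold hermiteFun; ring
  rw [e, integral_const_mul, h]
  split_ifs with hmn
  · subst hmn
    have h3 : 0 < (m.factorial : ℝ) * √Real.pi := by positivity
    have h4 : √(2 * Real.pi) = √2 * √Real.pi := Real.sqrt_mul (by norm_num) _
    rw [← mul_inv, Real.mul_self_sqrt h3.le, h4, abs_of_pos (by positivity), smul_eq_mul]
    field_simp
  · simp

theorem orthonormal_numberState : Orthonormal ℂ numberState := by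
  rw [orthonormal_iff_ite]
  intro m n
  rw [L2.inner_def]
  have : (fun x => inner ℂ ((numberState m : Mode) x) ((numberState n : Mode) x)) =ᵐ[volume]
      fun x => ((hermiteFun m x * hermiteFun n x : ℝ) : ℂ) := by
    filter_upwards [(memLp_hermiteFun m).coeFn_toLp, (memLp_hermiteFun n).coeFn_toLp] with x h1 h2
    rw [numberState, numberState, h1, h2]
    simp [mul_comm]
  rw [integral_congr_ae this, integral_complex_ofReal, integral_hermiteFun_mul]
  split_ifs <;> simp


/-- The polynomials underlying the Hermite functions, as a polynomial sequence. -/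
def hermiteSeq : Polynomial.Sequence ℝ where
  elems' n := ((hermite n).map (Int.castRingHom ℝ)).comp (C (√2) * X)
  degree_eq' n := by
    have h2 : √(2 : ℝ) ≠ 0 := by positivity
    have hd : ((hermite n).map (Int.castRingHom ℝ)).natDegree = n := by
      rw [(hermite_monic n).natDegree_map, natDegree_hermite]
    have hne : ((hermite n).map (Int.castRingHom ℝ)).comp (C (√2) * X) ≠ 0 := by
      intro h
      have hl := congrArg Polynomial.leadingCoeff h
      rw [leadingCoeff_comp (by simp [natDegree_C_mul_X _ h2]),
        ((hermite_monic n).map (Int.castRingHom ℝ)).leadingCoeff] at hl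
      simp [h2] at hl
    rw [degree_eq_natDegree hne, natDegree_comp, hd, natDegree_C_mul_X _ h2, mul_one]

theorem eval_hermiteSeq (n : ℕ) (x : ℝ) :
    (hermiteSeq n).eval x = aeval (√2 * x) (hermite n) := by
  change (((hermite n).map (Int.castRingHom ℝ)).comp (C (√2) * X)).eval x = _
  simp [eval_comp, eval_map, aeval_def]

theorem integrable_exp_mul (f : Mode) (c : ℝ) :
    Integrable fun x : ℝ => Real.exp (c * |x|) * (Real.exp (-(x ^ 2 / 2)) * ‖f x‖) := by
  have h1 : MemLp (fun x : ℝ => Real.exp (c * |x|) * Real.exp (-(x ^ 2 / 2))) 2 volume := by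
    rw [memLp_two_iff_integrable_sq (by apply Continuous.aestronglyMeasurable; fun_prop)]
    have hg := (integrable_exp_neg_mul_sq (b := 1 / 2) (by norm_num)).const_mul
      (Real.exp (2 * c ^ 2))
    refine hg.mono' (by apply Continuous.aestronglyMeasurable; fun_prop)
      (Filter.Eventually.of_forall fun x => ?_)
    rw [Real.norm_eq_abs, abs_of_nonneg (by positivity), ← Real.exp_add, ← Real.exp_add,
      ← Real.exp_nat_mul]
    apply Real.exp_le_exp.2
    push_cast
    nlinarith [sq_nonneg (2 * c - |x|), sq_abs x]
  have := h1.integrable_mul (Lp.memLp f).norm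
  refine this.congr (Filter.Eventually.of_forall fun x => ?_)
  simp [mul_assoc]

/-- A square integrable function whose product with a Gaussian has vanishing moments is zero. -/
theorem eq_zero_of_moments (f : Mode)
    (hf : ∀ n : ℕ, ∫ x : ℝ, (x : ℂ) ^ n * ((Real.exp (-(x ^ 2 / 2)) : ℝ) * f x) = 0) : f = 0 := by
  set g : ℝ → ℂ := fun x => (Real.exp (-(x ^ 2 / 2)) : ℝ) * f x with hg
  have hgm : AEStronglyMeasurable g volume :=
    (Continuous.aestronglyMeasurable (by fun_prop)).mul (Lp.aestronglyMeasurable f)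
  have hgn : ∀ x, ‖g x‖ = Real.exp (-(x ^ 2 / 2)) * ‖f x‖ := fun x => by
    simp only [hg, norm_mul, Complex.norm_real, Real.norm_eq_abs, abs_of_pos (Real.exp_pos _)]
  have hgi : Integrable g := by
    have := integrable_exp_mul f 0
    refine this.mono' hgm (Filter.Eventually.of_forall fun x => ?_)
    rw [hgn]; simp
  have hF : ∀ t : ℝ, ∫ x : ℝ, Complex.exp (Complex.I * (t * x)) * g x = 0 := by
    intro t
    have hs := hasSum_integral_of_dominated_convergence (μ := (volume : Measure ℝ))
      (F := fun (n : ℕ) (x : ℝ) => ((Complex.I * (t * x)) ^ n / n.factorial) * g x)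
      (f := fun x : ℝ => Complex.exp (Complex.I * (t * x)) * g x)
      (fun n x => ((|t| * |x|) ^ n / n.factorial) * ‖g x‖)
      (fun n => (Continuous.aestronglyMeasurable (by fun_prop)).mul hgm)
      (fun n => Filter.Eventually.of_forall fun x => by simp)
      (Filter.Eventually.of_forall fun x =>
        (Real.summable_pow_div_factorial (|t| * |x|)).mul_right _)
      (by
        refine (integrable_exp_mul f |t|).congr (Filter.Eventually.of_forall fun x => ?_)
        simp only
        rw [tsum_mul_right, hgn, Real.exp_eq_exp_ℝ, NormedSpace.exp_eq_tsum_div])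
      (Filter.Eventually.of_forall fun x => by
        have := NormedSpace.expSeries_div_hasSum_exp (Complex.I * (t * x))
        rw [← Complex.exp_eq_exp_ℂ] at this
        exact this.mul_right _)
    have h0 : ∀ n : ℕ, ∫ x : ℝ, ((Complex.I * (t * x)) ^ n / n.factorial) * g x = 0 := by
      intro n
      have : (fun x : ℝ => ((Complex.I * (t * x)) ^ n / n.factorial) * g x) =
          fun x : ℝ => ((Complex.I * t) ^ n / n.factorial) * ((x : ℂ) ^ n * g x) := by
        ext x; ring
      rw [this, integral_const_mul, hf n, mul_zero]
    simp only [h0] at hs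
    exact hs.unique hasSum_zero
  have hφ : ∀ φ : SchwartzMap ℝ ℂ, ∫ x, φ x * g x = 0 := by
    intro φ
    have key := VectorFourier.integral_fourierIntegral_smul_eq_flip (L := innerₗ ℝ)
      (μ := (volume : Measure ℝ)) (ν := (volume : Measure ℝ)) Real.continuous_fourierChar
      continuous_inner (FourierTransform.fourierInv φ).integrable hgi
    have h1 : ∀ x, VectorFourier.fourierIntegral Real.fourierChar volume (innerₗ ℝ)
        (FourierTransform.fourierInv φ : SchwartzMap ℝ ℂ) x = φ x := by
      intro x
      have : FourierTransform.fourier (FourierTransform.fourierInv φ) = φ :=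
        FourierTransform.fourier_fourierInv_eq φ
      exact DFunLike.congr_fun this x
    have h2 : ∀ x, VectorFourier.fourierIntegral Real.fourierChar volume (innerₗ ℝ).flip g x = 0 := by
      intro x
      rw [← hF (-(2 * Real.pi * x))]
      simp only [VectorFourier.fourierIntegral]
      refine integral_congr_ae (Filter.Eventually.of_forall fun v => ?_)
      simp only [Circle.smul_def, Real.fourierChar_apply, smul_eq_mul]
      congr 2
      simp
      ring
    simpa only [h1, h2, smul_eq_mul, mul_zero, integral_zero] using key
  have hg0 : g =ᵐ[volume] 0 := by
    refine ae_eq_zero_of_integral_contDiff_smul_eq_zero hgi.locallyIntegrable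
      fun ψ hψ hc => ?_
    have hc' : HasCompactSupport fun x => (ψ x : ℂ) := hc.comp_left Complex.ofReal_zero
    have := hφ (hc'.toSchwartzMap (Complex.ofRealCLM.contDiff.comp hψ))
    simp only [Complex.real_smul]
    exact this
  rw [Lp.eq_zero_iff_ae_eq_zero]
  filter_upwards [hg0] with x hx
  have : (Real.exp (-(x ^ 2 / 2)) : ℂ) ≠ 0 := by exact_mod_cast (Real.exp_pos _).ne'
  simpa [hg, this] using hx

theorem orthogonal_numberState :
    (Submodule.span ℂ (Set.range numberState))ᗮ = ⊥ := by
  rw [Submodule.eq_bot_iff]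
  intro f hf
  have hint : ∀ p : ℝ[X], Integrable fun x : ℝ =>
      ((p.eval x * Real.exp (-(x ^ 2 / 2)) : ℝ) : ℂ) * f x := fun p =>
    (memLp_poly_gauss p).integrable_mul (Lp.memLp f)
  let L : ℝ[X] →ₗ[ℝ] ℂ :=
    { toFun := fun p => ∫ x : ℝ, ((p.eval x * Real.exp (-(x ^ 2 / 2)) : ℝ) : ℂ) * f x
      map_add' := fun p q => by
        rw [← integral_add (hint p) (hint q)]
        congr 1; ext x; simp; ring
      map_smul' := fun c p => by
        simp only [RingHom.id_apply]
        rw [← integral_smul]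
        congr 1; ext x; simp; ring }
  have hL0 : ∀ n, L (hermiteSeq n) = 0 := by
    intro n
    have h0 : inner ℂ (numberState n) f = 0 :=
      hf _ (Submodule.subset_span ⟨n, rfl⟩)
    rw [L2.inner_def] at h0
    have hc : (√(n.factorial * √Real.pi))⁻¹ ≠ 0 := by positivity
    have : ((√(n.factorial * √Real.pi))⁻¹ : ℝ) • L (hermiteSeq n) = 0 := by
      rw [← h0, ← map_smul]
      refine integral_congr_ae ?_
      filter_upwards [(memLp_hermiteFun n).coeFn_toLp] with x h1
      rw [numberState, h1]
      simp only [eval_smul, eval_hermiteSeq, hermiteFun, smul_eq_mul, RCLike.inner_apply,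
        Complex.conj_ofReal]
      rw [mul_comm, mul_assoc]
    exact (smul_eq_zero.1 this).resolve_left hc
  have hL : L = 0 := by
    refine LinearMap.ext_on_range (v := hermiteSeq) (hermiteSeq.span fun i => ?_) (by simpa using hL0)
    exact isUnit_iff_ne_zero.2 (leadingCoeff_ne_zero.2 (hermiteSeq.ne_zero i))
  refine eq_zero_of_moments f fun n => ?_
  have := LinearMap.congr_fun hL (X ^ n)
  rw [LinearMap.zero_apply] at this
  rw [← this]
  refine integral_congr_ae (Filter.Eventually.of_forall fun x => ?_)
  simp [mul_assoc]

/-- The number basis `{|n⟩}`. -/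
def numberBasis : HilbertBasis ℕ ℂ Mode :=
  HilbertBasis.mkOfOrthogonalEqBot orthonormal_numberState orthogonal_numberState


theorem coe_numberBasis : (numberBasis : ℕ → Mode) = numberState := by
  simp [numberBasis]

/-- The coherent state `|z⟩ = exp(-|z|²/2) ∑ₙ zⁿ/√(n!) |n⟩`. -/
def coherentState (z : ℂ) : Mode :=
  (Real.exp (-(‖z‖ ^ 2 / 2)) : ℂ) • ∑' n : ℕ, (z ^ n / (√(n.factorial : ℝ) : ℂ)) • numberState n

theorem orthonormal_rotated (θ : ℝ) :
    Orthonormal ℂ fun n : ℕ => Complex.exp (Complex.I * θ * n) • numberState n := by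
  have hn : ∀ n : ℕ, ‖Complex.exp (Complex.I * θ * n)‖ = 1 := fun n => by
    rw [Complex.norm_exp]; simp
  refine ⟨fun n => ?_, fun m n hmn => ?_⟩
  · rw [norm_smul, hn, orthonormal_numberState.1, mul_one]
  · beta_reduce
    rw [inner_smul_left, inner_smul_right, orthonormal_numberState.2 hmn, mul_zero, mul_zero]

theorem orthogonal_rotated (θ : ℝ) :
    (Submodule.span ℂ (Set.range fun n : ℕ =>
      Complex.exp (Complex.I * θ * n) • numberState n))ᗮ = ⊥ := by
  rw [eq_bot_iff, ← orthogonal_numberState]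
  refine Submodule.orthogonal_le (Submodule.span_le.2 ?_)
  rintro _ ⟨n, rfl⟩
  have := Submodule.smul_mem _ (Complex.exp (Complex.I * θ * n))⁻¹
    (Submodule.subset_span (R := ℂ) (Set.mem_range_self
      (f := fun n : ℕ => Complex.exp (Complex.I * θ * n) • numberState n) n))
  simp only [smul_smul, inv_mul_cancel₀ (Complex.exp_ne_zero _), one_smul] at this
  exact this

/-- The phase shifter `R(θ) = exp(iθN)`: the unitary operator that is diagonal in the number basis
with `R(θ)|n⟩ = exp(iθn)|n⟩`. -/
def phaseShifter (θ : ℝ) : Mode ≃ₗᵢ[ℂ] Mode :=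
  numberBasis.repr.trans
    (HilbertBasis.mkOfOrthogonalEqBot (orthonormal_rotated θ) (orthogonal_rotated θ)).repr.symm

theorem phaseShifter_numberState (θ : ℝ) (n : ℕ) :
    phaseShifter θ (numberState n) = Complex.exp (Complex.I * θ * n) • numberState n := by
  classical
  have h : numberBasis.repr (numberState n) = lp.single 2 n 1 := by
    rw [← numberBasis.repr_self, coe_numberBasis]
  rw [phaseShifter, LinearIsometryEquiv.trans_apply, h,
    HilbertBasis.repr_symm_single, HilbertBasis.coe_mkOfOrthogonalEqBot]

/-- The basis `{|n⟩}` of the space of finite linear combinations of number states. -/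
def finiteBasis : Module.Basis ℕ ℂ (Submodule.span ℂ (Set.range numberState)) :=
  Module.Basis.span orthonormal_numberState.linearIndependent

/-- The annihilation operator `a|n⟩ = √n |n-1⟩` on finite linear combinations of number states. -/
def annihilation : Mode →ₗ.[ℂ] Mode where
  domain := Submodule.span ℂ (Set.range numberState)
  toFun := finiteBasis.constr ℂ fun n => (√(n : ℝ) : ℂ) • numberState (n - 1)

/-- The creation operator `a*|n⟩ = √(n+1) |n+1⟩` on finite linear combinations of number states. -/
def creation : Mode →ₗ.[ℂ] Mode where
  domain := Submodule.span ℂ (Set.range numberState)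
  toFun := finiteBasis.constr ℂ fun n => (√((n : ℝ) + 1) : ℂ) • numberState (n + 1)

/-- The quadrature operator `Q_θ`, the closure of `(exp(iθ) a* + exp(-iθ) a)/√2`. -/
def quadrature (θ : ℝ) : Mode →ₗ.[ℂ] Mode :=
  ((1 / √2 : ℂ) • (Complex.exp (Complex.I * θ) • creation +
    Complex.exp (-(Complex.I * θ)) • annihilation)).closure

/-- An observable with outcome space `α` on the Hilbert space `K`: a normalized positive operator
measure (weakly countably additive), set to `0` on nonmeasurable sets. -/
structure Observable (α : Type*) [MeasurableSpace α] (K : Type*) [NormedAddCommGroup K]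
    [InnerProductSpace ℂ K] where
  toFun : Set α → K →L[ℂ] K
  isPositive : ∀ X, MeasurableSet X → (toFun X).IsPositive
  map_univ : toFun Set.univ = 1
  hasSum_iUnion : ∀ X : ℕ → Set α, (∀ n, MeasurableSet (X n)) → Pairwise (Function.onFun Disjoint X) →
    ∀ φ ψ : K, HasSum (fun n => inner ℂ φ (toFun (X n) ψ)) (inner ℂ φ (toFun (⋃ n, X n) ψ))
  not_measurable : ∀ X, ¬ MeasurableSet X → toFun X = 0

instance {α K : Type*} [MeasurableSpace α] [NormedAddCommGroup K] [InnerProductSpace ℂ K] :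
    CoeFun (Observable α K) fun _ => Set α → K →L[ℂ] K := ⟨Observable.toFun⟩

/-- The measure `X ↦ ⟨ψ, E(X) ψ⟩`. -/
def Observable.measure {α K : Type*} [MeasurableSpace α] [NormedAddCommGroup K]
    [InnerProductSpace ℂ K] (E : Observable α K) (ψ : K) : Measure α :=
  Measure.ofMeasurable (fun X _ => ENNReal.ofReal (inner ℂ ψ (E X ψ)).re)
    (by
      have h := E.hasSum_iUnion (fun _ => ∅) (fun _ => MeasurableSet.empty)
        (fun _ _ _ => disjoint_bot_left) ψ ψ
      have h0 := h.summable.tendsto_atTop_zero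
      rw [tendsto_const_nhds_iff] at h0
      simp [h0])
    (by
      intro X hX hd
      have h := Complex.hasSum_re (E.hasSum_iUnion X hX hd ψ ψ)
      rw [← h.tsum_eq, ENNReal.ofReal_tsum_of_nonneg _ h.summable]
      exact fun n => (E.isPositive _ (hX n)).re_inner_nonneg_right ψ)

/-- `E` is the spectral measure of the (unbounded) self-adjoint operator `T`: it is projection
valued, `dom T = {ψ | ∫ x² ⟨ψ, E(dx) ψ⟩ < ∞}`, and `⟨ψ, Tψ⟩ = ∫ x ⟨ψ, E(dx) ψ⟩` on `dom T`. -/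
def IsSpectralMeasure {K : Type*} [NormedAddCommGroup K] [InnerProductSpace ℂ K]
    (E : Observable ℝ K) (T : K →ₗ.[ℂ] K) : Prop :=
  (∀ X, E X * E X = E X) ∧
  (∀ ψ : K, ψ ∈ T.domain ↔ Integrable (fun x : ℝ => x ^ 2) (E.measure ψ)) ∧
  ∀ ψ : T.domain, inner ℂ (ψ : K) (T ψ) = ((∫ x : ℝ, x ∂(E.measure (ψ : K)) : ℝ) : ℂ)

open Classical in
/-- The spectral measure of a self-adjoint operator `T` (it is unique; `0` if there is none). -/
def spectralMeasure {K : Type*} [NormedAddCommGroup K] [InnerProductSpace ℂ K]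
    (T : K →ₗ.[ℂ] K) (X : Set ℝ) : K →L[ℂ] K :=
  if h : ∃ E : Observable ℝ K, IsSpectralMeasure E T then h.choose X else 0

/-- The trace `∑ᵢ ⟨eᵢ, T eᵢ⟩` over a Hilbert basis. It does not depend on the basis when `T` is
positive or trace class. -/
def trace {K : Type*} [NormedAddCommGroup K] [InnerProductSpace ℂ K] [CompleteSpace K]
    (T : K →L[ℂ] K) : ℂ :=
  ∑' i, inner ℂ ((exists_hilbertBasis ℂ K).choose_spec.choose i)
    (T ((exists_hilbertBasis ℂ K).choose_spec.choose i))

/-- A state: a positive operator of trace one. (A sum that diverges counts as `0`, so the second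
condition includes convergence.) -/
def IsState {K : Type*} [NormedAddCommGroup K] [InnerProductSpace ℂ K] [CompleteSpace K]
    (ρ : K →L[ℂ] K) : Prop :=
  ρ.IsPositive ∧ trace ρ = 1

/-- The Hilbert space tensor product of two modes. -/
abbrev TwoModes : Type := UniformSpace.Completion (Mode ⊗[ℂ] Mode)

/-- The simple tensor `φ ⊗ ψ`. -/
def tensorVec (φ ψ : Mode) : TwoModes := ((φ ⊗ₜ[ℂ] ψ : Mode ⊗[ℂ] Mode) : TwoModes)

/-- The tensor product `A ⊗ B` of bounded operators, acting on the completed tensor product. -/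
def tensorOp (A B : Mode →L[ℂ] Mode) : TwoModes →L[ℂ] TwoModes :=
  (TensorProduct.mapL A B).completion

/-- The 50:50 beam splitter: the (unique) unitary operator with
`U |z⟩ ⊗ |w⟩ = |(z - w)/√2⟩ ⊗ |(z + w)/√2⟩` for all `z, w`. -/
def beamSplitter : TwoModes ≃ₗᵢ[ℂ] TwoModes :=
  Classical.epsilon fun U : TwoModes ≃ₗᵢ[ℂ] TwoModes => ∀ z w : ℂ,
    U (tensorVec (coherentState z) (coherentState w)) =
      tensorVec (coherentState ((z - w) / (√2 : ℝ))) (coherentState ((z + w) / (√2 : ℝ)))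

/-- `E` is the high-amplitude limit observable of eight-port homodyne detection with phase shift
`θ` and parameter field `σ`: for every signal state `ρ` and all Borel sets `X`, `Y`,
`tr[ρ E(X × Y)] = tr[U (ρ ⊗ σ) U* (Q(X/√2) ⊗ Q_θ(Y/√2))]`. -/
def IsHighAmplitudeLimit (θ : ℝ) (σ : Mode →L[ℂ] Mode) (E : Observable (ℝ × ℝ) Mode) : Prop :=
  ∀ ρ : Mode →L[ℂ] Mode, IsState ρ → ∀ X Y : Set ℝ, MeasurableSet X → MeasurableSet Y →
    trace (ρ * E (X ×ˢ Y)) =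
      trace ((beamSplitter : TwoModes →L[ℂ] TwoModes) * tensorOp ρ σ *
        ContinuousLinearMap.adjoint (beamSplitter : TwoModes →L[ℂ] TwoModes) *
        tensorOp (spectralMeasure (quadrature 0) ((1 / √2 : ℝ) • X))
          (spectralMeasure (quadrature θ) ((1 / √2 : ℝ) • Y)))

/-- The translation `exp(-iqP)`: `ψ(x) ↦ ψ(x - q)`. -/
def translation (q : ℝ) : Mode →L[ℂ] Mode :=
  (Lp.compMeasurePreservingₗᵢ ℂ (fun x : ℝ => x - q)
    (measurePreserving_sub_right volume q)).toContinuousLinearMap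

theorem memLp_phase (p : ℝ) (ψ : Mode) :
    MemLp (fun x : ℝ => Complex.exp (Complex.I * p * x) * ψ x) 2 volume := by
  refine (Lp.memLp ψ).of_le
    ((Continuous.aestronglyMeasurable (by fun_prop)).mul (Lp.aestronglyMeasurable ψ))
    (Filter.Eventually.of_forall fun x => ?_)
  rw [norm_mul, Complex.norm_exp]
  simp

/-- The operator `exp(ipQ)`: `ψ(x) ↦ exp(ipx) ψ(x)`. -/
def phaseMul (p : ℝ) : Mode →L[ℂ] Mode :=
  LinearMap.mkContinuous
    { toFun := fun ψ => (memLp_phase p ψ).toLp _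
      map_add' := fun φ ψ => by
        rw [← MemLp.toLp_add]
        refine MemLp.toLp_congr _ _ ?_
        filter_upwards [Lp.coeFn_add φ ψ] with x hx
        simp only [hx, Pi.add_apply, mul_add]
      map_smul' := fun c ψ => by
        rw [RingHom.id_apply, ← MemLp.toLp_const_smul]
        refine MemLp.toLp_congr _ _ ?_
        filter_upwards [Lp.coeFn_smul c ψ] with x hx
        simp only [hx, Pi.smul_apply, smul_eq_mul, mul_left_comm] } 1
    (fun ψ => by
      rw [one_mul]
      refine Lp.norm_le_norm_of_ae_le ?_
      filter_upwards [(memLp_phase p ψ).coeFn_toLp] with x hx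
      change ‖((memLp_phase p ψ).toLp _ : Mode) x‖ ≤ _
      rw [hx, norm_mul, Complex.norm_exp]
      simp)

/-- The Weyl operator `W(q,p) = exp(iqp/2) exp(-iqP) exp(ipQ)`. -/
def weyl (z : ℝ × ℝ) : Mode →L[ℂ] Mode :=
  Complex.exp (Complex.I * (z.1 * z.2 / 2)) • (translation z.1 * phaseMul z.2)

/-- The linear map `f_θ(q,p) = (q, q cos θ + p sin θ)`. -/
def tilt (θ : ℝ) (z : ℝ × ℝ) : ℝ × ℝ :=
  (z.1, z.1 * Real.cos θ + z.2 * Real.sin θ)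

/-- The inverse of `f_θ`, for `sin θ ≠ 0`. -/
def tiltInv (θ : ℝ) (z : ℝ × ℝ) : ℝ × ℝ :=
  (z.1, (z.2 - z.1 * Real.cos θ) / Real.sin θ)

theorem tiltInv_tilt {θ : ℝ} (h : Real.sin θ ≠ 0) (z : ℝ × ℝ) : tiltInv θ (tilt θ z) = z := by
  ext <;> simp [tilt, tiltInv, h]

theorem tilt_tiltInv {θ : ℝ} (h : Real.sin θ ≠ 0) (z : ℝ × ℝ) : tilt θ (tiltInv θ z) = z := by
  ext <;> simp [tilt, tiltInv, h]

/-- The tilted Weyl operator `W_θ(q,p) = W(f_θ⁻¹(q,p))`. -/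
def tiltedWeyl (θ : ℝ) (z : ℝ × ℝ) : Mode →L[ℂ] Mode :=
  weyl (tiltInv θ z)

/-- `θ`-covariance: `W_θ(q,p) E(Z) W_θ(q,p)* = E(Z + (q,p))`. -/
def IsCovariant (θ : ℝ) (E : Observable (ℝ × ℝ) Mode) : Prop :=
  ∀ Z : Set (ℝ × ℝ), MeasurableSet Z → ∀ z : ℝ × ℝ,
    tiltedWeyl θ z * E Z * ContinuousLinearMap.adjoint (tiltedWeyl θ z) =
      E ((fun w => w + z) '' Z)

/-- `E = G_θ^S`, i.e. `E(Z) = (2π|sin θ|)⁻¹ ∫_Z W_θ(q,p) S W_θ(q,p)* dq dp` for all Borel sets `Z`,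
the integral being understood weakly. -/
def IsGeneratedBy (θ : ℝ) (S : Mode →L[ℂ] Mode) (E : Observable (ℝ × ℝ) Mode) : Prop :=
  ∀ Z : Set (ℝ × ℝ), MeasurableSet Z → ∀ φ ψ : Mode,
    IntegrableOn (fun z => inner ℂ φ
      ((tiltedWeyl θ z * S * ContinuousLinearMap.adjoint (tiltedWeyl θ z)) ψ)) Z volume ∧
    inner ℂ φ (E Z ψ) = ((1 / (2 * Real.pi * |Real.sin θ|) : ℝ) : ℂ) *
      ∫ z in Z, inner ℂ φ
        ((tiltedWeyl θ z * S * ContinuousLinearMap.adjoint (tiltedWeyl θ z)) ψ)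

/-- The conjugation `(Cψ)(x) = conj (ψ(x))`. -/
def conjugation : Mode ≃ₗᵢ⋆[ℂ] Mode where
  toFun ψ := star ψ
  invFun ψ := star ψ
  left_inv ψ := star_star ψ
  right_inv ψ := star_star ψ
  map_add' φ ψ := by
    refine Lp.ext ?_
    filter_upwards [Lp.coeFn_star (φ + ψ), Lp.coeFn_add φ ψ, Lp.coeFn_add (star φ) (star ψ),
      Lp.coeFn_star φ, Lp.coeFn_star ψ] with x h1 h2 h3 h4 h5
    simp only [h1, h2, h3, h4, h5, Pi.add_apply, Pi.star_apply, star_add]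
  map_smul' c ψ := by
    refine Lp.ext ?_
    filter_upwards [Lp.coeFn_star (c • ψ), Lp.coeFn_smul c ψ,
      Lp.coeFn_smul (starRingEnd ℂ c) (star ψ), Lp.coeFn_star ψ] with x h1 h2 h3 h4
    simp only [h1, h2, h3, h4, Pi.smul_apply, Pi.star_apply, smul_eq_mul, star_mul']
    rfl
  norm_map' ψ := by
    have h : ∀ᵐ x, ‖(star ψ : Mode) x‖ = ‖ψ x‖ := by
      filter_upwards [Lp.coeFn_star ψ] with x hx
      rw [hx, Pi.star_apply, norm_star]
    exact le_antisymm (Lp.norm_le_norm_of_ae_le (h.mono fun _ hx => hx.le))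
      (Lp.norm_le_norm_of_ae_le (h.mono fun _ hx => hx.ge))

theorem memLp_dilation {k : ℝ} (hk : k ≠ 0) (ψ : Mode) :
    MemLp (fun x : ℝ => ψ (k * x)) 2 volume := by
  have h : MemLp (ψ : ℝ → ℂ) 2 (Measure.map (k * ·) volume) := by
    rw [Real.map_volume_mul_left hk]
    exact (Lp.memLp ψ).smul_measure ENNReal.ofReal_ne_top
  exact h.comp_of_map (by fun_prop)

theorem ae_dilation {k : ℝ} (hk : k ≠ 0) {P : ℝ → Prop} (h : ∀ᵐ x, P x) : ∀ᵐ x, P (k * x) := by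
  have h' : ∀ᵐ x ∂(Measure.map (k * ·) volume), P x := by
    rw [Real.map_volume_mul_left hk]
    exact Measure.ae_smul_measure h _
  exact ae_of_ae_map (by fun_prop) h'

open Classical in
/-- The substitution operator `ψ(x) ↦ ψ(kx)` for `k ≠ 0` (and `0` for `k = 0`). -/
def dilation (k : ℝ) : Mode →L[ℂ] Mode :=
  if hk : k ≠ 0 then
    LinearMap.mkContinuous
      { toFun := fun ψ => (memLp_dilation hk ψ).toLp _
        map_add' := fun φ ψ => by
          rw [← MemLp.toLp_add]
          refine MemLp.toLp_congr _ _ ?_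
          filter_upwards [ae_dilation hk (Lp.coeFn_add φ ψ)] with x hx
          simp only [hx, Pi.add_apply]
        map_smul' := fun c ψ => by
          rw [RingHom.id_apply, ← MemLp.toLp_const_smul]
          refine MemLp.toLp_congr _ _ ?_
          filter_upwards [ae_dilation hk (Lp.coeFn_smul c ψ)] with x hx
          simp only [hx, Pi.smul_apply] }
      (ENNReal.ofReal |k⁻¹| ^ (1 / (2 : ENNReal)).toReal).toReal
      (fun ψ => by
        have h1 : AEStronglyMeasurable (ψ : ℝ → ℂ) (Measure.map (k * ·) volume) := by
          rw [Real.map_volume_mul_left hk]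
          exact (Lp.aestronglyMeasurable ψ).smul_measure _
        have h2 := eLpNorm_map_measure (p := 2) h1 (by fun_prop)
        rw [Real.map_volume_mul_left hk,
          eLpNorm_smul_measure_of_ne_top ENNReal.ofNat_ne_top] at h2
        change ‖(memLp_dilation hk ψ).toLp _‖ ≤ _
        rw [Lp.norm_toLp, Lp.norm_def, ← ENNReal.toReal_mul, ← smul_eq_mul, h2]
        rfl)
  else 0

/-- The unitary operator
`(A_θ ψ)(x) = √(|sin θ|/(1 + cos θ)) ψ(√((1 - cos θ)/(1 + cos θ)) x)`. -/
def squeeze (θ : ℝ) : Mode →L[ℂ] Mode :=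
  (√(|Real.sin θ| / (1 + Real.cos θ)) : ℂ) •
    dilation (√((1 - Real.cos θ) / (1 + Real.cos θ)))

/-- The unitary operator `V_θ`: `R((θ-π)/2) A_θ R(θ/2)` for `θ ∈ (0, π)`, and
`R((θ+π)/2) A_θ R(θ/2)` for `θ ∈ (-π, 0)`. -/
def tiltUnitary (θ : ℝ) : Mode →L[ℂ] Mode :=
  (phaseShifter (if 0 < θ then (θ - Real.pi) / 2 else (θ + Real.pi) / 2) : Mode →L[ℂ] Mode) *
    squeeze θ * (phaseShifter (θ / 2) : Mode →L[ℂ] Mode)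

/-- The operator `C σ C⁻¹`. -/
def conjugate (σ : Mode →L[ℂ] Mode) : Mode →L[ℂ] Mode :=
  (conjugation : Mode →L⋆[ℂ] Mode).comp (σ.comp (conjugation.symm : Mode →L⋆[ℂ] Mode))

/-- The generating operator `S_θ(σ) = V_θ C σ C⁻¹ V_θ*`. -/
def generator (θ : ℝ) (σ : Mode →L[ℂ] Mode) : Mode →L[ℂ] Mode :=
  tiltUnitary θ * conjugate σ * ContinuousLinearMap.adjoint (tiltUnitary θ)

end EightPort

end

/-!
The spectral measure of `Q_θ` is `X ↦ R(θ) 1_X(Q) R(θ)*`; it is the only one, since `Q_θ - c`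
expands vectors by at most `r` on the spectral subspace of `[c - r, c + r]` for one spectral measure
and by more than `r` on that of an interval beyond `c + r` for another, which makes the two
orthogonal. Hence `U* (Q ⊗ Q_θ) U`, with `U` the beam splitter, is carried by an isometry into
`L²(ℝ²)` to multiplication by indicator functions. Comparing Gaussian generating functions on
exponential vectors shows that this isometry is a coherent state transform: up to a phase, its value
on `φ ⊗ w` at a point `p` is `(π |sin θ|)^(-1/2) ⟨W_θ(√2 p) V_θ C w, φ⟩`.
Decompose `σ = ∑ₖ |wₖ⟩⟨wₖ|`. Summing the squared moduli of the images of `φ ⊗ wₖ` and integrating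
over `Z / √2` gives the probability of `Z`, and at the same time identifies its density as
`⟨φ, W_θ S_θ(σ) W_θ* φ⟩ / (2π |sin θ|)`.
Covariance is then the composition law of the Weyl operators. Uniqueness holds because products
`X × Y` determine a measure on the plane and pure states determine an operator.
-/

noncomputable section

namespace EightPort

/-! ### Total families and almost everywhere representatives -/

theorem ae_eq_of_tendsto_Lp {α E : Type*} [MeasurableSpace α] {μ : Measure α}
    [NormedAddCommGroup E] {p : ENNReal} [Fact (1 ≤ p)] {f : ℕ → Lp E p μ} {g : Lp E p μ}
    (h : Filter.Tendsto f Filter.atTop (nhds g)) {F : α → E}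
    (hF : ∀ᵐ x ∂μ, Filter.Tendsto (fun n => f n x) Filter.atTop (nhds (F x))) : g =ᵐ[μ] F := by
  obtain ⟨ns, hns, hae⟩ := (tendstoInMeasure_of_tendsto_Lp h).exists_seq_tendsto_ae
  filter_upwards [hF, hae] with x hx hx'
  exact tendsto_nhds_unique hx' (hx.comp hns.tendsto_atTop)

theorem inner_eq_integral_of_ae_eq {α : Type*} [MeasurableSpace α] {μ : Measure α}
    {f g : Lp ℂ 2 μ} {F G : α → ℂ} (hf : f =ᵐ[μ] F) (hg : g =ᵐ[μ] G) :
    inner ℂ f g = ∫ x, G x * starRingEnd ℂ (F x) ∂μ := by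
  rw [L2.inner_def]
  refine integral_congr_ae ?_
  filter_upwards [hf, hg] with x hfx hgx
  rw [hfx, hgx, RCLike.inner_apply]

theorem dense_span_range_of_forall_inner_eq_zero {ι E : Type*} [NormedAddCommGroup E]
    [InnerProductSpace ℂ E] [CompleteSpace E] {e : ι → E}
    (h : ∀ x, (∀ i, inner ℂ (e i) x = 0) → x = 0) :
    Dense (Submodule.span ℂ (Set.range e) : Set E) := by
  rw [Submodule.dense_iff_topologicalClosure_eq_top, Submodule.topologicalClosure_eq_top_iff,
    Submodule.eq_bot_iff]
  exact fun x hx => h x fun i => hx _ (Submodule.subset_span ⟨i, rfl⟩)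

theorem mem_of_dense_span_range {ι E : Type*} [NormedAddCommGroup E] [NormedSpace ℂ E] {e : ι → E}
    (he : Dense (Submodule.span ℂ (Set.range e) : Set E)) {S : Submodule ℂ E}
    (hS : IsClosed (S : Set E)) (h : ∀ i, e i ∈ S) (x : E) : x ∈ S :=
  hS.closure_subset_iff.2 (Submodule.span_le.2 (Set.range_subset_iff.2 h)) (he x)

/-! ### Number states and exponential vectors -/

theorem dense_span_numberState : Dense (Submodule.span ℂ (Set.range numberState) : Set Mode) := by
  rw [Submodule.dense_iff_topologicalClosure_eq_top, ← coe_numberBasis]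
  exact numberBasis.dense_span

theorem eq_zero_of_forall_inner_numberState {ψ : Mode} (h : ∀ n, inner ℂ (numberState n) ψ = 0) :
    ψ = 0 := by
  refine numberBasis.repr.map_eq_zero_iff.1 (lp.ext (funext fun n => ?_))
  rw [numberBasis.repr_apply_apply, coe_numberBasis, h]
  rfl

theorem ofReal_sqrt_factorial_ne_zero (n : ℕ) : ((√(n.factorial : ℝ) : ℝ) : ℂ) ≠ 0 := by
  norm_cast
  positivity

theorem ofReal_sqrt_factorial_mul_self (n : ℕ) :
    ((√(n.factorial : ℝ) : ℝ) : ℂ) * ((√(n.factorial : ℝ) : ℝ) : ℂ) = n.factorial := by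
  rw [← Complex.ofReal_mul, Real.mul_self_sqrt (by positivity), Complex.ofReal_natCast]

/-- The exponential vector `∑ₙ (zⁿ/√n!) |n⟩`: the coherent state `|z⟩` without its normalization,
which makes it an entire function of `z`. -/
def expVec (z : ℂ) : Mode := ∑' n : ℕ, (z ^ n / (√(n.factorial : ℝ) : ℂ)) • numberState n

theorem coherentState_eq_smul_expVec (z : ℂ) :
    coherentState z = (Real.exp (-(‖z‖ ^ 2 / 2)) : ℂ) • expVec z := rfl

theorem hasSum_expVec (z : ℂ) :
    HasSum (fun n : ℕ => (z ^ n / (√(n.factorial : ℝ) : ℂ)) • numberState n) (expVec z) := by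
  have hs : Summable fun n : ℕ => ‖z ^ n / (√(n.factorial : ℝ) : ℂ)‖ ^ 2 := by
    refine (Real.summable_pow_div_factorial (‖z‖ ^ 2)).congr fun n => ?_
    rw [norm_div, norm_pow, Complex.norm_real, Real.norm_eq_abs, div_pow, sq_abs,
      Real.sq_sqrt (by positivity), ← pow_mul, ← pow_mul, mul_comm]
  exact ((orthonormal_numberState.orthogonalFamily.summable_iff_norm_sq_summable
    (fun n : ℕ => z ^ n / (√(n.factorial : ℝ) : ℂ))).2 hs).hasSum

theorem hasSum_inner_expVec (ψ : Mode) (z : ℂ) :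
    HasSum (fun n : ℕ => z ^ n * (inner ℂ ψ (numberState n) / (√(n.factorial : ℝ) : ℂ)))
      (inner ℂ ψ (expVec z)) := by
  convert! (innerSL ℂ ψ).hasSum (hasSum_expVec z) using 2 with n
  rw [innerSL_apply_apply, inner_smul_right]
  ring

theorem inner_expVec_numberState (z : ℂ) (n : ℕ) :
    inner ℂ (expVec z) (numberState n) = starRingEnd ℂ z ^ n / (√(n.factorial : ℝ) : ℂ) := by
  have h := (hasSum_inner_expVec (numberState n) z).unique (hasSum_single n fun m hm => by
    rw [orthonormal_numberState.2 hm.symm, zero_div, mul_zero])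
  rw [← inner_conj_symm, h, inner_self_eq_norm_sq_to_K, orthonormal_numberState.1]
  simp [div_eq_mul_inv]

theorem inner_expVec (z w : ℂ) :
    inner ℂ (expVec z) (expVec w) = Complex.exp (starRingEnd ℂ z * w) := by
  refine (hasSum_inner_expVec (expVec z) w).unique ?_
  rw [Complex.exp_eq_exp_ℂ]
  convert! NormedSpace.expSeries_div_hasSum_exp (starRingEnd ℂ z * w) using 2 with n
  rw [inner_expVec_numberState, div_div, ofReal_sqrt_factorial_mul_self, mul_pow]
  ring

/-- A vector orthogonal to all exponential vectors has a vanishing power series. -/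
theorem dense_span_expVec : Dense (Submodule.span ℂ (Set.range expVec) : Set Mode) := by
  refine dense_span_range_of_forall_inner_eq_zero fun ψ hψ =>
    eq_zero_of_forall_inner_numberState fun n => ?_
  have hzero : HasFPowerSeriesAt (0 : ℂ → ℂ) (FormalMultilinearSeries.ofScalars ℂ
      fun n : ℕ => inner ℂ ψ (numberState n) / (√(n.factorial : ℝ) : ℂ)) 0 := by
    refine hasFPowerSeriesAt_iff'.2 (Filter.Eventually.of_forall fun z => ?_)
    have hz := hasSum_inner_expVec ψ z
    rw [inner_eq_zero_symm.1 (hψ z)] at hz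
    simpa only [sub_zero, FormalMultilinearSeries.coeff_ofScalars, smul_eq_mul, Pi.zero_apply]
      using hz
  have hcoeff := congrArg (fun p => FormalMultilinearSeries.coeff p n) hzero.eq_zero
  simp only [FormalMultilinearSeries.coeff_ofScalars] at hcoeff
  exact inner_eq_zero_symm.1
    ((div_eq_zero_iff.1 hcoeff).resolve_right (ofReal_sqrt_factorial_ne_zero n))

/-! ### Phase shifters -/

theorem phaseShifter_add (α β : ℝ) (ψ : Mode) :
    phaseShifter (α + β) ψ = phaseShifter α (phaseShifter β ψ) := by
  have h : ((phaseShifter (α + β)).toContinuousLinearEquiv : Mode →L[ℂ] Mode) =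
      ((phaseShifter β).trans (phaseShifter α)).toContinuousLinearEquiv := by
    refine ContinuousLinearMap.ext_on dense_span_numberState ?_
    rintro _ ⟨n, rfl⟩
    change phaseShifter (α + β) (numberState n) = phaseShifter α (phaseShifter β (numberState n))
    rw [phaseShifter_numberState, phaseShifter_numberState, map_smul, phaseShifter_numberState,
      smul_smul, ← Complex.exp_add]
    push_cast
    ring_nf
  exact DFunLike.congr_fun h ψ

theorem phaseShifter_zero (ψ : Mode) : phaseShifter 0 ψ = ψ :=
  (phaseShifter 0).injective (by rw [← phaseShifter_add, add_zero])

theorem phaseShifter_neg_apply_phaseShifter (β : ℝ) (ψ : Mode) :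
    phaseShifter (-β) (phaseShifter β ψ) = ψ := by
  rw [← phaseShifter_add, neg_add_cancel, phaseShifter_zero]

theorem phaseShifter_apply_phaseShifter_neg (β : ℝ) (ψ : Mode) :
    phaseShifter β (phaseShifter (-β) ψ) = ψ := by
  rw [← phaseShifter_add, add_neg_cancel, phaseShifter_zero]

theorem inner_phaseShifter_left (β : ℝ) (φ ψ : Mode) :
    inner ℂ (phaseShifter β φ) ψ = inner ℂ φ (phaseShifter (-β) ψ) := by
  rw [← (phaseShifter β).inner_map_map φ, phaseShifter_apply_phaseShifter_neg]

theorem adjoint_phaseShifter (β : ℝ) :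
    ContinuousLinearMap.adjoint (phaseShifter β : Mode →L[ℂ] Mode) =
      (phaseShifter (-β) : Mode →L[ℂ] Mode) :=
  ((ContinuousLinearMap.eq_adjoint_iff _ _).2 fun φ ψ =>
    (inner_phaseShifter_left (-β) φ ψ).trans (by rw [neg_neg]; rfl)).symm

theorem phaseShifter_expVec (β : ℝ) (z : ℂ) :
    phaseShifter β (expVec z) = expVec (Complex.exp (Complex.I * β) * z) := by
  refine ((phaseShifter β : Mode →L[ℂ] Mode).hasSum (hasSum_expVec z)).unique ?_
  convert! hasSum_expVec (Complex.exp (Complex.I * β) * z) using 2 with n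
  change phaseShifter β _ = _
  rw [map_smul, phaseShifter_numberState, smul_smul, mul_pow, ← Complex.exp_nat_mul]
  ring_nf

/-! ### Exponential vectors in the coordinate representation -/

/-- The exponential vector `expVec z` as a function of the position. -/
def expFun (z : ℂ) (x : ℝ) : ℂ :=
  ((√(√Real.pi))⁻¹ : ℝ) * Complex.exp (-(x ^ 2 / 2) + (√2 : ℝ) * z * x - z ^ 2 / 2)

theorem iteratedDeriv_exp_mul_sub_sq (y : ℂ) (n : ℕ) :
    iteratedDeriv n (fun t : ℂ => Complex.exp (y * t - t ^ 2 / 2)) =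
      fun t => aeval (y - t) (hermite n) * Complex.exp (y * t - t ^ 2 / 2) := by
  induction n with
  | zero => simp
  | succ n ih =>
    rw [iteratedDeriv_succ, ih]
    funext t
    have hpoly : HasDerivAt (fun t : ℂ => aeval (y - t) (hermite n))
        (aeval (y - t) (derivative (hermite n)) * -1) t :=
      HasDerivAt.comp t (Polynomial.hasDerivAt_aeval (hermite n) (y - t))
        ((hasDerivAt_id t).const_sub y)
    have hexp : HasDerivAt (fun t : ℂ => Complex.exp (y * t - t ^ 2 / 2))
        (Complex.exp (y * t - t ^ 2 / 2) * (y - t)) t :=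
      ((((hasDerivAt_id t).const_mul y).sub ((hasDerivAt_pow 2 t).div_const 2))).cexp.congr_deriv
        (by simp)
    refine (hpoly.mul hexp).deriv.trans ?_
    simp only [hermite_succ, map_sub, map_mul, aeval_X]
    ring

theorem hasSum_hermite_generating (y t : ℂ) :
    HasSum (fun n : ℕ => (n.factorial : ℂ)⁻¹ * (t ^ n * aeval y (hermite n)))
      (Complex.exp (y * t - t ^ 2 / 2)) := by
  have h := Complex.hasSum_taylorSeries_of_entire
    (f := fun t : ℂ => Complex.exp (y * t - t ^ 2 / 2)) (by fun_prop) 0 t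
  simpa [iteratedDeriv_exp_mul_sub_sq] using h

theorem hasSum_hermiteFun (z : ℂ) (x : ℝ) :
    HasSum (fun n : ℕ => z ^ n / (√(n.factorial : ℝ) : ℂ) * hermiteFun n x) (expFun z x) := by
  have hgen := (hasSum_hermite_generating ((√2 : ℝ) * x) z).mul_left
    (((√(√Real.pi))⁻¹ : ℝ) * Complex.exp (-(x ^ 2 / 2 : ℂ)))
  convert! hgen using 1
  · funext n
    have hcast : ((aeval (√2 * x) (hermite n) : ℝ) : ℂ) = aeval ((√2 : ℝ) * x : ℂ) (hermite n) := by
      rw [← Complex.ofReal_mul]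
      exact (Polynomial.aeval_algebraMap_apply ℂ (√2 * x) (hermite n)).symm
    have hne := ofReal_sqrt_factorial_ne_zero n
    rw [hermiteFun, Real.sqrt_mul (by positivity)]
    push_cast
    rw [hcast, ← ofReal_sqrt_factorial_mul_self]
    field_simp
  · rw [expFun]
    conv_rhs => rw [mul_assoc, ← Complex.exp_add]
    ring_nf

theorem coeFn_expVec (z : ℂ) : expVec z =ᵐ[volume] expFun z := by
  refine ae_eq_of_tendsto_Lp (hasSum_expVec z).tendsto_sum_nat ?_
  have hstate : ∀ᵐ x : ℝ, ∀ n : ℕ, ((z ^ n / (√(n.factorial : ℝ) : ℂ)) • numberState n : Mode) x =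
      z ^ n / (√(n.factorial : ℝ) : ℂ) * hermiteFun n x :=
    ae_all_iff.2 fun n => by
      filter_upwards [Lp.coeFn_smul (z ^ n / (√(n.factorial : ℝ) : ℂ)) (numberState n),
        (memLp_hermiteFun n).coeFn_toLp] with x hsmul hx
      rw [hsmul, Pi.smul_apply, numberState, hx, smul_eq_mul]
  have hsum := ae_all_iff.2 fun N => Lp.coeFn_fun_finsetSum (Finset.range N)
    fun n => (z ^ n / (√(n.factorial : ℝ) : ℂ)) • numberState n
  filter_upwards [hstate, hsum] with x hstate hsum
  simp only [hsum, hstate]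
  exact (hasSum_hermiteFun z x).tendsto_sum_nat

theorem conjugation_expVec (z : ℂ) : conjugation (expVec z) = expVec (starRingEnd ℂ z) := by
  refine Lp.ext ?_
  change (star (expVec z) : Mode) =ᵐ[volume] _
  filter_upwards [Lp.coeFn_star (expVec z), coeFn_expVec z,
    coeFn_expVec (starRingEnd ℂ z)] with x hstar hz hconj
  rw [hstar, hconj, Pi.star_apply, hz, expFun, expFun, ← starRingEnd_apply, map_mul,
    Complex.conj_ofReal, ← Complex.exp_conj]
  simp [map_ofNat]

theorem inner_conjugation_left (φ ψ : Mode) :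
    inner ℂ (conjugation φ) ψ = inner ℂ (conjugation ψ) φ := by
  change inner ℂ (star φ : Mode) ψ = inner ℂ (star ψ : Mode) φ
  rw [inner_eq_integral_of_ae_eq (Lp.coeFn_star φ) (ae_eq_refl ψ),
    inner_eq_integral_of_ae_eq (Lp.coeFn_star ψ) (ae_eq_refl φ)]
  congr 1
  funext x
  simp [mul_comm]

/-! ### Weyl operators -/

theorem coeFn_translation (q : ℝ) (ψ : Mode) :
    translation q ψ =ᵐ[volume] fun x => ψ (x - q) :=
  Lp.coeFn_compMeasurePreserving ψ (measurePreserving_sub_right volume q)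

theorem coeFn_phaseMul (p : ℝ) (ψ : Mode) :
    phaseMul p ψ =ᵐ[volume] fun x => Complex.exp (Complex.I * p * x) * ψ x :=
  (memLp_phase p ψ).coeFn_toLp

theorem ae_comp_sub {P : ℝ → Prop} (h : ∀ᵐ x, P x) (q : ℝ) : ∀ᵐ x, P (x - q) :=
  (measurePreserving_sub_right volume q).quasiMeasurePreserving.ae h

theorem coeFn_weyl (a : ℝ × ℝ) (ψ : Mode) :
    weyl a ψ =ᵐ[volume] fun x =>
      Complex.exp (Complex.I * (a.2 * x - a.1 * a.2 / 2)) * ψ (x - a.1) := by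
  filter_upwards [Lp.coeFn_smul (Complex.exp (Complex.I * (a.1 * a.2 / 2)))
    (translation a.1 (phaseMul a.2 ψ)), coeFn_translation a.1 (phaseMul a.2 ψ),
    ae_comp_sub (coeFn_phaseMul a.2 ψ) a.1] with x hsmul htrans hphase
  change (Complex.exp (Complex.I * (a.1 * a.2 / 2)) • translation a.1 (phaseMul a.2 ψ)) x = _
  rw [hsmul, Pi.smul_apply, htrans, hphase, smul_eq_mul, ← mul_assoc, ← Complex.exp_add]
  congr 2
  push_cast
  ring

theorem weyl_zero_apply (ψ : Mode) : weyl 0 ψ = ψ := by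
  refine Lp.ext ?_
  filter_upwards [coeFn_weyl 0 ψ] with x hx
  simp [hx]

theorem weyl_apply_weyl (a b : ℝ × ℝ) (ψ : Mode) :
    weyl a (weyl b ψ) =
      Complex.exp (Complex.I * ((b.1 * a.2 - a.1 * b.2) / 2)) • weyl (a + b) ψ := by
  refine Lp.ext ?_
  filter_upwards [coeFn_weyl a (weyl b ψ), ae_comp_sub (coeFn_weyl b ψ) a.1, coeFn_weyl (a + b) ψ,
    Lp.coeFn_smul (Complex.exp (Complex.I * ((b.1 * a.2 - a.1 * b.2) / 2)))
      (weyl (a + b) ψ)] with x ha hb hab hsmul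
  rw [ha, hb, hsmul, Pi.smul_apply, hab, smul_eq_mul, ← mul_assoc, ← mul_assoc, ← Complex.exp_add,
    ← Complex.exp_add, Prod.fst_add, Prod.snd_add, sub_add_eq_sub_sub]
  congr 2
  push_cast
  ring

theorem norm_weyl_apply (a : ℝ × ℝ) (ψ : Mode) : ‖weyl a ψ‖ = ‖ψ‖ := by
  have htrans : ‖translation a.1 ψ‖ = ‖ψ‖ :=
    (Lp.compMeasurePreservingₗᵢ ℂ (fun x : ℝ => x - a.1)
      (measurePreserving_sub_right volume a.1)).norm_map ψ
  have hae : ∀ᵐ x, ‖weyl a ψ x‖ = ‖translation a.1 ψ x‖ := by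
    filter_upwards [coeFn_weyl a ψ, coeFn_translation a.1 ψ] with x hweyl htrans
    rw [hweyl, htrans, norm_mul, Complex.norm_exp]
    simp [Complex.sub_im]
  rw [← htrans]
  exact le_antisymm (Lp.norm_le_norm_of_ae_le (hae.mono fun _ h => h.le))
    (Lp.norm_le_norm_of_ae_le (hae.mono fun _ h => h.ge))

theorem inner_weyl_weyl (a : ℝ × ℝ) (φ ψ : Mode) :
    inner ℂ (weyl a φ) (weyl a ψ) = inner ℂ φ ψ :=
  (LinearMap.norm_map_iff_inner_map_map (weyl a)).1 (norm_weyl_apply a) φ ψ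

theorem adjoint_weyl (a : ℝ × ℝ) : ContinuousLinearMap.adjoint (weyl a) = weyl (-a) := by
  refine ((ContinuousLinearMap.eq_adjoint_iff _ _).2 fun φ ψ => ?_).symm
  rw [← inner_weyl_weyl a, weyl_apply_weyl]
  simp [mul_comm, weyl_zero_apply]

theorem ofReal_sqrt_two_sq : ((√2 : ℝ) : ℂ) ^ 2 = 2 := by
  rw [← Complex.ofReal_pow, Real.sq_sqrt (by norm_num), Complex.ofReal_ofNat]

theorem weyl_expVec (a : ℝ × ℝ) (z : ℂ) :
    weyl a (expVec z) =
      Complex.exp (-((a.1 ^ 2 + a.2 ^ 2) / 4) - (a.1 - Complex.I * a.2) / (√2 : ℝ) * z) •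
        expVec (z + (a.1 + Complex.I * a.2) / (√2 : ℝ)) := by
  refine Lp.ext ?_
  filter_upwards [coeFn_weyl a (expVec z), ae_comp_sub (coeFn_expVec z) a.1, Lp.coeFn_smul
    (Complex.exp (-((a.1 ^ 2 + a.2 ^ 2) / 4) - (a.1 - Complex.I * a.2) / (√2 : ℝ) * z))
    (expVec (z + (a.1 + Complex.I * a.2) / (√2 : ℝ))),
    coeFn_expVec (z + (a.1 + Complex.I * a.2) / (√2 : ℝ))] with x hweyl hz hsmul hza
  rw [hweyl, hz, hsmul, Pi.smul_apply, hza, smul_eq_mul, expFun, expFun, mul_left_comm,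
    ← Complex.exp_add, mul_left_comm, ← Complex.exp_add]
  have hne : ((√2 : ℝ) : ℂ) ≠ 0 := by norm_num
  have hcube : ((√2 : ℝ) : ℂ) ^ 3 = 2 * (√2 : ℝ) := by rw [pow_succ, ofReal_sqrt_two_sq]
  congr 2
  push_cast
  field_simp
  ring_nf
  simp only [Complex.I_sq, ofReal_sqrt_two_sq, hcube]
  ring

/-! ### Decompositions of states into rank one operators -/

section Ensemble

variable {K L : Type*} [NormedAddCommGroup K] [InnerProductSpace ℂ K]
  [NormedAddCommGroup L] [InnerProductSpace ℂ L] {ι κ : Type*}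

/-- The decomposition `ρ = ∑ₖ |vₖ⟩⟨vₖ|` of a positive trace class operator, with
`∑ₖ ‖vₖ‖² < ∞`. The weights of the ensemble are absorbed into the vectors `vₖ`. -/
structure IsEnsemble (ρ : K →L[ℂ] K) (v : ι → K) : Prop where
  summable_norm_sq : Summable fun k => ‖v k‖ ^ 2
  hasSum_inner : ∀ x y, HasSum (fun k => inner ℂ x (v k) * inner ℂ (v k) y) (inner ℂ x (ρ y))

theorem isEnsemble_rankOne (φ : K) :
    IsEnsemble (InnerProductSpace.rankOne ℂ φ φ) fun _ : Unit => φ where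
  summable_norm_sq := (hasSum_unique _).summable
  hasSum_inner x y := by simp [mul_comm]

theorem hasSum_norm_inner_sq (b : HilbertBasis ι ℂ K) (x : K) :
    HasSum (fun i => ‖inner ℂ (b i) x‖ ^ 2) (‖x‖ ^ 2) := by
  have h := Complex.hasSum_re (b.hasSum_inner_mul_inner x x)
  rw [inner_self_eq_norm_sq_to_K] at h
  norm_cast at h
  refine h.congr_fun fun i => ?_
  rw [← inner_conj_symm x, Complex.conj_mul', ← Complex.ofReal_pow, Complex.ofReal_re]

theorem summable_norm_inner_sq (b : HilbertBasis κ ℂ K) {v : ι → K}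
    (hv : Summable fun k => ‖v k‖ ^ 2) :
    Summable fun p : ι × κ => ‖inner ℂ (b p.2) (v p.1)‖ ^ 2 := by
  rw [summable_prod_of_nonneg fun p => by positivity]
  refine ⟨fun k => (hasSum_norm_inner_sq b (v k)).summable, ?_⟩
  simpa only [fun k => (hasSum_norm_inner_sq b (v k)).tsum_eq] using hv

theorem summable_norm_apply_sq (T : K →L[ℂ] L) {v : ι → K} (hv : Summable fun k => ‖v k‖ ^ 2) :
    Summable fun k => ‖T (v k)‖ ^ 2 := by
  refine Summable.of_nonneg_of_le (fun k => by positivity) (fun k => ?_) (hv.mul_left (‖T‖ ^ 2))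
  rw [← mul_pow]
  gcongr
  exact T.le_opNorm (v k)

theorem isPositive_of_hasSum_inner {A : K →L[ℂ] K} {c : K → ι → ℝ} (hc : ∀ x k, 0 ≤ c x k)
    (h : ∀ x, HasSum (fun k => (c x k : ℂ)) (inner ℂ x (A x))) : A.IsPositive := by
  rw [ContinuousLinearMap.isPositive_iff_complex]
  intro x
  obtain ⟨r, hr⟩ := Complex.summable_ofReal.1 (h x).summable
  have hinner : inner ℂ (A x) x = (r : ℂ) := by
    rw [← inner_conj_symm, (h x).unique (Complex.hasSum_ofReal.2 hr), Complex.conj_ofReal]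
  rw [hinner]
  exact ⟨rfl, hr.nonneg (hc x)⟩

theorem IsEnsemble.isPositive {ρ : K →L[ℂ] K} {v : ι → K} (h : IsEnsemble ρ v) :
    ρ.IsPositive := by
  refine isPositive_of_hasSum_inner (c := fun x k => ‖inner ℂ (v k) x‖ ^ 2)
    (fun _ _ => by positivity) fun x => (h.hasSum_inner x x).congr_fun fun k => ?_
  rw [← inner_conj_symm x, Complex.conj_mul', Complex.ofReal_pow]

section Complete

variable [CompleteSpace K] {ρ : K →L[ℂ] K} {v : ι → K}

theorem IsEnsemble.summable_inner_mul_inner (h : IsEnsemble ρ v) (A : K →L[ℂ] K)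
    (b : HilbertBasis κ ℂ K) :
    Summable fun p : ι × κ => inner ℂ (b p.2) (v p.1) * inner ℂ (v p.1) (A (b p.2)) := by
  refine Summable.of_norm_bounded ((summable_norm_inner_sq b h.summable_norm_sq).add
    (summable_norm_inner_sq b
      (summable_norm_apply_sq (ContinuousLinearMap.adjoint A) h.summable_norm_sq))) fun p => ?_
  rw [norm_mul, ← ContinuousLinearMap.adjoint_inner_left, norm_inner_symm _ (b p.2)]
  nlinarith [two_mul_le_add_sq ‖inner ℂ (b p.2) (v p.1)‖
    ‖inner ℂ (b p.2) (ContinuousLinearMap.adjoint A (v p.1))‖,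
    norm_nonneg (inner ℂ (b p.2) (v p.1)),
    norm_nonneg (inner ℂ (b p.2) (ContinuousLinearMap.adjoint A (v p.1)))]

/-- Sum the same absolutely summable double series in the two possible orders. -/
theorem IsEnsemble.exists_hasSum_inner_apply (h : IsEnsemble ρ v) (A : K →L[ℂ] K)
    (b : HilbertBasis κ ℂ K) :
    ∃ t : ℂ, HasSum (fun i => inner ℂ (b i) (ρ (A (b i)))) t ∧
      HasSum (fun k => inner ℂ (v k) (A (v k))) t := by
  obtain ⟨t, ht⟩ := h.summable_inner_mul_inner A b
  have hswap : HasSum (fun p : κ × ι => inner ℂ (b p.1) (v p.2) * inner ℂ (v p.2) (A (b p.1))) t :=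
    (Equiv.prodComm κ ι).hasSum_iff.2 ht
  refine ⟨t, hswap.prod_fiberwise fun i => h.hasSum_inner (b i) (A (b i)),
    ht.prod_fiberwise fun k => ?_⟩
  have hbasis := b.hasSum_inner_mul_inner (ContinuousLinearMap.adjoint A (v k)) (v k)
  simp only [ContinuousLinearMap.adjoint_inner_left] at hbasis
  exact hbasis.congr_fun fun i => mul_comm _ _

theorem IsEnsemble.hasSum_trace_mul (h : IsEnsemble ρ v) (A : K →L[ℂ] K) :
    HasSum (fun k => inner ℂ (v k) (A (v k))) (trace (ρ * A)) := by
  obtain ⟨t, hbasis, hv⟩ :=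
    h.exists_hasSum_inner_apply A (exists_hilbertBasis ℂ K).choose_spec.choose
  exact (show trace (ρ * A) = t from hbasis.tsum_eq) ▸ hv

theorem IsEnsemble.hasSum_trace (h : IsEnsemble ρ v) :
    HasSum (fun k => ((‖v k‖ ^ 2 : ℝ) : ℂ)) (trace ρ) := by
  have hone := h.hasSum_trace_mul 1
  rw [mul_one] at hone
  exact hone.congr_fun fun k => by simp [inner_self_eq_norm_sq_to_K]

theorem IsEnsemble.isState_iff (h : IsEnsemble ρ v) :
    IsState ρ ↔ HasSum (fun k => ‖v k‖ ^ 2) 1 := by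
  rw [← Complex.hasSum_ofReal, Complex.ofReal_one]
  exact ⟨fun hρ => hρ.2 ▸ h.hasSum_trace, fun hone => ⟨h.isPositive, h.hasSum_trace.unique hone⟩⟩

theorem isState_rankOne {φ : K} (hφ : ‖φ‖ = 1) : IsState (InnerProductSpace.rankOne ℂ φ φ) := by
  refine (isEnsemble_rankOne φ).isState_iff.2 ?_
  simp [hφ]

theorem inner_sqrt_left (ρ : K →L[ℂ] K) (x y : K) :
    inner ℂ (CFC.sqrt ρ x) y = inner ℂ x (CFC.sqrt ρ y) :=
  (CFC.sqrt_nonneg ρ).isSelfAdjoint.isSymmetric x y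

theorem sqrt_apply_sqrt (hρ : ρ.IsPositive) (x : K) : CFC.sqrt ρ (CFC.sqrt ρ x) = ρ x :=
  DFunLike.congr_fun
    (CFC.sqrt_mul_sqrt_self ρ ((ContinuousLinearMap.nonneg_iff_isPositive ρ).2 hρ)) x

theorem isEnsemble_sqrt (hρ : ρ.IsPositive) (b : HilbertBasis ι ℂ K)
    (hb : Summable fun i => ‖CFC.sqrt ρ (b i)‖ ^ 2) : IsEnsemble ρ fun i => CFC.sqrt ρ (b i) where
  summable_norm_sq := hb
  hasSum_inner x y := by
    simpa only [inner_sqrt_left, sqrt_apply_sqrt hρ]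
      using b.hasSum_inner_mul_inner (CFC.sqrt ρ x) (CFC.sqrt ρ y)

theorem inner_apply_self_eq_norm_sqrt_sq (hρ : ρ.IsPositive) (x : K) :
    inner ℂ x (ρ x) = ((‖CFC.sqrt ρ x‖ ^ 2 : ℝ) : ℂ) := by
  rw [← sqrt_apply_sqrt hρ, ← inner_sqrt_left, inner_self_eq_norm_sq_to_K]
  norm_cast

theorem IsState.exists_isEnsemble (hρ : IsState ρ) (b : HilbertBasis ι ℂ K) :
    ∃ v : ι → K, IsEnsemble ρ v := by
  have htrace : Summable fun i =>
      ‖CFC.sqrt ρ ((exists_hilbertBasis ℂ K).choose_spec.choose i)‖ ^ 2 := by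
    by_contra hsum
    rw [← Complex.summable_ofReal] at hsum
    simp only [← inner_apply_self_eq_norm_sqrt_sq hρ.1] at hsum
    exact one_ne_zero (hρ.2.symm.trans (tsum_eq_zero_of_not_summable hsum))
  obtain ⟨t, ht, -⟩ := (isEnsemble_sqrt hρ.1 _ htrace).exists_hasSum_inner_apply 1 b
  have hb : Summable fun i => ‖CFC.sqrt ρ (b i)‖ ^ 2 := by
    rw [← Complex.summable_ofReal]
    simpa only [← inner_apply_self_eq_norm_sqrt_sq hρ.1, one_apply_eq_self] using ht.summable
  exact ⟨_, isEnsemble_sqrt hρ.1 b hb⟩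

theorem exists_isEnsemble_of_summable (hv : Summable fun k => ‖v k‖ ^ 2) :
    ∃ ρ : K →L[ℂ] K, IsEnsemble ρ v := by
  obtain ⟨ρ, hρ⟩ : Summable fun k => InnerProductSpace.rankOne ℂ (v k) (v k) :=
    Summable.of_norm_bounded hv fun k => by rw [InnerProductSpace.norm_rankOne, sq]
  refine ⟨ρ, hv, fun x y => ?_⟩
  convert! (hρ.mapL (ContinuousLinearMap.apply ℂ K y)).mapL (innerSL ℂ x) using 2 with k
  simp [mul_comm]

theorem IsEnsemble.conj [CompleteSpace L] (h : IsEnsemble ρ v) (T : K →L[ℂ] L) :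
    IsEnsemble (T.comp (ρ.comp (ContinuousLinearMap.adjoint T))) fun k => T (v k) where
  summable_norm_sq := summable_norm_apply_sq T h.summable_norm_sq
  hasSum_inner x y := by
    simpa only [ContinuousLinearMap.adjoint_inner_left, ContinuousLinearMap.adjoint_inner_right,
      ContinuousLinearMap.comp_apply]
      using h.hasSum_inner (ContinuousLinearMap.adjoint T x) (ContinuousLinearMap.adjoint T y)

end Complete

end Ensemble

/-! ### The two-mode space -/

theorem inner_tensorVec (φ ψ φ' ψ' : Mode) :
    inner ℂ (tensorVec φ ψ) (tensorVec φ' ψ') = inner ℂ φ φ' * inner ℂ ψ ψ' := by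
  rw [tensorVec, tensorVec, UniformSpace.Completion.inner_coe, TensorProduct.inner_tmul]

theorem norm_tensorVec (φ ψ : Mode) : ‖tensorVec φ ψ‖ = ‖φ‖ * ‖ψ‖ := by
  rw [tensorVec, UniformSpace.Completion.norm_coe, TensorProduct.norm_tmul]

theorem tensorOp_tensorVec (A B : Mode →L[ℂ] Mode) (φ ψ : Mode) :
    tensorOp A B (tensorVec φ ψ) = tensorVec (A φ) (B ψ) := by
  rw [tensorOp, tensorVec, ContinuousLinearMap.completion_apply_coe]
  rfl

/-- The simple tensor `φ ⊗ ψ` as a continuous bilinear map of `φ` and `ψ`. -/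
def tensorVecL : Mode →L[ℂ] Mode →L[ℂ] TwoModes :=
  (ContinuousLinearMap.compL ℂ Mode (Mode ⊗[ℂ] Mode) TwoModes
    UniformSpace.Completion.toComplL).comp (TensorProduct.mkL ℂ Mode Mode)

theorem tensorVecL_apply (φ ψ : Mode) : tensorVecL φ ψ = tensorVec φ ψ := rfl

theorem tensorVec_smul_smul (a b : ℂ) (φ ψ : Mode) :
    tensorVec (a • φ) (b • ψ) = (a * b) • tensorVec φ ψ := by
  simp only [← tensorVecL_apply, map_smul, smul_apply, smul_smul, mul_comm]

theorem dense_span_tensorVec :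
    Dense (Submodule.span ℂ (Set.range fun p : Mode × Mode => tensorVec p.1 p.2) :
      Set TwoModes) := by
  have hmem : ∀ t : Mode ⊗[ℂ] Mode, (t : TwoModes) ∈
      Submodule.span ℂ (Set.range fun p : Mode × Mode => tensorVec p.1 p.2) := fun t => by
    induction t using TensorProduct.induction_on with
    | zero => exact UniformSpace.Completion.coe_zero (α := Mode ⊗[ℂ] Mode) ▸ Submodule.zero_mem _
    | tmul φ ψ => exact Submodule.subset_span ⟨(φ, ψ), rfl⟩
    | add s t hs ht => exact UniformSpace.Completion.coe_add s t ▸ Submodule.add_mem _ hs ht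
  exact UniformSpace.Completion.denseRange_coe.mono (Set.range_subset_iff.2 hmem)

theorem dense_span_tensorVec_of_dense {ι κ : Type*} {e : ι → Mode} {f : κ → Mode}
    (he : Dense (Submodule.span ℂ (Set.range e) : Set Mode))
    (hf : Dense (Submodule.span ℂ (Set.range f) : Set Mode)) :
    Dense (Submodule.span ℂ (Set.range fun p : ι × κ => tensorVec (e p.1) (f p.2)) :
      Set TwoModes) := by
  set S := (Submodule.span ℂ
    (Set.range fun p : ι × κ => tensorVec (e p.1) (f p.2))).topologicalClosure
  have hS : IsClosed (S : Set TwoModes) := Submodule.isClosed_topologicalClosure _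
  have hright : ∀ i ψ, tensorVec (e i) ψ ∈ S := fun i =>
    mem_of_dense_span_range (S := S.comap (tensorVecL (e i)).toLinearMap) hf
      (hS.preimage (tensorVecL (e i)).continuous) fun k =>
        Submodule.le_topologicalClosure _ (Submodule.subset_span ⟨(i, k), rfl⟩)
  have hleft : ∀ φ ψ, tensorVec φ ψ ∈ S := fun φ ψ =>
    mem_of_dense_span_range (S := S.comap (tensorVecL.flip ψ).toLinearMap) he
      (hS.preimage (tensorVecL.flip ψ).continuous) (fun i => hright i ψ) φ
  rw [Submodule.dense_iff_topologicalClosure_eq_top, Submodule.eq_top_iff']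
  exact mem_of_dense_span_range dense_span_tensorVec hS fun p => hleft p.1 p.2

theorem ext_tensorVec {F : Type*} [NormedAddCommGroup F] [NormedSpace ℂ F]
    {S T : TwoModes →L[ℂ] F} (h : ∀ φ ψ, S (tensorVec φ ψ) = T (tensorVec φ ψ)) : S = T :=
  ContinuousLinearMap.ext_on dense_span_tensorVec (Set.forall_mem_range.2 fun p => h p.1 p.2)

theorem ext_inner_tensorVec {S T : TwoModes →L[ℂ] TwoModes}
    (h : ∀ φ ψ φ' ψ', inner ℂ (tensorVec φ ψ) (S (tensorVec φ' ψ')) =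
      inner ℂ (tensorVec φ ψ) (T (tensorVec φ' ψ'))) : S = T := by
  refine ext_tensorVec fun φ' ψ' => ext_inner_right ℂ fun t => ?_
  have hleft : innerSL ℂ (S (tensorVec φ' ψ')) = innerSL ℂ (T (tensorVec φ' ψ')) :=
    ext_tensorVec fun φ ψ => by
      rw [innerSL_apply_apply, innerSL_apply_apply, ← inner_conj_symm, h, inner_conj_symm]
  exact DFunLike.congr_fun hleft t

theorem tensorOp_one : tensorOp 1 1 = 1 :=
  ext_tensorVec fun φ ψ => tensorOp_tensorVec 1 1 φ ψ

theorem tensorOp_mul (A B A' B' : Mode →L[ℂ] Mode) :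
    tensorOp A B * tensorOp A' B' = tensorOp (A * A') (B * B') :=
  ext_tensorVec fun φ ψ => by simp only [mul_apply_eq_comp, tensorOp_tensorVec]

theorem adjoint_tensorOp (A B : Mode →L[ℂ] Mode) :
    ContinuousLinearMap.adjoint (tensorOp A B) =
      tensorOp (ContinuousLinearMap.adjoint A) (ContinuousLinearMap.adjoint B) :=
  ext_inner_tensorVec fun φ ψ φ' ψ' => by
    simp only [ContinuousLinearMap.adjoint_inner_right, tensorOp_tensorVec, inner_tensorVec]

theorem hasSum_mul_prod {𝕜 ι κ : Type*} [RCLike 𝕜] {f : ι → 𝕜} {g : κ → 𝕜} {a b : 𝕜}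
    (hf : HasSum f a) (hg : HasSum g b) : HasSum (fun p : ι × κ => f p.1 * g p.2) (a * b) :=
  hf.mul hg (summable_mul_of_summable_norm hf.summable.norm hg.summable.norm)

theorem isEnsemble_tensorOp {ι κ : Type*} {ρ σ : Mode →L[ℂ] Mode} {u : ι → Mode} {v : κ → Mode}
    (hρ : IsEnsemble ρ u) (hσ : IsEnsemble σ v) :
    IsEnsemble (tensorOp ρ σ) fun p : ι × κ => tensorVec (u p.1) (v p.2) := by
  have hsq : Summable fun p : ι × κ => ‖tensorVec (u p.1) (v p.2)‖ ^ 2 := by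
    simp only [norm_tensorVec, mul_pow]
    exact hρ.summable_norm_sq.mul_of_nonneg hσ.summable_norm_sq (fun _ => sq_nonneg _)
      fun _ => sq_nonneg _
  obtain ⟨T, hT⟩ := exists_isEnsemble_of_summable hsq
  have hTρσ : T = tensorOp ρ σ := by
    refine ext_inner_tensorVec fun φ ψ φ' ψ' => ?_
    have hprod := hasSum_mul_prod (hρ.hasSum_inner φ φ') (hσ.hasSum_inner ψ ψ')
    have hT := hT.hasSum_inner (tensorVec φ ψ) (tensorVec φ' ψ')
    simp only [inner_tensorVec, mul_mul_mul_comm _ (inner ℂ ψ _)] at hT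
    rw [tensorOp_tensorVec, inner_tensorVec]
    exact hT.unique hprod
  rwa [hTρσ] at hT

/-! ### The beam splitter -/

theorem exists_linearIsometryEquiv_of_inner_eq {K L ι : Type*} [NormedAddCommGroup K]
    [InnerProductSpace ℂ K] [CompleteSpace K] [NormedAddCommGroup L] [InnerProductSpace ℂ L]
    [CompleteSpace L] {e : ι → K} {f : ι → L}
    (h : ∀ i j, inner ℂ (e i) (e j) = inner ℂ (f i) (f j))
    (he : Dense (Submodule.span ℂ (Set.range e) : Set K))
    (hf : Dense (Submodule.span ℂ (Set.range f) : Set L)) :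
    ∃ U : K ≃ₗᵢ[ℂ] L, ∀ i, U (e i) = f i := by
  rw [← Finsupp.range_linearCombination, LinearMap.coe_range] at he hf
  have hnorm : ∀ c : ι →₀ ℂ, ‖Finsupp.linearCombination ℂ f (LinearEquiv.refl ℂ _ c)‖ =
      ‖Finsupp.linearCombination ℂ e c‖ := fun c => by
    simp only [LinearEquiv.refl_apply, norm_eq_sqrt_re_inner (𝕜 := ℂ),
      Finsupp.linearCombination_apply, Finsupp.sum, sum_inner, inner_sum, inner_smul_left,
      inner_smul_right, h]
  refine ⟨(LinearEquiv.refl ℂ (ι →₀ ℂ)).extendOfIsometry (Finsupp.linearCombination ℂ e)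
    (Finsupp.linearCombination ℂ f) he hf hnorm, fun i => ?_⟩
  simpa using LinearEquiv.extendOfIsometry_eq (LinearEquiv.refl ℂ (ι →₀ ℂ)) _ _ he hf hnorm
    (Finsupp.single i 1)

/-- Both sides carry the same normalization because `(z, w) ↦ ((z - w)/√2, (z + w)/√2)` preserves
`|z|² + |w|²`. -/
theorem apply_tensorVec_coherentState_iff (U : TwoModes ≃ₗᵢ[ℂ] TwoModes) (z w : ℂ) :
    U (tensorVec (coherentState z) (coherentState w)) =
      tensorVec (coherentState ((z - w) / (√2 : ℝ))) (coherentState ((z + w) / (√2 : ℝ))) ↔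
    U (tensorVec (expVec z) (expVec w)) =
      tensorVec (expVec ((z - w) / (√2 : ℝ))) (expVec ((z + w) / (√2 : ℝ))) := by
  have hexp : ∀ z w : ℂ, (Real.exp (-(‖z‖ ^ 2 / 2)) : ℂ) * (Real.exp (-(‖w‖ ^ 2 / 2)) : ℂ) =
      ((Real.exp (-((‖z‖ ^ 2 + ‖w‖ ^ 2) / 2)) : ℝ) : ℂ) := fun z w => by
    rw [← Complex.ofReal_mul, ← Real.exp_add]
    ring_nf
  have hnorm : ‖(z - w) / (√2 : ℝ)‖ ^ 2 + ‖(z + w) / (√2 : ℝ)‖ ^ 2 = ‖z‖ ^ 2 + ‖w‖ ^ 2 := by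
    simp only [norm_div, Complex.norm_real, Real.norm_eq_abs, div_pow, sq_abs]
    rw [Real.sq_sqrt (by norm_num)]
    linarith [parallelogram_law_with_norm ℝ z w]
  simp only [coherentState_eq_smul_expVec, tensorVec_smul_smul, hexp, hnorm, map_smul]
  exact (smul_right_injective TwoModes
    (Complex.ofReal_ne_zero.2 (Real.exp_pos _).ne')).eq_iff

theorem inner_tensorVec_expVec_rotate (z w z' w' : ℂ) :
    inner ℂ (tensorVec (expVec z) (expVec w)) (tensorVec (expVec z') (expVec w')) =
      inner ℂ (tensorVec (expVec ((z - w) / (√2 : ℝ))) (expVec ((z + w) / (√2 : ℝ))))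
        (tensorVec (expVec ((z' - w') / (√2 : ℝ))) (expVec ((z' + w') / (√2 : ℝ)))) := by
  simp only [inner_tensorVec, inner_expVec, ← Complex.exp_add, map_div₀, map_sub, map_add,
    Complex.conj_ofReal, div_mul_div_comm, ← sq, ofReal_sqrt_two_sq]
  ring_nf

theorem dense_span_tensorVec_expVec_rotate :
    Dense (Submodule.span ℂ (Set.range fun p : ℂ × ℂ => tensorVec
      (expVec ((p.1 - p.2) / (√2 : ℝ))) (expVec ((p.1 + p.2) / (√2 : ℝ)))) : Set TwoModes) := by
  have hhalf : ∀ c : ℂ, 2 * c / (√2 : ℝ) / (√2 : ℝ) = c := fun c => by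
    rw [div_div, ← sq, ofReal_sqrt_two_sq, mul_div_cancel_left₀ c two_ne_zero]
  have hsurj : Function.Surjective fun p : ℂ × ℂ =>
      ((p.1 - p.2) / ((√2 : ℝ) : ℂ), (p.1 + p.2) / ((√2 : ℝ) : ℂ)) := fun p => by
    refine ⟨((p.1 + p.2) / (√2 : ℝ), (p.2 - p.1) / (√2 : ℝ)), Prod.ext ?_ ?_⟩
    · exact Eq.trans (by ring) (hhalf p.1)
    · exact Eq.trans (by ring) (hhalf p.2)
  exact hsurj.range_comp (fun p : ℂ × ℂ => tensorVec (expVec p.1) (expVec p.2)) ▸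
    dense_span_tensorVec_of_dense dense_span_expVec dense_span_expVec

theorem beamSplitter_expVec (z w : ℂ) :
    beamSplitter (tensorVec (expVec z) (expVec w)) =
      tensorVec (expVec ((z - w) / (√2 : ℝ))) (expVec ((z + w) / (√2 : ℝ))) := by
  obtain ⟨U, hU⟩ := exists_linearIsometryEquiv_of_inner_eq
    (fun p q : ℂ × ℂ => inner_tensorVec_expVec_rotate p.1 p.2 q.1 q.2)
    (dense_span_tensorVec_of_dense dense_span_expVec dense_span_expVec)
    dense_span_tensorVec_expVec_rotate
  refine (apply_tensorVec_coherentState_iff beamSplitter z w).1 ?_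
  exact Classical.epsilon_spec (p := fun U : TwoModes ≃ₗᵢ[ℂ] TwoModes => ∀ z w : ℂ,
    U (tensorVec (coherentState z) (coherentState w)) =
      tensorVec (coherentState ((z - w) / (√2 : ℝ))) (coherentState ((z + w) / (√2 : ℝ))))
    ⟨U, fun z w => (apply_tensorVec_coherentState_iff U z w).2 (hU (z, w))⟩ z w

/-! ### Multiplication by indicator functions -/

section Indicator

variable {α : Type*} [MeasurableSpace α] {μ : Measure α}

open Classical in
/-- The operator of multiplication by the indicator function of `X` on `L²(μ)`; it is `0` if `X` is
not measurable. -/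
def indicatorOp (μ : Measure α) (X : Set α) : Lp ℂ 2 μ →L[ℂ] Lp ℂ 2 μ :=
  if hX : MeasurableSet X then
    (ContinuousLinearMap.lsmul ℂ ℂ).holderL μ ⊤ 2 2
      (((memLp_top_const (1 : ℂ)).indicator hX).toLp (X.indicator fun _ => 1))
  else 0

theorem coeFn_indicatorOp {X : Set α} (hX : MeasurableSet X) (ψ : Lp ℂ 2 μ) :
    indicatorOp μ X ψ =ᵐ[μ] X.indicator ψ := by
  rw [indicatorOp, dif_pos hX]
  filter_upwards [ContinuousLinearMap.coeFn_holder (r := 2) (ContinuousLinearMap.lsmul ℂ ℂ)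
      (((memLp_top_const (1 : ℂ)).indicator hX).toLp (X.indicator fun _ => 1)) ψ,
    ((memLp_top_const (μ := μ) (1 : ℂ)).indicator hX).coeFn_toLp] with x hmul hind
  refine hmul.trans ?_
  rw [hind]
  by_cases hx : x ∈ X <;> simp [hx]

theorem inner_indicatorOp {X : Set α} (hX : MeasurableSet X) (φ ψ : Lp ℂ 2 μ) :
    inner ℂ φ (indicatorOp μ X ψ) = ∫ x in X, inner ℂ (φ x) (ψ x) ∂μ := by
  rw [L2.inner_def, ← integral_indicator hX]
  refine integral_congr_ae ?_
  filter_upwards [coeFn_indicatorOp hX ψ] with x hx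
  rw [hx]
  by_cases h : x ∈ X <;> simp [h]

theorem inner_indicatorOp_self {X : Set α} (hX : MeasurableSet X) (ψ : Lp ℂ 2 μ) :
    inner ℂ ψ (indicatorOp μ X ψ) = ((∫ x in X, ‖ψ x‖ ^ 2 ∂μ : ℝ) : ℂ) := by
  rw [inner_indicatorOp hX, ← integral_complex_ofReal]
  refine integral_congr_ae (.of_forall fun x => ?_)
  simp [inner_self_eq_norm_sq_to_K]

theorem indicatorOp_mul_self (X : Set α) :
    indicatorOp μ X * indicatorOp μ X = indicatorOp μ X := by
  by_cases hX : MeasurableSet X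
  · ext1 ψ
    refine Lp.ext ?_
    filter_upwards [coeFn_indicatorOp hX ψ, coeFn_indicatorOp hX (indicatorOp μ X ψ)] with x h1 h2
    rw [mul_apply_eq_comp, h2, h1]
    by_cases h : x ∈ X <;> simp [h, h1]
  · simp [indicatorOp, hX]

/-- The canonical projection valued measure `X ↦ 1_X` on `L²(μ)`. -/
def indicatorObservable (μ : Measure α) : Observable α (Lp ℂ 2 μ) where
  toFun := indicatorOp μ
  isPositive X hX := by
    rw [ContinuousLinearMap.isPositive_iff_complex]
    intro ψ
    rw [← inner_conj_symm, inner_indicatorOp_self hX, Complex.conj_ofReal]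
    exact ⟨rfl, integral_nonneg fun x => by positivity⟩
  map_univ := by
    ext1 ψ
    refine Lp.ext ?_
    filter_upwards [coeFn_indicatorOp MeasurableSet.univ ψ] with x hx
    rw [hx, Set.indicator_univ, one_apply_eq_self]
  hasSum_iUnion X hX hd φ ψ := by
    simp only [inner_indicatorOp (hX _), inner_indicatorOp (MeasurableSet.iUnion hX)]
    exact hasSum_integral_iUnion hX hd (L2.integrable_inner φ ψ).integrableOn
  not_measurable X hX := by rw [indicatorOp, dif_neg hX]

end Indicator

/-! ### The two-mode space as a space of functions on the plane -/

section PlaneRepresentation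

variable {α β : Type*} [MeasurableSpace α] [MeasurableSpace β] {μ : Measure α} {ν : Measure β}

theorem ae_fst {P : α → Prop} (h : ∀ᵐ x ∂μ, P x) : ∀ᵐ p ∂μ.prod ν, P p.1 :=
  Measure.quasiMeasurePreserving_fst.ae h

theorem ae_snd {P : β → Prop} (h : ∀ᵐ y ∂ν, P y) : ∀ᵐ p ∂μ.prod ν, P p.2 :=
  Measure.quasiMeasurePreserving_snd.ae h

theorem memLp_two_mul_prod (φ : Lp ℂ 2 μ) (ψ : Lp ℂ 2 ν) :
    MemLp (fun p : α × β => φ p.1 * ψ p.2) 2 (μ.prod ν) := by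
  have hm : AEStronglyMeasurable (fun p : α × β => φ p.1 * ψ p.2) (μ.prod ν) :=
    (Lp.aestronglyMeasurable φ).comp_fst.mul (Lp.aestronglyMeasurable ψ).comp_snd
  rw [memLp_two_iff_integrable_sq_norm hm]
  simp only [norm_mul, mul_pow]
  exact ((memLp_two_iff_integrable_sq_norm (Lp.aestronglyMeasurable φ)).1 (Lp.memLp φ)).mul_prod
    ((memLp_two_iff_integrable_sq_norm (Lp.aestronglyMeasurable ψ)).1 (Lp.memLp ψ))

/-- The function `(x, y) ↦ φ x * ψ y` as an element of `L²(μ × ν)`, bilinear in `φ` and `ψ`. -/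
def prodVec : Lp ℂ 2 μ →ₗ[ℂ] Lp ℂ 2 ν →ₗ[ℂ] Lp ℂ 2 (μ.prod ν) :=
  LinearMap.mk₂ ℂ (fun φ ψ => (memLp_two_mul_prod φ ψ).toLp _)
    (fun φ φ' ψ => by
      rw [← MemLp.toLp_add]
      refine MemLp.toLp_congr _ _ ?_
      filter_upwards [ae_fst (Lp.coeFn_add φ φ')] with p hp
      simp only [hp, Pi.add_apply, add_mul])
    (fun c φ ψ => by
      rw [← MemLp.toLp_const_smul]
      refine MemLp.toLp_congr _ _ ?_
      filter_upwards [ae_fst (Lp.coeFn_smul c φ)] with p hp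
      simp only [hp, Pi.smul_apply, smul_eq_mul, mul_assoc])
    (fun φ ψ ψ' => by
      rw [← MemLp.toLp_add]
      refine MemLp.toLp_congr _ _ ?_
      filter_upwards [ae_snd (Lp.coeFn_add ψ ψ')] with p hp
      simp only [hp, Pi.add_apply, mul_add])
    (fun c φ ψ => by
      rw [← MemLp.toLp_const_smul]
      refine MemLp.toLp_congr _ _ ?_
      filter_upwards [ae_snd (Lp.coeFn_smul c ψ)] with p hp
      simp only [hp, Pi.smul_apply, smul_eq_mul, mul_left_comm])

theorem coeFn_prodVec (φ : Lp ℂ 2 μ) (ψ : Lp ℂ 2 ν) :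
    prodVec φ ψ =ᵐ[μ.prod ν] fun p => φ p.1 * ψ p.2 :=
  (memLp_two_mul_prod φ ψ).coeFn_toLp

theorem indicatorOp_prodVec {X : Set α} {Y : Set β} (hX : MeasurableSet X) (hY : MeasurableSet Y)
    (φ : Lp ℂ 2 μ) (ψ : Lp ℂ 2 ν) :
    indicatorOp (μ.prod ν) (X ×ˢ Y) (prodVec φ ψ) =
      prodVec (indicatorOp μ X φ) (indicatorOp ν Y ψ) := by
  refine Lp.ext ?_
  filter_upwards [coeFn_indicatorOp (hX.prod hY) (prodVec φ ψ), coeFn_prodVec φ ψ,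
    coeFn_prodVec (indicatorOp μ X φ) (indicatorOp ν Y ψ), ae_fst (coeFn_indicatorOp hX φ),
    ae_snd (coeFn_indicatorOp hY ψ)] with p hleft hprod hright hφ hψ
  rw [hleft, hright, hφ, hψ]
  by_cases hx : p.1 ∈ X <;> by_cases hy : p.2 ∈ Y <;>
    simp [Set.indicator, Set.mem_prod, hx, hy, hprod]

theorem inner_prodVec [SFinite μ] [SFinite ν] (φ φ' : Lp ℂ 2 μ) (ψ ψ' : Lp ℂ 2 ν) :
    inner ℂ (prodVec φ ψ) (prodVec φ' ψ') = inner ℂ φ φ' * inner ℂ ψ ψ' := by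
  rw [L2.inner_def, L2.inner_def, L2.inner_def, ← integral_prod_mul]
  refine integral_congr_ae ?_
  filter_upwards [coeFn_prodVec φ ψ, coeFn_prodVec φ' ψ'] with p h h'
  rw [h, h']
  simp only [RCLike.inner_apply, map_mul]
  ring

theorem inner_lift_prodVec [SFinite μ] [SFinite ν] (x y : Lp ℂ 2 μ ⊗[ℂ] Lp ℂ 2 ν) :
    inner ℂ (TensorProduct.lift prodVec x) (TensorProduct.lift prodVec y) = inner ℂ x y := by
  induction x using TensorProduct.induction_on with
  | zero => simp
  | add x x' hx hx' => rw [map_add, inner_add_left, inner_add_left, hx, hx']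
  | tmul φ ψ =>
    induction y using TensorProduct.induction_on with
    | zero => simp
    | add y y' hy hy' => rw [map_add, inner_add_right, inner_add_right, hy, hy']
    | tmul φ' ψ' =>
      rw [TensorProduct.lift.tmul, TensorProduct.lift.tmul, inner_prodVec, TensorProduct.inner_tmul]

theorem norm_lift_prodVec [SFinite μ] [SFinite ν] (x : Lp ℂ 2 μ ⊗[ℂ] Lp ℂ 2 ν) :
    ‖TensorProduct.lift prodVec x‖ = ‖x‖ := by
  rw [norm_eq_sqrt_re_inner (𝕜 := ℂ), norm_eq_sqrt_re_inner (𝕜 := ℂ), inner_lift_prodVec]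

end PlaneRepresentation

theorem exists_linearIsometry_completion {V F : Type*} [NormedAddCommGroup V] [NormedSpace ℂ V]
    [NormedAddCommGroup F] [NormedSpace ℂ F] [CompleteSpace F] (f : V →ₗ[ℂ] F)
    (hf : ∀ x, ‖f x‖ = ‖x‖) :
    ∃ T : UniformSpace.Completion V →ₗᵢ[ℂ] F, ∀ x : V, T x = f x := by
  let e : V →ₗ[ℂ] UniformSpace.Completion V := UniformSpace.Completion.toComplL.toLinearMap
  have he : DenseRange e := UniformSpace.Completion.denseRange_coe
  have hnorm : ∀ x, ‖e x‖ = ‖x‖ := UniformSpace.Completion.norm_coe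
  have hext : ∀ x, f.extendOfNorm e (e x) = f x :=
    LinearMap.extendOfNorm_eq he ⟨1, fun x => by rw [one_mul, hf, hnorm]⟩
  refine ⟨⟨(f.extendOfNorm e).toLinearMap, fun t => ?_⟩, hext⟩
  refine he.induction_on t (isClosed_eq ?_ continuous_norm) fun x => ?_
  · exact (f.extendOfNorm e).continuous.norm
  · rw [ContinuousLinearMap.coe_coe, hext, hf, hnorm]

/-- `L²(ℝ²)`. -/
abbrev PlaneL2 : Type := Lp ℂ 2 (volume : Measure (ℝ × ℝ))

/-- The isometry from the two-mode space to `L²(ℝ²)` with `φ ⊗ ψ ↦ φ(x) ψ(y)`. -/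
def planeRep : TwoModes →ₗᵢ[ℂ] PlaneL2 :=
  (exists_linearIsometry_completion (TensorProduct.lift prodVec) norm_lift_prodVec).choose

theorem planeRep_tensorVec (φ ψ : Mode) : planeRep (tensorVec φ ψ) = prodVec φ ψ :=
  ((exists_linearIsometry_completion (TensorProduct.lift prodVec)
    norm_lift_prodVec).choose_spec _).trans (TensorProduct.lift.tmul φ ψ)

theorem planeRep_tensorOp_indicatorOp {X Y : Set ℝ} (hX : MeasurableSet X) (hY : MeasurableSet Y)
    (t : TwoModes) :
    planeRep (tensorOp (indicatorOp volume X) (indicatorOp volume Y) t) =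
      indicatorOp volume (X ×ˢ Y) (planeRep t) := by
  have h : planeRep.toContinuousLinearMap.comp
      (tensorOp (indicatorOp volume X) (indicatorOp volume Y)) =
      (indicatorOp volume (X ×ˢ Y)).comp planeRep.toContinuousLinearMap := by
    refine ext_tensorVec fun φ ψ => ?_
    simp only [ContinuousLinearMap.comp_apply, LinearIsometry.coe_toContinuousLinearMap,
      tensorOp_tensorVec, planeRep_tensorVec]
    exact (indicatorOp_prodVec hX hY φ ψ).symm
  exact DFunLike.congr_fun h t

/-! ### Positive operator measures -/

theorem ext_inner_self {K : Type*} [NormedAddCommGroup K] [InnerProductSpace ℂ K] {S T : K →L[ℂ] K}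
    (h : ∀ ψ, inner ℂ ψ (S ψ) = inner ℂ ψ (T ψ)) : S = T := by
  refine ContinuousLinearMap.coe_injective ((ext_inner_map _ _).1 fun ψ => ?_)
  rw [← inner_conj_symm, ← inner_conj_symm _ ψ]
  exact congrArg _ (h ψ)

namespace Observable

variable {α K : Type*} [MeasurableSpace α] [NormedAddCommGroup K] [InnerProductSpace ℂ K]

theorem measure_apply (E : Observable α K) (ψ : K) {X : Set α} (hX : MeasurableSet X) :
    E.measure ψ X = ENNReal.ofReal (inner ℂ ψ (E X ψ)).re :=
  Measure.ofMeasurable_apply X hX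

theorem inner_left (E : Observable α K) {X : Set α} (hX : MeasurableSet X) (φ ψ : K) :
    inner ℂ (E X φ) ψ = inner ℂ φ (E X ψ) :=
  (E.isPositive X hX).isSymmetric φ ψ

theorem inner_eq_measure (E : Observable α K) (ψ : K) {X : Set α} (hX : MeasurableSet X) :
    inner ℂ ψ (E X ψ) = ((E.measure ψ).real X : ℂ) := by
  have hreal : starRingEnd ℂ (inner ℂ ψ (E X ψ)) = inner ℂ ψ (E X ψ) := by
    rw [inner_conj_symm, E.inner_left hX]
  have hnonneg : 0 ≤ (inner ℂ ψ (E X ψ)).re := (E.isPositive X hX).re_inner_nonneg_right ψ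
  rw [Measure.real, E.measure_apply ψ hX, ENNReal.toReal_ofReal hnonneg,
    Complex.conj_eq_iff_re.1 hreal]

instance isFiniteMeasure_measure (E : Observable α K) (ψ : K) : IsFiniteMeasure (E.measure ψ) :=
  ⟨by rw [E.measure_apply ψ MeasurableSet.univ]; exact ENNReal.ofReal_lt_top⟩

theorem measureReal_univ (E : Observable α K) (ψ : K) : (E.measure ψ).real Set.univ = ‖ψ‖ ^ 2 := by
  have h := E.inner_eq_measure ψ MeasurableSet.univ
  rw [E.map_univ, one_apply_eq_self, inner_self_eq_norm_sq_to_K] at h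
  refine Complex.ofReal_injective (h.symm.trans ?_)
  push_cast
  rfl

theorem ext_of_measure {E F : Observable α K} (h : ∀ ψ, E.measure ψ = F.measure ψ) : E = F := by
  have : E.toFun = F.toFun := by
    funext X
    by_cases hX : MeasurableSet X
    · refine ext_inner_self fun ψ => ?_
      rw [E.inner_eq_measure ψ hX, F.inner_eq_measure ψ hX, h]
    · rw [E.not_measurable X hX, F.not_measurable X hX]
  cases E; cases F; cases this; rfl

theorem map_union (E : Observable α K) {X Y : Set α} (hX : MeasurableSet X) (hY : MeasurableSet Y)
    (h : Disjoint X Y) : E (X ∪ Y) = E X + E Y := by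
  refine ext_inner_self fun ψ => ?_
  rw [E.inner_eq_measure ψ (hX.union hY), add_apply, inner_add_right, E.inner_eq_measure ψ hX,
    E.inner_eq_measure ψ hY, measureReal_union h hY, Complex.ofReal_add]

theorem apply_add_apply_compl (E : Observable α K) {X : Set α} (hX : MeasurableSet X) (ψ : K) :
    E X ψ + E Xᶜ ψ = ψ := by
  rw [← add_apply, ← E.map_union hX hX.compl disjoint_compl_right, Set.union_compl_self,
    E.map_univ, one_apply_eq_self]

theorem mul_eq_zero_comm (E F : Observable α K) {X Y : Set α} (hX : MeasurableSet X)
    (hY : MeasurableSet Y) : E X * F Y = 0 ↔ F Y * E X = 0 := by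
  have key : ∀ (E F : Observable α K) {X Y : Set α}, MeasurableSet X → MeasurableSet Y →
      E X * F Y = 0 → F Y * E X = 0 := fun E F X Y hX hY h => by
    ext1 ψ
    refine ext_inner_left ℂ fun φ => ?_
    rw [mul_apply_eq_comp, ← F.inner_left hY, ← E.inner_left hX, ← mul_apply_eq_comp, h]
    simp
  exact ⟨key E F hX hY, key F E hY hX⟩

theorem apply_eq_zero_iff {E : Observable α K} (hE : ∀ X, E X * E X = E X) {X : Set α}
    (hX : MeasurableSet X) (ψ : K) : E X ψ = 0 ↔ E.measure ψ X = 0 := by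
  rw [← inner_self_eq_zero (𝕜 := ℂ), E.inner_left hX, ← mul_apply_eq_comp, hE,
    E.inner_eq_measure ψ hX, Complex.ofReal_eq_zero, measureReal_eq_zero_iff]

theorem mul_eq_zero_of_disjoint {E : Observable α K} (hE : ∀ X, E X * E X = E X) {X Y : Set α}
    (hX : MeasurableSet X) (hY : MeasurableSet Y) (h : Disjoint X Y) : E X * E Y = 0 := by
  ext1 ψ
  have hYc : E Yᶜ (E Y ψ) = 0 := by
    have := E.apply_add_apply_compl hY (E Y ψ)
    rwa [← mul_apply_eq_comp, hE, add_eq_left] at this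
  rw [mul_apply_eq_comp, zero_apply, apply_eq_zero_iff hE hX]
  exact measure_mono_null h.subset_compl_right ((apply_eq_zero_iff hE hY.compl _).1 hYc)

theorem mul_eq_inter {E : Observable α K} (hE : ∀ X, E X * E X = E X) {X Y : Set α}
    (hX : MeasurableSet X) (hY : MeasurableSet Y) : E X * E Y = E (X ∩ Y) := by
  have hsplit : ∀ {X Y : Set α}, MeasurableSet X → MeasurableSet Y →
      E X = E (X ∩ Y) + E (X \ Y) := fun {X Y} hX hY => by
    rw [← E.map_union (hX.inter hY) (hX.diff hY)
      (Set.disjoint_sdiff_right.mono_left Set.inter_subset_right), Set.inter_union_sdiff]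
  rw [hsplit hX hY, add_mul, mul_eq_zero_of_disjoint hE (hX.diff hY) hY Set.disjoint_sdiff_left,
    add_zero, hsplit hY hX, Set.inter_comm Y, mul_add, hE,
    mul_eq_zero_of_disjoint hE (hX.inter hY) (hY.diff hX)
      (Set.disjoint_sdiff_right.mono_left Set.inter_subset_left), add_zero]

theorem measure_apply_restrict {E : Observable α K} (hE : ∀ X, E X * E X = E X) {A : Set α}
    (hA : MeasurableSet A) (ψ : K) : E.measure (E A ψ) = (E.measure ψ).restrict A := by
  ext X hX
  rw [Measure.restrict_apply hX, E.measure_apply _ hX, E.measure_apply _ (hX.inter hA),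
    E.inner_left hA, ← mul_apply_eq_comp (E X), mul_eq_inter hE hX hA, ← mul_apply_eq_comp,
    mul_eq_inter hE hA (hX.inter hA), Set.inter_comm A, Set.inter_assoc, Set.inter_self]

theorem measure_eq_restrict {E : Observable α K} (hE : ∀ X, E X * E X = E X) {A : Set α}
    (hA : MeasurableSet A) {ψ : K} (hψ : E A ψ = ψ) : E.measure ψ = (E.measure ψ).restrict A := by
  rw [← measure_apply_restrict hE hA, hψ]

theorem mul_eq_zero_of_forall_subset {β : Type*} [MeasurableSpace β] {E : Observable α K}
    (hE : ∀ X, E X * E X = E X) {X : Set α} (hX : MeasurableSet X) {s : ℕ → Set α}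
    (hs : ∀ n, MeasurableSet (s n)) (hXs : X ⊆ ⋃ n, s n) (F : Observable β K) {Y : Set β}
    (h : ∀ n, E (s n) * F Y = 0) : E X * F Y = 0 := by
  ext1 ψ
  rw [mul_apply_eq_comp, zero_apply, apply_eq_zero_iff hE hX]
  refine measure_mono_null hXs (measure_iUnion_null fun n => ?_)
  rw [← apply_eq_zero_iff hE (hs n), ← mul_apply_eq_comp, h, zero_apply]

end Observable

/-! ### Uniqueness of spectral measures -/

theorem norm_apply_le_of_abs_inner_le {V : Type*} [NormedAddCommGroup V] [InnerProductSpace ℂ V]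
    {B : V →ₗ[ℂ] V} {r : ℝ} (hr : 0 < r)
    (hB : ∀ x, ∃ s : ℝ, |s| ≤ r * ‖x‖ ^ 2 ∧ inner ℂ x (B x) = s) (u : V) : ‖B u‖ ≤ r * ‖u‖ := by
  have hsymm : B.IsSymmetric := by
    refine (LinearMap.isSymmetric_iff_inner_map_self_real B).2 fun x => ?_
    obtain ⟨s, -, hs⟩ := hB x
    rw [← inner_conj_symm (B x), hs, Complex.conj_ofReal, Complex.conj_ofReal]
  have hre : ∀ x, |RCLike.re (inner ℂ x (B x))| ≤ r * ‖x‖ ^ 2 := fun x => by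
    obtain ⟨s, hle, hs⟩ := hB x
    rwa [hs, ← RCLike.ofReal_eq_complex_ofReal, RCLike.ofReal_re]
  -- Polarization and the parallelogram law bound `Re ⟪v, B u⟫`; take `v = r⁻¹ • B u`.
  have hpolar : ∀ v, 2 * RCLike.re (inner ℂ v (B u)) ≤ r * (‖u‖ ^ 2 + ‖v‖ ^ 2) := fun v => by
    have hcross : RCLike.re (inner ℂ u (B v)) = RCLike.re (inner ℂ v (B u)) := by
      rw [← hsymm, inner_re_symm]
    have hadd := (abs_le.1 (hre (u + v))).2
    have hsub := (abs_le.1 (hre (u - v))).1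
    simp only [map_add, map_sub, inner_add_left, inner_add_right, inner_sub_left,
      inner_sub_right, hcross] at hadd hsub
    nlinarith [parallelogram_law_with_norm ℂ u v]
  have h := hpolar ((r⁻¹ : ℂ) • B u)
  rw [← Complex.ofReal_inv, inner_smul_left, Complex.conj_ofReal, inner_self_eq_norm_sq_to_K,
    norm_smul, Complex.norm_real, Real.norm_of_nonneg (by positivity)] at h
  have hval : RCLike.re (((r⁻¹ : ℝ) : ℂ) * (‖B u‖ : ℂ) ^ 2) = r⁻¹ * ‖B u‖ ^ 2 := by
    rw [← Complex.ofReal_pow, ← Complex.ofReal_mul]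
    exact Complex.ofReal_re _
  refine le_of_sq_le_sq ?_ (by positivity)
  have h' := mul_le_mul_of_nonneg_left (hval ▸ h) hr.le
  field_simp at h'
  linarith

section Spectral

variable {K : Type*} [NormedAddCommGroup K] [InnerProductSpace ℂ K] {T : K →ₗ.[ℂ] K}
  {E F : Observable ℝ K}

namespace IsSpectralMeasure

theorem apply_mem_domain (hE : IsSpectralMeasure E T) {A : Set ℝ} (hA : MeasurableSet A) {φ : K}
    (hφ : φ ∈ T.domain) : E A φ ∈ T.domain := by
  rw [hE.2.1] at hφ ⊢
  rw [Observable.measure_apply_restrict hE.1 hA]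
  exact hφ.restrict

theorem mem_domain_of_apply_Icc_eq (hE : IsSpectralMeasure E T) {a b : ℝ} {φ : K}
    (hφ : E (Set.Icc a b) φ = φ) : φ ∈ T.domain := by
  rw [hE.2.1, Observable.measure_eq_restrict hE.1 measurableSet_Icc hφ]
  exact (continuous_pow 2).continuousOn.integrableOn_Icc

theorem integrable_id (hE : IsSpectralMeasure E T) (φ : T.domain) :
    Integrable (fun x : ℝ => x) (E.measure (φ : K)) := by
  have h := (hE.2.1 φ).1 φ.2
  refine (h.add (integrable_const 1)).mono' (by fun_prop) (.of_forall fun x => ?_)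
  rw [Real.norm_eq_abs, Pi.add_apply]
  nlinarith [sq_abs x, sq_nonneg (|x| - 1)]

theorem inner_eq_add (hE : IsSpectralMeasure E T) {A : Set ℝ} (hA : MeasurableSet A)
    {u v w : T.domain} (hu : E A v = u) (hw : E Aᶜ v = w) :
    inner ℂ (v : K) (T v) = inner ℂ (u : K) (T u) + inner ℂ (w : K) (T w) := by
  rw [hE.2.2, hE.2.2, hE.2.2, ← hu, ← hw, Observable.measure_apply_restrict hE.1 hA,
    Observable.measure_apply_restrict hE.1 hA.compl, ← integral_add_compl hA (hE.integrable_id v),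
    Complex.ofReal_add]

theorem inner_apply_eq_zero (hE : IsSpectralMeasure E T) {A : Set ℝ} (hA : MeasurableSet A)
    {u w : T.domain} (hu : E A u = u) (hw : E Aᶜ w = w) : inner ℂ (w : K) (T u) = 0 := by
  have hAw : ∀ {w : T.domain}, E Aᶜ w = w → E A w = 0 := fun {w} hw => by
    rw [← hw, ← mul_apply_eq_comp,
      Observable.mul_eq_zero_of_disjoint hE.1 hA hA.compl disjoint_compl_right, zero_apply]
  have hAu : E Aᶜ u = 0 := by
    rw [← hu, ← mul_apply_eq_comp,
      Observable.mul_eq_zero_of_disjoint hE.1 hA.compl hA disjoint_compl_left, zero_apply]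
  have hcross : ∀ {w : T.domain}, E Aᶜ w = w →
      inner ℂ (u : K) (T w) + inner ℂ (w : K) (T u) = 0 := fun {w} hw => by
    have h := hE.inner_eq_add hA (u := u) (v := u + w) (w := w)
      (by rw [Submodule.coe_add, map_add, hu, hAw hw, add_zero])
      (by rw [Submodule.coe_add, map_add, hw, hAu, zero_add])
    rw [LinearPMap.map_add, Submodule.coe_add, inner_add_left, inner_add_right,
      inner_add_right] at h
    linear_combination h
  have hI := hcross (w := Complex.I • w) (by rw [Submodule.coe_smul, map_smul, hw])
  rw [LinearPMap.map_smul, Submodule.coe_smul, inner_smul_left, inner_smul_right,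
    Complex.conj_I] at hI
  have h : Complex.I * (2 * inner ℂ (w : K) (T u)) = 0 := by
    linear_combination Complex.I * hcross hw - hI
  simpa using h

theorem apply_map_eq_map (hE : IsSpectralMeasure E T) (hT : Dense (T.domain : Set K)) {A : Set ℝ}
    (hA : MeasurableSet A) {u : T.domain} (hu : E A u = u) : E A (T u) = T u := by
  have h0 : E Aᶜ (T u) = 0 := by
    refine hT.eq_zero_of_inner_right ℂ fun φ hφ => ?_
    rw [← E.inner_left hA.compl]
    refine hE.inner_apply_eq_zero hA (w := ⟨E Aᶜ φ, hE.apply_mem_domain hA.compl hφ⟩) hu ?_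
    change E Aᶜ (E Aᶜ φ) = E Aᶜ φ
    rw [← mul_apply_eq_comp, hE.1]
  simpa only [h0, add_zero] using E.apply_add_apply_compl hA (T u)

theorem apply_map (hE : IsSpectralMeasure E T) (hT : Dense (T.domain : Set K)) {A : Set ℝ}
    (hA : MeasurableSet A) {u v : T.domain} (hv : E A u = v) : E A (T u) = T v := by
  have hw : (u - v : K) = E Aᶜ u := by
    rw [sub_eq_iff_eq_add', ← hv, E.apply_add_apply_compl hA]
  have hAv : E A v = v := by rw [← hv, ← mul_apply_eq_comp, hE.1]
  have hAw : E Aᶜ (u - v : T.domain) = (u - v : T.domain) := by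
    rw [Submodule.coe_sub, hw, ← mul_apply_eq_comp, hE.1]
  have h : E A (T (u - v)) = 0 := by
    rw [← hE.apply_map_eq_map hT hA.compl hAw, ← mul_apply_eq_comp,
      Observable.mul_eq_zero_of_disjoint hE.1 hA hA.compl disjoint_compl_right, zero_apply]
  rwa [LinearPMap.map_sub, map_sub, sub_eq_zero, hE.apply_map_eq_map hT hA hAv] at h

theorem inner_map_sub_smul (hE : IsSpectralMeasure E T) (c : ℝ) (u : T.domain) :
    inner ℂ (u : K) (T u - (c : ℂ) • (u : K)) = ((∫ x, (x - c) ∂(E.measure (u : K)) : ℝ) : ℂ) := by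
  rw [integral_sub (hE.integrable_id u) (integrable_const _), integral_const, E.measureReal_univ,
    inner_sub_right, hE.2.2, inner_smul_right, inner_self_eq_norm_sq_to_K, smul_eq_mul, mul_comm]
  push_cast
  rfl

theorem norm_map_sub_smul_le (hE : IsSpectralMeasure E T) (hT : Dense (T.domain : Set K)) {c r : ℝ}
    (hr : 0 < r) {u : T.domain} (hu : E (Set.Icc (c - r) (c + r)) u = u) :
    ‖T u - (c : ℂ) • (u : K)‖ ≤ r * ‖(u : K)‖ := by
  let D : Submodule ℂ K := LinearMap.eqLocus (E (Set.Icc (c - r) (c + r))).toLinearMap LinearMap.id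
  have hD : D ≤ T.domain := fun x hx => hE.mem_domain_of_apply_Icc_eq hx
  let B : D →ₗ[ℂ] D := LinearMap.codRestrict D
    (T.toFun ∘ₗ Submodule.inclusion hD - (c : ℂ) • D.subtype) fun x => by
      have hx : E (Set.Icc (c - r) (c + r)) (x : K) = x := x.2
      change E _ (T (Submodule.inclusion hD x) - (c : ℂ) • (x : K)) =
        T (Submodule.inclusion hD x) - (c : ℂ) • (x : K)
      rw [map_sub, map_smul, hx,
        hE.apply_map_eq_map hT measurableSet_Icc (u := Submodule.inclusion hD x) hx]
  refine norm_apply_le_of_abs_inner_le (B := B) hr (fun x => ?_) ⟨u, hu⟩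
  refine ⟨_, ?_, hE.inner_map_sub_smul c (Submodule.inclusion hD x)⟩
  have hbound : ∀ᵐ t ∂(E.measure (x : K)), ‖t - c‖ ≤ r := by
    rw [Observable.measure_eq_restrict hE.1 measurableSet_Icc x.2]
    filter_upwards [ae_restrict_mem measurableSet_Icc] with t ht
    rw [Real.norm_eq_abs, abs_le]
    constructor <;> linarith [ht.1, ht.2]
  have h := norm_integral_le_of_norm_le_const hbound
  rwa [E.measureReal_univ, Real.norm_eq_abs] at h

theorem le_norm_map_sub_smul (hE : IsSpectralMeasure E T) {a b : ℝ} (c : ℝ) {u : T.domain}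
    (hu : E (Set.Icc a b) u = u) : (a - c) * ‖(u : K)‖ ≤ ‖T u - (c : ℂ) • (u : K)‖ := by
  rcases eq_or_lt_of_le (norm_nonneg (u : K)) with h0 | hpos
  · rw [← h0, mul_zero]
    exact norm_nonneg _
  have hform : (a - c) * ‖(u : K)‖ ^ 2 ≤ ∫ x, (x - c) ∂(E.measure (u : K)) := by
    have hle : ∀ᵐ x ∂(E.measure (u : K)), a - c ≤ x - c := by
      rw [Observable.measure_eq_restrict hE.1 measurableSet_Icc hu]
      filter_upwards [ae_restrict_mem measurableSet_Icc] with x hx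
      linarith [hx.1]
    have h := integral_mono_ae (integrable_const _)
      ((hE.integrable_id u).sub (integrable_const c)) hle
    rwa [integral_const, E.measureReal_univ, smul_eq_mul, mul_comm] at h
  have hcs := norm_inner_le_norm (𝕜 := ℂ) (u : K) (T u - (c : ℂ) • (u : K))
  rw [hE.inner_map_sub_smul, Complex.norm_real, Real.norm_eq_abs] at hcs
  refine le_of_mul_le_mul_left ?_ hpos
  linarith [le_abs_self (∫ x, (x - c) ∂(E.measure (u : K))), sq ‖(u : K)‖]

/-- Under `T - c` a vector of `E`-support `[c - r, c + r]` grows at most like `r ^ n`, whereas its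
component of `F`-support `[a, b]` grows at least like `(a - c) ^ n`. -/
theorem pow_mul_norm_apply_le (hE : IsSpectralMeasure E T) (hF : IsSpectralMeasure F T)
    (hT : Dense (T.domain : Set K)) {c r a b : ℝ} (hr : 0 < r) (hac : c ≤ a) (n : ℕ) {u : K}
    (hu : E (Set.Icc (c - r) (c + r)) u = u) :
    (a - c) ^ n * ‖F (Set.Icc a b) u‖ ≤ r ^ n * (‖F (Set.Icc a b)‖ * ‖u‖) := by
  induction n generalizing u with
  | zero => simpa using (F (Set.Icc a b)).le_opNorm u
  | succ n ih =>
    lift u to T.domain using hE.mem_domain_of_apply_Icc_eq hu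
    obtain ⟨v, hv⟩ : ∃ v : T.domain, F (Set.Icc a b) u = v :=
      ⟨⟨_, hF.apply_mem_domain measurableSet_Icc u.2⟩, rfl⟩
    have hvF : F (Set.Icc a b) v = v := by rw [← hv, ← mul_apply_eq_comp, hF.1]
    have hcomm : F (Set.Icc a b) (T u - (c : ℂ) • (u : K)) = T v - (c : ℂ) • (v : K) := by
      rw [map_sub, map_smul, hF.apply_map hT measurableSet_Icc hv, hv]
    have hinv : E (Set.Icc (c - r) (c + r)) (T u - (c : ℂ) • (u : K)) =
        T u - (c : ℂ) • (u : K) := by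
      rw [map_sub, map_smul, hE.apply_map_eq_map hT measurableSet_Icc hu, hu]
    calc (a - c) ^ (n + 1) * ‖F (Set.Icc a b) u‖
        = (a - c) ^ n * ((a - c) * ‖(v : K)‖) := by rw [hv]; ring
      _ ≤ (a - c) ^ n * ‖F (Set.Icc a b) (T u - (c : ℂ) • (u : K))‖ := by
        rw [hcomm]
        have := hF.le_norm_map_sub_smul c hvF
        have := sub_nonneg.2 hac
        gcongr
      _ ≤ r ^ n * (‖F (Set.Icc a b)‖ * ‖T u - (c : ℂ) • (u : K)‖) := ih hinv
      _ ≤ r ^ n * (‖F (Set.Icc a b)‖ * (r * ‖(u : K)‖)) := by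
        gcongr
        exact hE.norm_map_sub_smul_le hT hr hu
      _ = r ^ (n + 1) * (‖F (Set.Icc a b)‖ * ‖(u : K)‖) := by ring

theorem Icc_mul_Icc_eq_zero (hE : IsSpectralMeasure E T) (hF : IsSpectralMeasure F T)
    (hT : Dense (T.domain : Set K)) {c r a b : ℝ} (hr : 0 < r) (ha : c + r < a) :
    F (Set.Icc a b) * E (Set.Icc (c - r) (c + r)) = 0 := by
  ext1 ψ
  rw [mul_apply_eq_comp, zero_apply, ← norm_le_zero_iff]
  set u := E (Set.Icc (c - r) (c + r)) ψ with hu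
  have hur : E (Set.Icc (c - r) (c + r)) u = u := by rw [hu, ← mul_apply_eq_comp, hE.1]
  have hpos : 0 < a - c := by linarith
  have hlim : Filter.Tendsto (fun n : ℕ => (r / (a - c)) ^ n * (‖F (Set.Icc a b)‖ * ‖u‖))
      Filter.atTop (nhds (0 * (‖F (Set.Icc a b)‖ * ‖u‖))) :=
    (tendsto_pow_atTop_nhds_zero_of_lt_one (by positivity)
      ((div_lt_one hpos).2 (by linarith))).mul_const _
  rw [zero_mul] at hlim
  refine ge_of_tendsto' hlim fun n => ?_
  rw [div_pow, div_mul_eq_mul_div, le_div_iff₀' (by positivity)]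
  exact hE.pow_mul_norm_apply_le hF hT hr (by linarith) n hur

theorem Ioi_mul_Iic_eq_zero (hE : IsSpectralMeasure E T) (hF : IsSpectralMeasure F T)
    (hT : Dense (T.domain : Set K)) (a : ℝ) : F (Set.Ioi a) * E (Set.Iic a) = 0 := by
  refine Observable.mul_eq_zero_of_forall_subset hF.1 measurableSet_Ioi
    (s := fun n : ℕ => Set.Icc (a + 1 / (n + 1)) (a + n)) (fun n => measurableSet_Icc) ?_ E
    fun n => ?_
  · intro x (hx : a < x)
    obtain ⟨k, hk⟩ := exists_nat_one_div_lt (sub_pos.2 hx)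
    obtain ⟨m, hm⟩ := exists_nat_ge (x - a)
    refine Set.mem_iUnion.2 ⟨max k m, ?_, ?_⟩
    · have : (1 : ℝ) / ((max k m : ℕ) + 1) ≤ 1 / (k + 1) := by gcongr; exact le_max_left k m
      linarith
    · have : (m : ℝ) ≤ (max k m : ℕ) := by gcongr; exact le_max_right k m
      linarith
  rw [Observable.mul_eq_zero_comm _ _ measurableSet_Icc measurableSet_Iic]
  refine Observable.mul_eq_zero_of_forall_subset hE.1 measurableSet_Iic
    (s := fun m : ℕ => Set.Icc (a - (m + 1) - (m + 1)) (a - (m + 1) + (m + 1)))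
    (fun n => measurableSet_Icc) ?_ F fun m => ?_
  · intro x (hx : x ≤ a)
    obtain ⟨m, hm⟩ := exists_nat_ge (a - x)
    exact Set.mem_iUnion.2 ⟨m, by constructor <;> linarith⟩
  rw [Observable.mul_eq_zero_comm _ _ measurableSet_Icc measurableSet_Icc]
  refine hE.Icc_mul_Icc_eq_zero hF hT (by positivity) ?_
  rw [sub_add_cancel]
  exact lt_add_of_pos_right a (by positivity)

theorem unique (hE : IsSpectralMeasure E T) (hF : IsSpectralMeasure F T)
    (hT : Dense (T.domain : Set K)) : E = F := by
  have hle : ∀ {E F : Observable ℝ K}, IsSpectralMeasure E T → IsSpectralMeasure F T → ∀ a,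
      F (Set.Iic a) * E (Set.Iic a) = E (Set.Iic a) := fun {E F} hE hF a => by
    ext1 ψ
    have h := F.apply_add_apply_compl (measurableSet_Iic (a := a)) (E (Set.Iic a) ψ)
    rwa [Set.compl_Iic, ← mul_apply_eq_comp (F (Set.Ioi a)), hE.Ioi_mul_Iic_eq_zero hF hT,
      zero_apply, add_zero] at h
  have hIic : ∀ a, E (Set.Iic a) = F (Set.Iic a) := fun a => by
    ext1 ψ
    refine ext_inner_left ℂ fun φ => ?_
    rw [← hle hE hF, mul_apply_eq_comp, ← F.inner_left measurableSet_Iic,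
      ← E.inner_left measurableSet_Iic, ← mul_apply_eq_comp, hle hF hE,
      F.inner_left measurableSet_Iic]
  refine Observable.ext_of_measure fun ψ => Measure.ext_of_Iic _ _ fun a => ?_
  rw [E.measure_apply _ measurableSet_Iic, F.measure_apply _ measurableSet_Iic, hIic]

theorem spectralMeasure_eq (hE : IsSpectralMeasure E T) (hT : Dense (T.domain : Set K))
    (X : Set ℝ) : spectralMeasure T X = E X := by
  have hex : ∃ E : Observable ℝ K, IsSpectralMeasure E T := ⟨E, hE⟩
  rw [spectralMeasure, dif_pos hex, hex.choose_spec.unique hE hT]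

end IsSpectralMeasure

end Spectral

/-! ### Quadratures as multiplication operators -/

theorem derivative_hermite_succ (n : ℕ) :
    derivative (hermite (n + 1)) = ((n : ℤ[X]) + 1) * hermite n := by
  induction n with
  | zero => simp
  | succ n ih =>
    have hmul : derivative (((n : ℤ[X]) + 1) * hermite n) =
        ((n : ℤ[X]) + 1) * derivative (hermite n) := by
      simp only [derivative_mul, derivative_add, derivative_natCast, derivative_one, add_zero,
        zero_mul, zero_add]
    rw [hermite_succ (n + 1), derivative_sub, derivative_mul, derivative_X, ih, hmul,
      hermite_succ n]
    push_cast
    ring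

theorem X_mul_hermite (n : ℕ) :
    X * hermite n = hermite (n + 1) + (n : ℤ[X]) * hermite (n - 1) := by
  cases n with
  | zero => simp
  | succ n => rw [hermite_succ (n + 1), derivative_hermite_succ]; simp

theorem sqrt_succ_mul_inv_sqrt_factorial_succ (n : ℕ) :
    √((n : ℝ) + 1) * (√((n + 1).factorial * √Real.pi))⁻¹ = (√(n.factorial * √Real.pi))⁻¹ := by
  have hsplit : √((n + 1).factorial * √Real.pi) = √((n : ℝ) + 1) * √(n.factorial * √Real.pi) := by
    rw [← Real.sqrt_mul (by positivity), Nat.factorial_succ]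
    push_cast
    rw [mul_assoc]
  rw [hsplit, mul_inv, mul_inv_cancel_left₀ (by positivity)]

theorem mul_hermiteFun (n : ℕ) (x : ℝ) :
    x * hermiteFun n x = (1 / √2) * (√((n : ℝ) + 1) * hermiteFun (n + 1) x +
      √(n : ℝ) * hermiteFun (n - 1) x) := by
  have hrec : √2 * x * aeval (√2 * x) (hermite n) =
      aeval (√2 * x) (hermite (n + 1)) + n * aeval (√2 * x) (hermite (n - 1)) := by
    simpa using congrArg (aeval (√2 * x)) (X_mul_hermite n)
  have hlower : √(n : ℝ) * (√((n - 1).factorial * √Real.pi))⁻¹ =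
      n * (√(n.factorial * √Real.pi))⁻¹ := by
    cases n with
    | zero => simp
    | succ n =>
      rw [Nat.add_sub_cancel, ← sqrt_succ_mul_inv_sqrt_factorial_succ, Nat.cast_succ, ← mul_assoc,
        Real.mul_self_sqrt (by positivity)]
  have hraise := sqrt_succ_mul_inv_sqrt_factorial_succ n
  have hx : x = 1 / √2 * (√2 * x) := by field_simp
  simp only [hermiteFun]
  generalize Real.exp (-(x ^ 2 / 2)) = g at *
  linear_combination (1 / √2) * g * (√(n.factorial * √Real.pi))⁻¹ * hrec +
    g * (√(n.factorial * √Real.pi))⁻¹ * aeval (√2 * x) (hermite n) * hx -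
    (1 / √2) * g * aeval (√2 * x) (hermite (n + 1)) * hraise -
    (1 / √2) * g * aeval (√2 * x) (hermite (n - 1)) * hlower

section MultiplicationGraph

variable {α : Type*} [MeasurableSpace α] {μ : Measure α} {g : α → ℂ}

/-- The graph of the maximal operator of multiplication by `g` on `L²(μ)`. -/
def mulGraph (μ : Measure α) (g : α → ℂ) : Submodule ℂ (Lp ℂ 2 μ × Lp ℂ 2 μ) where
  carrier := {p | p.2 =ᵐ[μ] fun x => g x * p.1 x}
  zero_mem' := by
    filter_upwards [Lp.coeFn_zero ℂ 2 μ] with x hx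
    rw [Prod.fst_zero, Prod.snd_zero, hx, Pi.zero_apply, mul_zero]
  add_mem' := by
    intro p q hp hq
    filter_upwards [hp, hq, Lp.coeFn_add p.1 q.1, Lp.coeFn_add p.2 q.2] with x hp hq h₁ h₂
    rw [Prod.fst_add, Prod.snd_add, h₁, h₂, Pi.add_apply, Pi.add_apply, hp, hq, mul_add]
  smul_mem' := by
    intro c p hp
    filter_upwards [hp, Lp.coeFn_smul c p.1, Lp.coeFn_smul c p.2] with x hp h₁ h₂
    rw [Prod.smul_fst, Prod.smul_snd, h₁, h₂, Pi.smul_apply, Pi.smul_apply, hp, smul_eq_mul,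
      smul_eq_mul, mul_left_comm]

theorem mem_mulGraph {p : Lp ℂ 2 μ × Lp ℂ 2 μ} :
    p ∈ mulGraph μ g ↔ p.2 =ᵐ[μ] fun x => g x * p.1 x := Iff.rfl

theorem isClosed_mulGraph : IsClosed (mulGraph μ g : Set (Lp ℂ 2 μ × Lp ℂ 2 μ)) := by
  refine IsSeqClosed.isClosed fun u p hu hp => ?_
  have hfst : Filter.Tendsto (fun n => (u n).1) Filter.atTop (nhds p.1) :=
    (continuous_fst.tendsto p).comp hp
  have hsnd : Filter.Tendsto (fun n => (u n).2) Filter.atTop (nhds p.2) :=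
    (continuous_snd.tendsto p).comp hp
  obtain ⟨ns, hns, hae⟩ := (tendstoInMeasure_of_tendsto_Lp hfst).exists_seq_tendsto_ae
  refine ae_eq_of_tendsto_Lp (hsnd.comp hns.tendsto_atTop) ?_
  have hmul : ∀ᵐ x ∂μ, ∀ n, (u n).2 x = g x * (u n).1 x := ae_all_iff.2 hu
  filter_upwards [hae, hmul] with x hx hmul
  simp only [Function.comp_apply, hmul]
  exact hx.const_mul _

theorem inner_eq_integral_of_mem_mulGraph {p : Lp ℂ 2 μ × Lp ℂ 2 μ} (hp : p ∈ mulGraph μ g) :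
    inner ℂ p.1 p.2 = ∫ x, g x * (‖p.1 x‖ ^ 2 : ℝ) ∂μ := by
  rw [inner_eq_integral_of_ae_eq (Filter.EventuallyEq.rfl : p.1 =ᵐ[μ] p.1) hp]
  simp only [mul_assoc, Complex.mul_conj', Complex.ofReal_pow]

end MultiplicationGraph

/-- The position operator `Q`, as a graph: multiplication by `x` on its maximal domain. -/
abbrev positionGraph : Submodule ℂ (Mode × Mode) := mulGraph volume fun x : ℝ => (x : ℂ)

/-- The operator `R(θ) Q R(θ)*`, as a graph. -/
def rotatedGraph (θ : ℝ) : Submodule ℂ (Mode × Mode) :=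
  positionGraph.comap ((phaseShifter (-θ)).toLinearEquiv.toLinearMap.prodMap
    (phaseShifter (-θ)).toLinearEquiv.toLinearMap)

theorem mem_rotatedGraph {θ : ℝ} {p : Mode × Mode} : p ∈ rotatedGraph θ ↔
    (phaseShifter (-θ) p.1, phaseShifter (-θ) p.2) ∈ positionGraph := Iff.rfl

theorem isClosed_rotatedGraph (θ : ℝ) : IsClosed (rotatedGraph θ : Set (Mode × Mode)) := by
  have hclosed : IsClosed (positionGraph : Set (Mode × Mode)) := isClosed_mulGraph
  refine hclosed.preimage (f := fun p : Mode × Mode =>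
    (phaseShifter (-θ) p.1, phaseShifter (-θ) p.2)) ?_
  fun_prop

theorem rotatedGraph_snd_eq {θ : ℝ} {ψ χ χ' : Mode} (h : (ψ, χ) ∈ rotatedGraph θ)
    (h' : (ψ, χ') ∈ rotatedGraph θ) : χ = χ' := by
  have hχ := mem_mulGraph.1 (mem_rotatedGraph.1 h)
  have hχ' := mem_mulGraph.1 (mem_rotatedGraph.1 h')
  exact (phaseShifter (-θ)).injective (Lp.ext (hχ.trans hχ'.symm))

theorem inner_eq_integral_of_mem_rotatedGraph {θ : ℝ} {p : Mode × Mode}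
    (hp : p ∈ rotatedGraph θ) :
    inner ℂ p.1 p.2 = ((∫ x : ℝ, x * ‖phaseShifter (-θ) p.1 x‖ ^ 2 : ℝ) : ℂ) := by
  rw [← (phaseShifter (-θ)).inner_map_map,
    inner_eq_integral_of_mem_mulGraph (mem_rotatedGraph.1 hp), ← integral_complex_ofReal]
  simp only [Complex.ofReal_mul]

/-- The operator `(exp(iθ) a* + exp(-iθ) a)/√2` on finite linear combinations of number states,
whose closure is `quadrature θ`. -/
abbrev preQuadrature (θ : ℝ) : Mode →ₗ.[ℂ] Mode :=
  (1 / √2 : ℂ) • (Complex.exp (Complex.I * θ) • creation +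
    Complex.exp (-(Complex.I * θ)) • annihilation)

theorem mem_domain_preQuadrature {θ : ℝ} {ψ : Mode} :
    ψ ∈ (preQuadrature θ).domain ↔ ψ ∈ Submodule.span ℂ (Set.range numberState) := by
  change ψ ∈ Submodule.span ℂ (Set.range numberState) ⊓ Submodule.span ℂ (Set.range numberState) ↔ _
  rw [inf_idem]

theorem coeFn_numberState (n : ℕ) : numberState n =ᵐ[volume] fun x => (hermiteFun n x : ℂ) :=
  (memLp_hermiteFun n).coeFn_toLp

theorem numberState_mem_positionGraph (n : ℕ) :
    (numberState n, (1 / √2 : ℂ) • ((√((n : ℝ) + 1) : ℂ) • numberState (n + 1) +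
      (√(n : ℝ) : ℂ) • numberState (n - 1))) ∈ positionGraph := by
  rw [mem_mulGraph]
  filter_upwards [Lp.coeFn_smul (1 / √2 : ℂ) ((√((n : ℝ) + 1) : ℂ) • numberState (n + 1) +
    (√(n : ℝ) : ℂ) • numberState (n - 1)), Lp.coeFn_add ((√((n : ℝ) + 1) : ℂ) •
    numberState (n + 1)) ((√(n : ℝ) : ℂ) • numberState (n - 1)),
    Lp.coeFn_smul (√((n : ℝ) + 1) : ℂ) (numberState (n + 1)),
    Lp.coeFn_smul (√(n : ℝ) : ℂ) (numberState (n - 1)), coeFn_numberState n,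
    coeFn_numberState (n + 1), coeFn_numberState (n - 1)]
    with x hsmul hadd hraise hlower hn hsucc hpred
  rw [hsmul, Pi.smul_apply, hadd, Pi.add_apply, hraise, hlower, Pi.smul_apply, Pi.smul_apply, hn,
    hsucc, hpred, ← Complex.ofReal_mul, mul_hermiteFun]
  push_cast
  simp only [smul_eq_mul]

theorem exp_smul_phaseShifter_neg_numberState (θ : ℝ) {m n : ℕ} {z : ℂ}
    (h : Complex.I * θ * m = z + Complex.I * θ * n) :
    Complex.exp z • phaseShifter (-θ) (numberState m) =
      Complex.exp (Complex.I * (-θ : ℝ) * n) • numberState m := by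
  rw [phaseShifter_numberState, smul_smul, ← Complex.exp_add]
  congr 2
  push_cast
  linear_combination -h

theorem numberState_mem_rotatedGraph (θ : ℝ) (n : ℕ) :
    (numberState n, (1 / √2 : ℂ) • (Complex.exp (Complex.I * θ) •
      ((√((n : ℝ) + 1) : ℂ) • numberState (n + 1)) + Complex.exp (-(Complex.I * θ)) •
      ((√(n : ℝ) : ℂ) • numberState (n - 1)))) ∈ rotatedGraph θ := by
  have hraise := exp_smul_phaseShifter_neg_numberState θ (m := n + 1) (n := n)
    (z := Complex.I * θ) (by push_cast; ring)
  have hlower : (√(n : ℝ) : ℂ) • Complex.exp (-(Complex.I * θ)) •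
        phaseShifter (-θ) (numberState (n - 1)) =
      (√(n : ℝ) : ℂ) • Complex.exp (Complex.I * (-θ : ℝ) * n) • numberState (n - 1) := by
    cases n with
    | zero => simp
    | succ n =>
      rw [Nat.add_sub_cancel, exp_smul_phaseShifter_neg_numberState θ (n := n + 1)
        (by push_cast; ring)]
  have hrotated := positionGraph.smul_mem (Complex.exp (Complex.I * (-θ : ℝ) * n))
    (numberState_mem_positionGraph n)
  rw [Prod.smul_mk] at hrotated
  rw [mem_rotatedGraph]
  convert! hrotated using 2
  · exact phaseShifter_numberState (-θ) n
  · simp only [map_smul, map_add, smul_comm (Complex.exp (Complex.I * θ)),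
      smul_comm (Complex.exp (-(Complex.I * θ))), hraise, hlower]
    simp only [smul_add, smul_comm (Complex.exp (Complex.I * (-θ : ℝ) * n))]

theorem graph_preQuadrature_le (θ : ℝ) : (preQuadrature θ).graph ≤ rotatedGraph θ := by
  let creationMap : Submodule.span ℂ (Set.range numberState) →ₗ[ℂ] Mode := creation.toFun
  let annihilationMap : Submodule.span ℂ (Set.range numberState) →ₗ[ℂ] Mode := annihilation.toFun
  let graphMap : Submodule.span ℂ (Set.range numberState) →ₗ[ℂ] Mode × Mode :=
    (Submodule.span ℂ (Set.range numberState)).subtype.prod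
      ((1 / √2 : ℂ) • (Complex.exp (Complex.I * θ) • creationMap +
        Complex.exp (-(Complex.I * θ)) • annihilationMap))
  have hbasis : ∀ n, graphMap (finiteBasis n) ∈ rotatedGraph θ := fun n => by
    have hcoe : (finiteBasis n : Mode) = numberState n :=
      congrArg Subtype.val (Module.Basis.span_apply orthonormal_numberState.linearIndependent n)
    have hcreation : creationMap (finiteBasis n) = (√((n : ℝ) + 1) : ℂ) • numberState (n + 1) :=
      finiteBasis.constr_basis _ _ _
    have hannihilation : annihilationMap (finiteBasis n) = (√(n : ℝ) : ℂ) • numberState (n - 1) :=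
      finiteBasis.constr_basis _ _ _
    have hmem := numberState_mem_rotatedGraph θ n
    rwa [← hcoe, ← hcreation, ← hannihilation] at hmem
  have hrange : ∀ ψ, graphMap ψ ∈ rotatedGraph θ := fun ψ => by
    have hle : Submodule.span ℂ (Set.range finiteBasis) ≤ (rotatedGraph θ).comap graphMap :=
      Submodule.span_le.2 (Set.range_subset_iff.2 hbasis)
    rw [finiteBasis.span_eq] at hle
    exact hle Submodule.mem_top
  rintro ⟨ψ, χ⟩ hψχ
  obtain ⟨y, rfl, rfl⟩ := (LinearPMap.mem_graph_iff _).1 hψχ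
  exact hrange ⟨y, mem_domain_preQuadrature.1 y.2⟩

/-- The real-linear map taking a polynomial `p` to the vector `p(x) exp(-x²/2)`. -/
def polyVec : ℝ[X] →ₗ[ℝ] Mode where
  toFun p := (memLp_poly_gauss p).toLp _
  map_add' p q := by
    rw [← MemLp.toLp_add]
    congr 1
    funext x
    simp only [Pi.add_apply, eval_add, add_mul, Complex.ofReal_add]
  map_smul' c p := by
    rw [RingHom.id_apply, ← MemLp.toLp_const_smul]
    congr 1
    funext x
    simp only [Pi.smul_apply, eval_smul, smul_eq_mul, Complex.real_smul, mul_assoc,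
      Complex.ofReal_mul]

theorem coeFn_polyVec (p : ℝ[X]) : polyVec p =ᵐ[volume]
    fun x => ((p.eval x * Real.exp (-(x ^ 2 / 2)) : ℝ) : ℂ) :=
  (memLp_poly_gauss p).coeFn_toLp

theorem polyVec_hermiteSeq (n : ℕ) :
    polyVec (hermiteSeq n) = ((√(n.factorial * √Real.pi) : ℝ) : ℂ) • numberState n := by
  have hnorm : √(n.factorial * √Real.pi) ≠ 0 := by positivity
  refine Lp.ext ?_
  filter_upwards [coeFn_polyVec (hermiteSeq n), coeFn_numberState n,
    Lp.coeFn_smul ((√(n.factorial * √Real.pi) : ℝ) : ℂ) (numberState n)] with x hpoly hn hsmul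
  rw [hpoly, hsmul, Pi.smul_apply, hn, smul_eq_mul, ← Complex.ofReal_mul, hermiteFun,
    ← mul_assoc, mul_inv_cancel₀ hnorm, one_mul, eval_hermiteSeq]

theorem polyVec_mem_span (p : ℝ[X]) : polyVec p ∈ Submodule.span ℂ (Set.range numberState) := by
  have hspan : Submodule.span ℝ (Set.range hermiteSeq) = ⊤ := hermiteSeq.span fun n =>
    isUnit_iff_ne_zero.2 (leadingCoeff_ne_zero.2 (hermiteSeq.ne_zero n))
  have hle : Submodule.span ℝ (Set.range hermiteSeq) ≤
      ((Submodule.span ℂ (Set.range numberState)).restrictScalars ℝ).comap polyVec := by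
    rw [Submodule.span_le]
    rintro _ ⟨n, rfl⟩
    change polyVec (hermiteSeq n) ∈ Submodule.span ℂ (Set.range numberState)
    rw [polyVec_hermiteSeq]
    exact Submodule.smul_mem _ _ (Submodule.subset_span ⟨n, rfl⟩)
  rw [hspan] at hle
  exact hle Submodule.mem_top

theorem polyVec_mem_positionGraph (p : ℝ[X]) : (polyVec p, polyVec (X * p)) ∈ positionGraph := by
  rw [mem_mulGraph]
  filter_upwards [coeFn_polyVec p, coeFn_polyVec (X * p)] with x hp hXp
  rw [hp, hXp, eval_mul, eval_X, mul_assoc, Complex.ofReal_mul]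

theorem phaseShifter_mem_span_numberState (θ : ℝ) {ψ : Mode}
    (h : ψ ∈ Submodule.span ℂ (Set.range numberState)) :
    phaseShifter θ ψ ∈ Submodule.span ℂ (Set.range numberState) := by
  have hle : Submodule.span ℂ (Set.range numberState) ≤
      (Submodule.span ℂ (Set.range numberState)).comap
        (phaseShifter θ).toLinearEquiv.toLinearMap := by
    rw [Submodule.span_le]
    rintro _ ⟨n, rfl⟩
    change phaseShifter θ (numberState n) ∈ Submodule.span ℂ (Set.range numberState)
    rw [phaseShifter_numberState]
    exact Submodule.smul_mem _ _ (Submodule.subset_span ⟨n, rfl⟩)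
  exact hle h

theorem polyVec_mem_graph_preQuadrature (θ : ℝ) (p : ℝ[X]) :
    (phaseShifter θ (polyVec p), phaseShifter θ (polyVec (X * p))) ∈ (preQuadrature θ).graph := by
  have hdomain : phaseShifter θ (polyVec p) ∈ (preQuadrature θ).domain :=
    mem_domain_preQuadrature.2 (phaseShifter_mem_span_numberState θ (polyVec_mem_span p))
  have hgraph := (preQuadrature θ).mem_graph ⟨_, hdomain⟩
  have hrotated :
      (phaseShifter θ (polyVec p), phaseShifter θ (polyVec (X * p))) ∈ rotatedGraph θ := by
    rw [mem_rotatedGraph, phaseShifter_neg_apply_phaseShifter, phaseShifter_neg_apply_phaseShifter]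
    exact polyVec_mem_positionGraph p
  rwa [rotatedGraph_snd_eq (graph_preQuadrature_le θ hgraph) hrotated] at hgraph

theorem memLp_affine_mul_gauss_mul_dilation {k : ℝ} (hk : k ≠ 0) (f : Mode) :
    MemLp (fun y : ℝ => ((k * y : ℝ) + Complex.I) * ((Real.exp (-(y ^ 2 / 2)) : ℝ) * f (k * y)))
      2 volume := by
  have hbound : ∀ y : ℝ, ‖((k * y : ℝ) : ℂ) + Complex.I‖ * Real.exp (-(y ^ 2 / 2)) ≤ |k| + 1 := by
    intro y
    have htri : ‖((k * y : ℝ) : ℂ) + Complex.I‖ ≤ |k| * |y| + 1 := by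
      refine (norm_add_le _ _).trans ?_
      rw [Complex.norm_real, Complex.norm_I, Real.norm_eq_abs, abs_mul]
    have hexp : y ^ 2 / 2 + 1 ≤ Real.exp (y ^ 2 / 2) := Real.add_one_le_exp _
    rw [Real.exp_neg, ← div_eq_mul_inv, div_le_iff₀ (Real.exp_pos _)]
    nlinarith [mul_nonneg (abs_nonneg k) (sq_nonneg (|y| - 1)), sq_abs y, abs_nonneg k]
  refine (memLp_dilation hk f).of_le_mul (c := |k| + 1) ?_ (Filter.Eventually.of_forall fun y => ?_)
  · exact (Continuous.aestronglyMeasurable (by fun_prop)).mul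
      ((Continuous.aestronglyMeasurable (by fun_prop)).mul
        (memLp_dilation hk f).aestronglyMeasurable)
  · rw [← mul_assoc, norm_mul, norm_mul, Complex.norm_real, Real.norm_eq_abs,
      abs_of_pos (Real.exp_pos _)]
    exact mul_le_mul_of_nonneg_right (hbound y) (norm_nonneg _)

-- The substitution `x = √2 y` leaves half of the Gaussian to make `(x + i) f(x)` square integrable.
theorem eq_zero_of_shifted_moments (f : Mode) (hf : ∀ n : ℕ, ∫ x : ℝ,
    (x : ℂ) ^ n * ((x + Complex.I) * ((Real.exp (-(x ^ 2 / 2)) : ℝ) * f x)) = 0) : f = 0 := by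
  have h2 : (√2 : ℝ) ≠ 0 := by positivity
  have hmem := memLp_affine_mul_gauss_mul_dilation h2 f
  have hzero : hmem.toLp _ = 0 := by
    refine eq_zero_of_moments _ fun n => ?_
    let F : ℝ → ℂ := fun x => (1 / √2 : ℂ) ^ n * ((x : ℂ) ^ n * ((x + Complex.I) *
      ((Real.exp (-(x ^ 2 / 2)) : ℝ) * f x)))
    have hsubst : ∫ y : ℝ, (y : ℂ) ^ n * ((Real.exp (-(y ^ 2 / 2)) : ℝ) * (hmem.toLp _ : Mode) y) =
        ∫ y : ℝ, F (√2 * y) := by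
      refine integral_congr_ae ?_
      filter_upwards [hmem.coeFn_toLp] with y hy
      have hexp : ((Real.exp (-((√2 * y) ^ 2 / 2)) : ℝ) : ℂ) =
          (Real.exp (-(y ^ 2 / 2)) : ℝ) * (Real.exp (-(y ^ 2 / 2)) : ℝ) := by
        rw [← Complex.ofReal_mul, ← Real.exp_add, mul_pow, Real.sq_sqrt zero_le_two]
        congr 2
        ring
      have hpow : (y : ℂ) ^ n = (1 / √2 : ℂ) ^ n * ((√2 * y : ℝ) : ℂ) ^ n := by
        rw [← mul_pow, Complex.ofReal_mul, ← mul_assoc, one_div_mul_cancel (by exact_mod_cast h2),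
          one_mul]
      simp only [F, hy, hexp, hpow]
      ring
    rw [hsubst, Measure.integral_comp_mul_left F, integral_const_mul, hf n, mul_zero, smul_zero]
  have hdilated : ∀ᵐ y : ℝ, f (√2 * y) = 0 := by
    have hcoe := hmem.coeFn_toLp
    rw [hzero] at hcoe
    filter_upwards [hcoe, Lp.coeFn_zero ℂ 2 (volume : Measure ℝ)] with y hy h0
    have hshift : ((√2 * y : ℝ) : ℂ) + Complex.I ≠ 0 := fun h => by
      simpa using congrArg Complex.im h
    have hgauss : ((Real.exp (-(y ^ 2 / 2)) : ℝ) : ℂ) ≠ 0 := by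
      exact_mod_cast (Real.exp_pos _).ne'
    rw [h0, Pi.zero_apply, eq_comm] at hy
    exact (mul_eq_zero.1 ((mul_eq_zero.1 hy).resolve_left hshift)).resolve_left hgauss
  rw [Lp.eq_zero_iff_ae_eq_zero]
  filter_upwards [ae_dilation (inv_ne_zero h2) hdilated] with x hx
  rwa [mul_inv_cancel_left₀ h2] at hx

section ClosedSymmetric

variable {K : Type*} [NormedAddCommGroup K] [InnerProductSpace ℂ K]

theorem norm_add_I_smul_sq {ψ χ : K} (h : (inner ℂ ψ χ).im = 0) :
    ‖χ + Complex.I • ψ‖ ^ 2 = ‖χ‖ ^ 2 + ‖ψ‖ ^ 2 := by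
  have hre : RCLike.re (inner ℂ χ (Complex.I • ψ)) = 0 := by
    rw [inner_smul_right, ← inner_conj_symm, RCLike.re_eq_complex_re, Complex.I_mul_re,
      Complex.conj_im, h, neg_zero, neg_zero]
  rw [norm_add_sq (𝕜 := ℂ), hre, norm_smul, Complex.norm_I, one_mul, mul_zero, add_zero]

theorem le_topologicalClosure_of_dense_map {G G₀ : Submodule ℂ (K × K)} (hle : G₀ ≤ G)
    (hsymm : ∀ p ∈ G, (inner ℂ p.1 p.2).im = 0)
    (hdense : Dense (G₀.map (LinearMap.snd ℂ K K + Complex.I • LinearMap.fst ℂ K K) : Set K)) :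
    G ≤ G₀.topologicalClosure := by
  rintro ⟨ψ, χ⟩ hp
  refine Metric.mem_closure_iff.2 fun ε hε => ?_
  obtain ⟨_, ⟨⟨a, b⟩, hab, rfl⟩, hdist⟩ := hdense.exists_dist_lt (χ + Complex.I • ψ) hε
  have hnorm := norm_add_I_smul_sq (hsymm _ (G.sub_mem hp (hle hab)))
  have hsub : (χ - b) + Complex.I • (ψ - a) = χ + Complex.I • ψ - (b + Complex.I • a) := by
    rw [smul_sub]; abel
  rw [Prod.snd_sub, Prod.fst_sub, hsub] at hnorm
  have hlt : ‖χ + Complex.I • ψ - (b + Complex.I • a)‖ < ε := by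
    rwa [dist_eq_norm] at hdist
  refine ⟨(a, b), hab, ?_⟩
  rw [Prod.dist_eq, max_lt_iff, dist_eq_norm, dist_eq_norm]
  constructor <;> refine (abs_le_of_sq_le_sq' ?_ (norm_nonneg _)).2.trans_lt hlt <;>
    nlinarith [sq_nonneg ‖χ - b‖, sq_nonneg ‖ψ - a‖]

end ClosedSymmetric

theorem dense_map_graph_preQuadrature (θ : ℝ) :
    Dense ((preQuadrature θ).graph.map
      (LinearMap.snd ℂ Mode Mode + Complex.I • LinearMap.fst ℂ Mode Mode) : Set Mode) := by
  rw [Submodule.dense_iff_topologicalClosure_eq_top, Submodule.topologicalClosure_eq_top_iff,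
    Submodule.eq_bot_iff]
  intro f hf
  have hstar : star (phaseShifter (-θ) f) = 0 := by
    refine eq_zero_of_shifted_moments _ fun n => ?_
    have hinner : inner ℂ f (phaseShifter θ (polyVec (X * X ^ n)) +
        Complex.I • phaseShifter θ (polyVec (X ^ n))) = 0 :=
      (Submodule.mem_orthogonal' _ _).1 hf _ ⟨_, polyVec_mem_graph_preQuadrature θ (X ^ n), rfl⟩
    rw [← map_smul, ← map_add, ← (phaseShifter (-θ)).inner_map_map,
      phaseShifter_neg_apply_phaseShifter, L2.inner_def] at hinner
    rw [← hinner]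
    refine integral_congr_ae ?_
    filter_upwards [Lp.coeFn_star (phaseShifter (-θ) f), coeFn_polyVec (X * X ^ n),
      coeFn_polyVec (X ^ n), Lp.coeFn_add (polyVec (X * X ^ n)) (Complex.I • polyVec (X ^ n)),
      Lp.coeFn_smul Complex.I (polyVec (X ^ n))] with x hstar hXpow hpow hadd hsmul
    rw [hstar, hadd, Pi.add_apply, hsmul, Pi.smul_apply, hXpow, hpow, Pi.star_apply,
      RCLike.inner_apply, RCLike.star_def]
    simp only [eval_mul, eval_X, eval_pow, smul_eq_mul]
    push_cast
    ring
  exact (phaseShifter (-θ)).map_eq_zero_iff.1 (conjugation.map_eq_zero_iff.1 hstar)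

theorem graph_quadrature (θ : ℝ) : (quadrature θ).graph = rotatedGraph θ := by
  have hgraph : (rotatedGraph θ).toLinearPMap.graph = rotatedGraph θ := by
    refine Submodule.toLinearPMap_graph_eq _ ?_
    rintro ⟨ψ, χ⟩ hp rfl
    exact rotatedGraph_snd_eq hp (rotatedGraph θ).zero_mem
  have hclosable : (preQuadrature θ).IsClosable := by
    refine LinearPMap.isClosable_iff_exists_closed_extension.2
      ⟨(rotatedGraph θ).toLinearPMap, ?_, LinearPMap.le_of_le_graph ?_⟩
    · rw [LinearPMap.IsClosed, hgraph]; exact isClosed_rotatedGraph θ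
    · rw [hgraph]; exact graph_preQuadrature_le θ
  change (preQuadrature θ).closure.graph = _
  rw [← hclosable.graph_closure_eq_closure_graph]
  refine le_antisymm (Submodule.topologicalClosure_minimal _ (graph_preQuadrature_le θ)
    (isClosed_rotatedGraph θ)) (le_topologicalClosure_of_dense_map (graph_preQuadrature_le θ)
      (fun p hp => ?_) (dense_map_graph_preQuadrature θ))
  rw [inner_eq_integral_of_mem_rotatedGraph hp, Complex.ofReal_im]

theorem dense_domain_quadrature (θ : ℝ) : Dense ((quadrature θ).domain : Set Mode) :=
  dense_span_numberState.mono fun _ hψ =>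
    (LinearPMap.le_closure (preQuadrature θ)).1 (mem_domain_preQuadrature.2 hψ)

/-! ### The spectral measures of the quadratures -/

theorem measure_indicatorObservable {α : Type*} [MeasurableSpace α] {μ : Measure α}
    (ψ : Lp ℂ 2 μ) :
    (indicatorObservable μ).measure ψ = μ.withDensity fun x => ENNReal.ofReal (‖ψ x‖ ^ 2) := by
  ext X hX
  have hintegrable : Integrable (fun x => ‖ψ x‖ ^ 2) μ :=
    (memLp_two_iff_integrable_sq_norm (Lp.aestronglyMeasurable ψ)).1 (Lp.memLp ψ)
  rw [Observable.measure_apply _ _ hX, withDensity_apply _ hX,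
    ← ofReal_integral_eq_lintegral_ofReal hintegrable.integrableOn
      (Filter.Eventually.of_forall fun x => by positivity)]
  change ENNReal.ofReal (inner ℂ ψ (indicatorOp μ X ψ)).re = _
  rw [inner_indicatorOp_self hX, Complex.ofReal_re]

/-- The observable `X ↦ U E(X) U*`. -/
def Observable.conj {α K : Type*} [MeasurableSpace α] [NormedAddCommGroup K]
    [InnerProductSpace ℂ K] (E : Observable α K) (U : K ≃ₗᵢ[ℂ] K) : Observable α K where
  toFun X := (U : K →L[ℂ] K).comp ((E X).comp (U.symm : K →L[ℂ] K))
  isPositive X hX := by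
    have hinner : ∀ φ ψ, inner ℂ (U (E X (U.symm φ))) ψ =
        inner ℂ (E X (U.symm φ)) (U.symm ψ) := fun φ ψ => by
      rw [← U.inner_map_map _ (U.symm ψ), U.apply_symm_apply]
    have hpos := E.isPositive X hX
    rw [ContinuousLinearMap.isPositive_iff_complex] at hpos ⊢
    intro ψ
    have hψ := hpos (U.symm ψ)
    rwa [← hinner] at hψ
  map_univ := by
    ext1 ψ
    change U (E Set.univ (U.symm ψ)) = ψ
    rw [E.map_univ]
    exact U.apply_symm_apply ψ
  hasSum_iUnion X hX hd φ ψ := by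
    have hinner : ∀ X, inner ℂ φ (U (E X (U.symm ψ))) = inner ℂ (U.symm φ) (E X (U.symm ψ)) :=
      fun X => by rw [← U.inner_map_map (U.symm φ), U.apply_symm_apply]
    have hsum := E.hasSum_iUnion X hX hd (U.symm φ) (U.symm ψ)
    simp only [← hinner] at hsum
    exact hsum
  not_measurable X hX := by
    rw [E.not_measurable X hX, ContinuousLinearMap.zero_comp, ContinuousLinearMap.comp_zero]

theorem Observable.conj_apply {α K : Type*} [MeasurableSpace α] [NormedAddCommGroup K]
    [InnerProductSpace ℂ K] (E : Observable α K) (U : K ≃ₗᵢ[ℂ] K) (X : Set α) (ψ : K) :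
    E.conj U X ψ = U (E X (U.symm ψ)) := rfl

theorem Observable.measure_conj {α K : Type*} [MeasurableSpace α] [NormedAddCommGroup K]
    [InnerProductSpace ℂ K] (E : Observable α K) (U : K ≃ₗᵢ[ℂ] K) (ψ : K) :
    (E.conj U).measure ψ = E.measure (U.symm ψ) := by
  ext X hX
  rw [Observable.measure_apply _ _ hX, Observable.measure_apply _ _ hX, E.conj_apply,
    ← U.inner_map_map (U.symm ψ), U.apply_symm_apply]

/-- The spectral measure `X ↦ R(θ) 1_X(Q) R(θ)*` of `quadrature θ`. -/
def quadratureObservable (θ : ℝ) : Observable ℝ Mode :=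
  (indicatorObservable volume).conj (phaseShifter θ)

theorem phaseShifter_symm_apply (θ : ℝ) (ψ : Mode) :
    (phaseShifter θ).symm ψ = phaseShifter (-θ) ψ := by
  rw [LinearIsometryEquiv.symm_apply_eq, phaseShifter_apply_phaseShifter_neg]

theorem quadratureObservable_apply (θ : ℝ) (X : Set ℝ) (ψ : Mode) :
    quadratureObservable θ X ψ =
      phaseShifter θ (indicatorOp volume X (phaseShifter (-θ) ψ)) := by
  rw [← phaseShifter_symm_apply]; rfl

theorem quadratureObservable_mul_self (θ : ℝ) (X : Set ℝ) :
    quadratureObservable θ X * quadratureObservable θ X = quadratureObservable θ X := by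
  ext1 ψ
  rw [mul_apply_eq_comp, quadratureObservable_apply, quadratureObservable_apply,
    phaseShifter_neg_apply_phaseShifter, ← mul_apply_eq_comp, indicatorOp_mul_self]

theorem measure_quadratureObservable (θ : ℝ) (ψ : Mode) : (quadratureObservable θ).measure ψ =
    volume.withDensity fun x => ENNReal.ofReal (‖phaseShifter (-θ) ψ x‖ ^ 2) := by
  rw [quadratureObservable, Observable.measure_conj, measure_indicatorObservable,
    phaseShifter_symm_apply]

theorem mem_domain_quadrature_iff {θ : ℝ} {ψ : Mode} : ψ ∈ (quadrature θ).domain ↔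
    MemLp (fun x : ℝ => (x : ℂ) * phaseShifter (-θ) ψ x) 2 volume := by
  rw [LinearPMap.mem_domain_iff, graph_quadrature]
  constructor
  · rintro ⟨χ, hχ⟩
    exact (memLp_congr_ae (mem_mulGraph.1 (mem_rotatedGraph.1 hχ))).1 (Lp.memLp _)
  · intro h
    refine ⟨phaseShifter θ (h.toLp _), ?_⟩
    rw [mem_rotatedGraph, phaseShifter_neg_apply_phaseShifter]
    exact h.coeFn_toLp

theorem isSpectralMeasure_quadratureObservable (θ : ℝ) :
    IsSpectralMeasure (quadratureObservable θ) (quadrature θ) := by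
  have hmeas : ∀ ψ : Mode, AEMeasurable (fun x => ENNReal.ofReal (‖ψ x‖ ^ 2)) volume := fun ψ =>
    ((Lp.aestronglyMeasurable ψ).norm.aemeasurable.pow_const 2).ennreal_ofReal
  have hfinite : ∀ ψ : Mode, ∀ᵐ x : ℝ, ENNReal.ofReal (‖ψ x‖ ^ 2) < ⊤ := fun ψ =>
    Filter.Eventually.of_forall fun x => ENNReal.ofReal_lt_top
  have htoReal : ∀ (ψ : Mode) (x : ℝ), (ENNReal.ofReal (‖ψ x‖ ^ 2)).toReal = ‖ψ x‖ ^ 2 :=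
    fun ψ x => ENNReal.toReal_ofReal (by positivity)
  refine ⟨quadratureObservable_mul_self θ, fun ψ => ?_, fun ψ => ?_⟩
  · have hmem : AEStronglyMeasurable (fun x : ℝ => (x : ℂ) * phaseShifter (-θ) ψ x) volume :=
      (Continuous.aestronglyMeasurable (by fun_prop)).mul (Lp.aestronglyMeasurable _)
    rw [mem_domain_quadrature_iff, memLp_two_iff_integrable_sq_norm hmem,
      measure_quadratureObservable,
      integrable_withDensity_iff_integrable_smul₀' (hmeas _) (hfinite _)]
    simp only [htoReal, norm_mul, mul_pow, Complex.norm_real, Real.norm_eq_abs, sq_abs, smul_eq_mul,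
      mul_comm]
  · have hgraph : ((ψ : Mode), quadrature θ ψ) ∈ rotatedGraph θ := by
      rw [← graph_quadrature]
      exact LinearPMap.mem_graph _ ψ
    rw [inner_eq_integral_of_mem_rotatedGraph hgraph, measure_quadratureObservable,
      integral_withDensity_eq_integral_toReal_smul₀ (hmeas _) (hfinite _)]
    simp only [htoReal, smul_eq_mul, mul_comm]

theorem spectralMeasure_quadrature (θ : ℝ) (X : Set ℝ) :
    spectralMeasure (quadrature θ) X = quadratureObservable θ X :=
  (isSpectralMeasure_quadratureObservable θ).spectralMeasure_eq (dense_domain_quadrature θ) X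

/-! ### The unitary `V_θ` on exponential vectors -/

theorem coeFn_dilation {k : ℝ} (hk : k ≠ 0) (ψ : Mode) :
    dilation k ψ =ᵐ[volume] fun x => ψ (k * x) := by
  rw [dilation, dif_pos hk]
  exact (memLp_dilation hk ψ).coeFn_toLp

theorem inner_dilation_dilation {k : ℝ} (hk : k ≠ 0) (φ ψ : Mode) :
    inner ℂ (dilation k φ) (dilation k ψ) = (|k|⁻¹ : ℝ) * inner ℂ φ ψ := by
  rw [inner_eq_integral_of_ae_eq (coeFn_dilation hk φ) (coeFn_dilation hk ψ),
    inner_eq_integral_of_ae_eq (ae_eq_refl φ) (ae_eq_refl ψ),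
    Measure.integral_comp_mul_left (fun y => ψ y * starRingEnd ℂ (φ y)), abs_inv,
    Complex.real_smul]

theorem ofReal_inv_sqrt_sqrt_pi_mul_self :
    (((√(√Real.pi))⁻¹ : ℝ) : ℂ) * ((√(√Real.pi))⁻¹ : ℝ) = ((√Real.pi)⁻¹ : ℝ) := by
  rw [← Complex.ofReal_mul, ← mul_inv, Real.mul_self_sqrt (Real.sqrt_nonneg _)]

theorem integral_expFun_mul_conj_expFun_comp_mul (k : ℝ) (v ζ : ℂ) :
    ∫ x : ℝ, expFun ζ x * starRingEnd ℂ (expFun v (k * x)) =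
      (√(2 / (1 + k ^ 2)) : ℝ) * Complex.exp ((k * starRingEnd ℂ v + ζ) ^ 2 / (1 + k ^ 2 : ℝ) -
        (starRingEnd ℂ v ^ 2 + ζ ^ 2) / 2) := by
  have hk : (0 : ℝ) < 1 + k ^ 2 := by positivity
  have hk' : ((1 + k ^ 2 : ℝ) : ℂ) ≠ 0 := by exact_mod_cast hk.ne'
  have hintegrand : (fun x : ℝ => expFun ζ x * starRingEnd ℂ (expFun v (k * x))) = fun x : ℝ =>
      ((√Real.pi)⁻¹ : ℝ) * Complex.exp ((-((1 + k ^ 2) / 2) : ℝ) * x ^ 2 +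
        ((√2 : ℝ) * (k * starRingEnd ℂ v + ζ)) * x + -((starRingEnd ℂ v ^ 2 + ζ ^ 2) / 2)) := by
    funext x
    rw [expFun, expFun, map_mul, Complex.conj_ofReal, mul_mul_mul_comm,
      ofReal_inv_sqrt_sqrt_pi_mul_self, ← Complex.exp_conj, ← Complex.exp_add]
    congr 2
    simp only [map_sub, map_add, map_neg, map_div₀, map_mul, map_pow, Complex.conj_ofReal,
      map_ofNat]
    push_cast
    ring
  have hscale : (√Real.pi)⁻¹ * √(Real.pi / ((1 + k ^ 2) / 2)) = √(2 / (1 + k ^ 2)) := by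
    rw [← Real.sqrt_inv, ← Real.sqrt_mul (by positivity)]
    congr 1
    field_simp
  have hroot : ((Real.pi : ℂ) / -((-((1 + k ^ 2) / 2) : ℝ) : ℂ)) ^ (1 / 2 : ℂ) =
      (√(Real.pi / ((1 + k ^ 2) / 2)) : ℝ) := by
    rw [Real.sqrt_eq_rpow, Complex.ofReal_cpow (by positivity)]
    push_cast
    rw [neg_neg]
  rw [hintegrand, integral_const_mul,
    integral_cexp_quadratic (by rw [Complex.ofReal_re]; linarith), hroot, ← mul_assoc,
    ← Complex.ofReal_mul, hscale]
  congr 2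
  rw [mul_pow, ofReal_sqrt_two_sq]
  push_cast at hk' ⊢
  field_simp
  ring

theorem inner_dilation_expVec {k : ℝ} (hk : k ≠ 0) (v ζ : ℂ) :
    inner ℂ (dilation k (expVec v)) (expVec ζ) =
      (√(2 / (1 + k ^ 2)) : ℝ) * Complex.exp ((k * starRingEnd ℂ v + ζ) ^ 2 / (1 + k ^ 2 : ℝ) -
        (starRingEnd ℂ v ^ 2 + ζ ^ 2) / 2) := by
  rw [inner_eq_integral_of_ae_eq
    ((coeFn_dilation hk _).trans (ae_dilation hk (coeFn_expVec v))) (coeFn_expVec ζ),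
    integral_expFun_mul_conj_expFun_comp_mul]

/-- The dilation factor `√((1 - cos θ)/(1 + cos θ))` of `A_θ`, without the square root. -/
def squeezeFactor (θ : ℝ) : ℝ :=
  |Real.sin θ| / (1 + Real.cos θ)

theorem sin_ne_zero_of_mem {θ : ℝ} (hθ : θ ∈ Set.Ioo (-Real.pi) 0 ∪ Set.Ioo 0 Real.pi) :
    Real.sin θ ≠ 0 :=
  hθ.elim (fun h => (Real.sin_neg_of_neg_of_neg_pi_lt h.2 h.1).ne)
    fun h => (Real.sin_pos_of_pos_of_lt_pi h.1 h.2).ne'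

theorem one_add_cos_pos {θ : ℝ} (hθ : Real.sin θ ≠ 0) : 0 < 1 + Real.cos θ := by
  refine lt_of_le_of_ne (by linarith [Real.neg_one_le_cos θ]) fun h => hθ ?_
  have hcos : Real.cos θ = -1 := by linarith
  simpa [hcos] using Real.sin_sq_add_cos_sq θ

theorem squeezeFactor_pos {θ : ℝ} (hθ : Real.sin θ ≠ 0) : 0 < squeezeFactor θ :=
  div_pos (abs_pos.2 hθ) (one_add_cos_pos hθ)

theorem squeezeFactor_mul_one_add_cos {θ : ℝ} (hθ : Real.sin θ ≠ 0) :
    squeezeFactor θ * (1 + Real.cos θ) = |Real.sin θ| :=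
  div_mul_cancel₀ _ (one_add_cos_pos hθ).ne'

theorem one_add_squeezeFactor_sq {θ : ℝ} (hθ : Real.sin θ ≠ 0) :
    1 + squeezeFactor θ ^ 2 = 2 / (1 + Real.cos θ) := by
  have hc := one_add_cos_pos hθ
  rw [squeezeFactor, div_pow, sq_abs, Real.sin_sq]
  field_simp
  ring

theorem squeeze_eq (θ : ℝ) :
    squeeze θ = (√(squeezeFactor θ) : ℂ) • dilation (squeezeFactor θ) := by
  have hc : 0 ≤ 1 + Real.cos θ := by linarith [Real.neg_one_le_cos θ]
  have hsq : (1 - Real.cos θ) / (1 + Real.cos θ) = squeezeFactor θ ^ 2 := by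
    rw [squeezeFactor, div_pow, sq_abs, Real.sin_sq]
    rcases hc.eq_or_lt with h | h
    · rw [← h]; norm_num
    · field_simp
      ring
  have hk : 0 ≤ squeezeFactor θ := div_nonneg (abs_nonneg _) hc
  rw [squeeze, hsq, Real.sqrt_sq hk, squeezeFactor]

theorem inner_squeeze_squeeze {θ : ℝ} (hθ : Real.sin θ ≠ 0) (φ ψ : Mode) :
    inner ℂ (squeeze θ φ) (squeeze θ ψ) = inner ℂ φ ψ := by
  have hk := squeezeFactor_pos hθ
  rw [squeeze_eq, smul_apply, smul_apply, inner_smul_left, inner_smul_right,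
    inner_dilation_dilation hk.ne', Complex.conj_ofReal, abs_of_pos hk, ← mul_assoc, ← mul_assoc,
    ← Complex.ofReal_mul, ← Complex.ofReal_mul, Real.mul_self_sqrt hk.le, mul_inv_cancel₀ hk.ne',
    Complex.ofReal_one, one_mul]

theorem inner_squeeze_expVec {θ : ℝ} (hθ : Real.sin θ ≠ 0) (v ζ : ℂ) :
    inner ℂ (squeeze θ (expVec v)) (expVec ζ) =
      (√|Real.sin θ| : ℝ) * Complex.exp (Real.cos θ / 2 * (ζ ^ 2 - starRingEnd ℂ v ^ 2) +
        |Real.sin θ| * starRingEnd ℂ v * ζ) := by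
  have hk := squeezeFactor_pos hθ
  have hc := one_add_cos_pos hθ
  have hsin := squeezeFactor_mul_one_add_cos hθ
  have hscale : √(squeezeFactor θ) * √(2 / (1 + squeezeFactor θ ^ 2)) = √|Real.sin θ| := by
    rw [← Real.sqrt_mul hk.le, one_add_squeezeFactor_sq hθ, div_div_cancel₀ two_ne_zero, hsin]
  have hsq : squeezeFactor θ * |Real.sin θ| = 1 - Real.cos θ := by
    have h := one_add_squeezeFactor_sq hθ
    rw [eq_div_iff hc.ne'] at h
    linear_combination -squeezeFactor θ * hsin + h
  rw [squeeze_eq, smul_apply, inner_smul_left, inner_dilation_expVec hk.ne', Complex.conj_ofReal,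
    ← mul_assoc, ← Complex.ofReal_mul, hscale, one_add_squeezeFactor_sq hθ, Complex.ofReal_div,
    div_div_eq_mul_div]
  congr 2
  have hsin' : (squeezeFactor θ * (1 + Real.cos θ) : ℂ) = |Real.sin θ| := by exact_mod_cast hsin
  have hsq' : (squeezeFactor θ * |Real.sin θ| : ℂ) = 1 - Real.cos θ := by exact_mod_cast hsq
  push_cast at hsin' hsq' ⊢
  linear_combination (starRingEnd ℂ v ^ 2 * squeezeFactor θ / 2 + starRingEnd ℂ v * ζ) * hsin' +
    starRingEnd ℂ v ^ 2 / 2 * hsq'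

/-- The angle of the second phase shifter in `V_θ`. -/
def tiltAngle (θ : ℝ) : ℝ :=
  if 0 < θ then (θ - Real.pi) / 2 else (θ + Real.pi) / 2

theorem tiltUnitary_apply (θ : ℝ) (ψ : Mode) : tiltUnitary θ ψ =
    phaseShifter (tiltAngle θ) (squeeze θ (phaseShifter (θ / 2) ψ)) := rfl

theorem norm_tiltUnitary_apply {θ : ℝ} (hθ : Real.sin θ ≠ 0) (ψ : Mode) :
    ‖tiltUnitary θ ψ‖ = ‖ψ‖ := by
  rw [tiltUnitary_apply, LinearIsometryEquiv.norm_map,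
    (LinearMap.norm_map_iff_inner_map_map (squeeze θ)).2 (inner_squeeze_squeeze hθ),
    LinearIsometryEquiv.norm_map]

theorem abs_sin_mul_exp_neg_tiltAngle {θ : ℝ} (hθ : θ ∈ Set.Ioo (-Real.pi) 0 ∪ Set.Ioo 0 Real.pi) :
    (|Real.sin θ| : ℝ) * Complex.exp (-(tiltAngle θ * Complex.I)) =
      Complex.I * Real.sin θ * Complex.exp (-(θ / 2 * Complex.I)) := by
  rcases hθ with hneg | hpos
  · have hangle : -((((θ + Real.pi) / 2 : ℝ) : ℂ) * Complex.I) =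
        -(θ / 2 * Complex.I) - Real.pi / 2 * Complex.I := by push_cast; ring
    rw [abs_of_neg (Real.sin_neg_of_neg_of_neg_pi_lt hneg.2 hneg.1), tiltAngle,
      if_neg hneg.2.not_gt, hangle, Complex.exp_sub, Complex.exp_pi_div_two_mul_I, Complex.div_I]
    push_cast
    ring
  · have hangle : -((((θ - Real.pi) / 2 : ℝ) : ℂ) * Complex.I) =
        -(θ / 2 * Complex.I) + Real.pi / 2 * Complex.I := by push_cast; ring
    rw [abs_of_pos (Real.sin_pos_of_pos_of_lt_pi hpos.1 hpos.2), tiltAngle, if_pos hpos.1, hangle,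
      Complex.exp_add, Complex.exp_pi_div_two_mul_I]
    ring

theorem exp_neg_tiltAngle_sq (θ : ℝ) :
    Complex.exp (-(tiltAngle θ * Complex.I)) ^ 2 = -Complex.exp (-(θ * Complex.I)) := by
  rw [← Complex.exp_nat_mul, tiltAngle]
  split_ifs
  · rw [← Complex.exp_add_pi_mul_I]
    congr 1
    push_cast
    ring
  · rw [← Complex.exp_sub_pi_mul_I]
    congr 1
    push_cast
    ring

theorem inner_tiltUnitary_conjugation_expVec {θ : ℝ}
    (hθ : θ ∈ Set.Ioo (-Real.pi) 0 ∪ Set.Ioo 0 Real.pi) (u z : ℂ) :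
    inner ℂ (tiltUnitary θ (conjugation (expVec u))) (expVec z) =
      (√|Real.sin θ| : ℝ) * Complex.exp (-(Complex.exp (-(θ * Complex.I)) *
        (Real.cos θ * (z ^ 2 + u ^ 2) / 2 - Complex.I * Real.sin θ * u * z))) := by
  have hangle : Complex.I * (-tiltAngle θ : ℝ) = -(tiltAngle θ * Complex.I) := by push_cast; ring
  have hconj : starRingEnd ℂ (Complex.exp (Complex.I * (θ / 2 : ℝ)) * starRingEnd ℂ u) =
      Complex.exp (-(θ / 2 * Complex.I)) * u := by
    rw [map_mul, Complex.conj_conj, ← Complex.exp_conj, map_mul, Complex.conj_I,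
      Complex.conj_ofReal]
    congr 2
    push_cast
    ring
  have hhalf : Complex.exp (-(θ / 2 * Complex.I)) ^ 2 = Complex.exp (-(θ * Complex.I)) := by
    rw [← Complex.exp_nat_mul]
    congr 1
    push_cast
    ring
  rw [conjugation_expVec, tiltUnitary_apply, inner_phaseShifter_left, phaseShifter_expVec,
    phaseShifter_expVec, inner_squeeze_expVec (sin_ne_zero_of_mem hθ), hconj, hangle]
  congr 2
  linear_combination Real.cos θ / 2 * z ^ 2 * exp_neg_tiltAngle_sq θ +
    Complex.exp (-(θ / 2 * Complex.I)) * u * z * abs_sin_mul_exp_neg_tiltAngle hθ +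
    (Complex.I * Real.sin θ * u * z - Real.cos θ / 2 * u ^ 2) * hhalf

/-! ### The measurement in the coordinate representation -/

/-- The isometry into `L²(ℝ²)` that diagonalizes `U* (Q ⊗ Q_θ) U`, where `U` is the beam
splitter. -/
def homodyneRep (θ : ℝ) : TwoModes →L[ℂ] PlaneL2 :=
  planeRep.toContinuousLinearMap.comp
    ((tensorOp 1 (phaseShifter (-θ) : Mode →L[ℂ] Mode)).comp
      (beamSplitter : TwoModes →L[ℂ] TwoModes))

theorem homodyneRep_apply (θ : ℝ) (t : TwoModes) : homodyneRep θ t =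
    planeRep (tensorOp 1 (phaseShifter (-θ) : Mode →L[ℂ] Mode) (beamSplitter t)) := rfl

theorem inner_homodyneRep (θ : ℝ) (s t : TwoModes) :
    inner ℂ (homodyneRep θ s) (homodyneRep θ t) = inner ℂ s t := by
  have hphase : (phaseShifter θ : Mode →L[ℂ] Mode) * (phaseShifter (-θ) : Mode →L[ℂ] Mode) = 1 :=
    ContinuousLinearMap.ext (phaseShifter_apply_phaseShifter_neg θ)
  rw [homodyneRep_apply, homodyneRep_apply, LinearIsometry.inner_map_map,
    ← ContinuousLinearMap.adjoint_inner_right, adjoint_tensorOp, adjoint_phaseShifter, neg_neg,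
    ContinuousLinearMap.adjoint_one, ← mul_apply_eq_comp, tensorOp_mul, one_mul, hphase,
    tensorOp_one]
  exact beamSplitter.inner_map_map s t

theorem homodyneRep_tensorVec_expVec (θ : ℝ) (z u : ℂ) :
    homodyneRep θ (tensorVec (expVec z) (expVec u)) =ᵐ[volume] fun p : ℝ × ℝ =>
      expFun ((z - u) / (√2 : ℝ)) p.1 *
        expFun (Complex.exp (-(θ * Complex.I)) * (z + u) / (√2 : ℝ)) p.2 := by
  set v := (z - u) / (√2 : ℝ)
  set w := Complex.exp (-(θ * Complex.I)) * (z + u) / (√2 : ℝ) with hw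
  have hangle : Complex.I * (-θ : ℝ) = -(θ * Complex.I) := by push_cast; ring
  have hrep : homodyneRep θ (tensorVec (expVec z) (expVec u)) = prodVec (expVec v) (expVec w) := by
    rw [homodyneRep_apply, beamSplitter_expVec, tensorOp_tensorVec, planeRep_tensorVec, hw,
      mul_div_assoc, ← hangle, ← phaseShifter_expVec]
    rfl
  rw [hrep]
  filter_upwards [coeFn_prodVec (expVec v) (expVec w), ae_fst (coeFn_expVec v),
    ae_snd (coeFn_expVec w)] with p hprod hfst hsnd
  rw [hprod, hfst, hsnd]

/-- The factor by which `⟨W_θ(√2 p) V_θ C w, φ⟩` differs from the value at `p` of the coordinate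
representation of `φ ⊗ w`. -/
def homodyneFactor (θ : ℝ) (p : ℝ × ℝ) : ℂ :=
  (√(Real.pi * |Real.sin θ|) : ℝ) * Complex.exp (
    (((tiltInv θ p).1 ^ 2 - (tiltInv θ p).2 ^ 2) * Real.sin θ * Real.cos θ / 2 -
      (tiltInv θ p).1 * (tiltInv θ p).2 * Real.cos θ ^ 2 : ℝ) * Complex.I)

theorem norm_homodyneFactor_sq (θ : ℝ) (p : ℝ × ℝ) :
    ‖homodyneFactor θ p‖ ^ 2 = Real.pi * |Real.sin θ| := by
  rw [homodyneFactor, norm_mul, Complex.norm_exp_ofReal_mul_I, mul_one, Complex.norm_real,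
    Real.norm_of_nonneg (Real.sqrt_nonneg _), Real.sq_sqrt (by positivity)]

theorem homodyneFactor_ne_zero {θ : ℝ} (hθ : Real.sin θ ≠ 0) (p : ℝ × ℝ) :
    homodyneFactor θ p ≠ 0 := by
  have h := norm_homodyneFactor_sq θ p
  contrapose! h
  rw [h, norm_zero, zero_pow two_ne_zero]
  positivity

theorem tiltInv_smul (θ c : ℝ) (p : ℝ × ℝ) : tiltInv θ (c • p) = c • tiltInv θ p := by
  ext
  · rfl
  · simp only [tiltInv, Prod.smul_fst, Prod.smul_snd, smul_eq_mul]
    ring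

theorem adjoint_weyl_sqrt_two_smul_expVec (a : ℝ × ℝ) (z : ℂ) :
    ContinuousLinearMap.adjoint (weyl (√2 • a)) (expVec z) =
      Complex.exp (-((a.1 ^ 2 + a.2 ^ 2) / 2) + (a.1 - Complex.I * a.2) * z) •
        expVec (z - (a.1 + Complex.I * a.2)) := by
  have h2 : ((√2 : ℝ) : ℂ) ≠ 0 := by norm_num
  rw [adjoint_weyl, weyl_expVec]
  simp only [Prod.fst_neg, Prod.snd_neg, Prod.smul_fst, Prod.smul_snd, smul_eq_mul,
    Complex.ofReal_neg, Complex.ofReal_mul]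
  congr 2
  · field_simp
    rw [ofReal_sqrt_two_sq]
    ring
  · field_simp
    ring

theorem expFun_div_sqrt_two_mul (v w : ℂ) (x y : ℝ) :
    expFun (v / (√2 : ℝ)) x * expFun (w / (√2 : ℝ)) y = ((√Real.pi)⁻¹ : ℝ) *
      Complex.exp (-((x ^ 2 + y ^ 2) / 2) + v * x + w * y - (v ^ 2 + w ^ 2) / 4) := by
  have h2 : ((√2 : ℝ) : ℂ) ≠ 0 := by norm_num
  rw [expFun, expFun, mul_mul_mul_comm, ofReal_inv_sqrt_sqrt_pi_mul_self, ← Complex.exp_add,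
    mul_div_cancel₀ v h2, mul_div_cancel₀ w h2, div_pow, div_pow, ofReal_sqrt_two_sq]
  congr 2
  ring

theorem inner_tiltedWeyl_tiltUnitary_conjugation_expVec {θ : ℝ}
    (hθ : θ ∈ Set.Ioo (-Real.pi) 0 ∪ Set.Ioo 0 Real.pi) (z u : ℂ) (p : ℝ × ℝ) :
    inner ℂ (tiltedWeyl θ (√2 • p) (tiltUnitary θ (conjugation (expVec u)))) (expVec z) =
      homodyneFactor θ p * (expFun ((z - u) / (√2 : ℝ)) p.1 *
        expFun (Complex.exp (-(θ * Complex.I)) * (z + u) / (√2 : ℝ)) p.2) := by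
  have hsin := sin_ne_zero_of_mem hθ
  obtain ⟨a, rfl⟩ : ∃ a, tilt θ a = p := ⟨_, tilt_tiltInv hsin p⟩
  have hconst : (√(Real.pi * |Real.sin θ|) : ℂ) * ((√Real.pi)⁻¹ : ℝ) = √|Real.sin θ| := by
    rw [← Complex.ofReal_mul, Real.sqrt_mul Real.pi_pos.le, mul_right_comm,
      mul_inv_cancel₀ (Real.sqrt_ne_zero'.2 Real.pi_pos), one_mul]
  have hexp : Complex.exp (-(θ * Complex.I)) = Real.cos θ - Real.sin θ * Complex.I := by
    rw [← neg_mul, Complex.exp_mul_I, Complex.cos_neg, Complex.sin_neg, Complex.ofReal_cos,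
      Complex.ofReal_sin]
    ring
  have hcs : (Real.sin θ : ℂ) ^ 2 + (Real.cos θ : ℂ) ^ 2 = 1 := by
    exact_mod_cast Real.sin_sq_add_cos_sq θ
  rw [tiltedWeyl, tiltInv_smul, homodyneFactor, tiltInv_tilt hsin,
    ← ContinuousLinearMap.adjoint_inner_right, adjoint_weyl_sqrt_two_smul_expVec,
    inner_smul_right, inner_tiltUnitary_conjugation_expVec hθ, mul_left_comm, ← Complex.exp_add,
    expFun_div_sqrt_two_mul, mul_mul_mul_comm, hconst, ← Complex.exp_add, hexp]
  congr 2
  simp only [tilt]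
  push_cast at hcs ⊢
  generalize Complex.cos θ = c at *
  generalize Complex.sin θ = s at *
  linear_combination (s ^ 2 * ((z - u) ^ 2 / 4 + u * (a.1 + Complex.I * a.2)) -
      c * s * a.2 * (z + u - a.1) + c * a.2 ^ 2 * (s * Complex.I - c) / 2) * Complex.I_sq +
    (a.2 ^ 2 / 2 + Complex.I * a.2 * z - a.1 * u - (z - u) ^ 2 / 4) * hcs

theorem ae_eq_of_dense_span_range {E α ι : Type*} [NormedAddCommGroup E] [NormedSpace ℂ E]
    [MeasurableSpace α] {μ : Measure α} {e : ι → E}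
    (he : Dense (Submodule.span ℂ (Set.range e) : Set E)) (T : E →L[ℂ] Lp ℂ 2 μ)
    (Λ : α → E →L[ℂ] ℂ) (h : ∀ i, T (e i) =ᵐ[μ] fun p => Λ p (e i)) (φ : E) :
    T φ =ᵐ[μ] fun p => Λ p φ := by
  let S : Submodule ℂ E :=
    { carrier := {φ | T φ =ᵐ[μ] fun p => Λ p φ}
      add_mem' := fun {φ ψ} hφ hψ => by
        rw [Set.mem_ofPred_eq, map_add]
        filter_upwards [hφ, hψ, Lp.coeFn_add (T φ) (T ψ)] with p hφp hψp hadd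
        rw [hadd, Pi.add_apply, hφp, hψp, map_add]
      zero_mem' := by
        rw [Set.mem_ofPred_eq, map_zero]
        filter_upwards [Lp.coeFn_zero ℂ 2 μ] with p hzero
        rw [hzero, map_zero, Pi.zero_apply]
      smul_mem' := fun c φ hφ => by
        rw [Set.mem_ofPred_eq, map_smul]
        filter_upwards [hφ, Lp.coeFn_smul c (T φ)] with p hφp hsmul
        rw [hsmul, Pi.smul_apply, hφp, map_smul] }
  have hS : IsClosed (S : Set E) := isSeqClosed_iff_isClosed.1 fun f g hf hg => by
    refine ae_eq_of_tendsto_Lp ((T.continuous.tendsto g).comp hg) ?_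
    filter_upwards [ae_all_iff.2 hf] with p hfp
    simp only [Function.comp_apply, hfp]
    exact ((Λ p).continuous.tendsto g).comp hg
  exact mem_of_dense_span_range (S := S) he hS h φ

theorem inner_tiltedWeyl_tiltUnitary_conjugation (θ : ℝ) (p : ℝ × ℝ) (φ w : Mode) :
    inner ℂ (tiltedWeyl θ p (tiltUnitary θ (conjugation w))) φ =
      inner ℂ (conjugation (ContinuousLinearMap.adjoint (tiltUnitary θ)
        (ContinuousLinearMap.adjoint (tiltedWeyl θ p) φ))) w := by
  rw [← ContinuousLinearMap.adjoint_inner_right, ← ContinuousLinearMap.adjoint_inner_right,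
    inner_conjugation_left]

theorem homodyneRep_tensorVec {θ : ℝ} (hθ : θ ∈ Set.Ioo (-Real.pi) 0 ∪ Set.Ioo 0 Real.pi)
    (φ w : Mode) : homodyneRep θ (tensorVec φ w) =ᵐ[volume] fun p : ℝ × ℝ =>
      (homodyneFactor θ p)⁻¹ *
        inner ℂ (tiltedWeyl θ (√2 • p) (tiltUnitary θ (conjugation w))) φ := by
  have hexp : ∀ φ u, homodyneRep θ (tensorVec φ (expVec u)) =ᵐ[volume] fun p : ℝ × ℝ =>
      (homodyneFactor θ p)⁻¹ *
        inner ℂ (tiltedWeyl θ (√2 • p) (tiltUnitary θ (conjugation (expVec u)))) φ := fun φ u => by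
    refine ae_eq_of_dense_span_range dense_span_expVec
      ((homodyneRep θ).comp (tensorVecL.flip (expVec u)))
      (fun p => (homodyneFactor θ p)⁻¹ •
        innerSL ℂ (tiltedWeyl θ (√2 • p) (tiltUnitary θ (conjugation (expVec u)))))
      (fun z => ?_) φ
    filter_upwards [homodyneRep_tensorVec_expVec θ z u] with p hp
    rw [smul_apply, smul_eq_mul, innerSL_apply_apply,
      inner_tiltedWeyl_tiltUnitary_conjugation_expVec hθ,
      inv_mul_cancel_left₀ (homodyneFactor_ne_zero (sin_ne_zero_of_mem hθ) p)]
    exact hp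
  simp only [inner_tiltedWeyl_tiltUnitary_conjugation] at hexp ⊢
  exact ae_eq_of_dense_span_range dense_span_expVec ((homodyneRep θ).comp (tensorVecL φ))
    (fun p => (homodyneFactor θ p)⁻¹ •
      innerSL ℂ (conjugation (ContinuousLinearMap.adjoint (tiltUnitary θ)
        (ContinuousLinearMap.adjoint (tiltedWeyl θ (√2 • p)) φ)))) (hexp φ) w

/-! ### Compressions and images of observables -/

section Compression

variable {α β K L ι : Type*} [MeasurableSpace α] [MeasurableSpace β]
  [NormedAddCommGroup K] [InnerProductSpace ℂ K] [NormedAddCommGroup L] [InnerProductSpace ℂ L]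

/-- The image of an observable under a renaming of its outcomes. Since an observable vanishes on
nonmeasurable sets, only measurable equivalences are allowed. -/
def Observable.map (E : Observable α K) (e : α ≃ᵐ β) : Observable β K where
  toFun Z := E (e ⁻¹' Z)
  isPositive Z hZ := E.isPositive _ (e.measurable hZ)
  map_univ := E.map_univ
  hasSum_iUnion Z hZ hd φ ψ := by
    rw [Set.preimage_iUnion]
    exact E.hasSum_iUnion _ (fun n => e.measurable (hZ n)) (fun m n h => (hd h).preimage e) φ ψ
  not_measurable Z hZ := E.not_measurable _ (mt e.measurableSet_preimage.1 hZ)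

theorem summable_norm_apply_sq_of_summable_norm_sq {T : ι → K →L[ℂ] L}
    (hT : Summable fun l => ‖T l‖ ^ 2) (φ : K) : Summable fun l => ‖T l φ‖ ^ 2 := by
  refine Summable.of_nonneg_of_le (fun l => by positivity) (fun l => ?_) (hT.mul_right (‖φ‖ ^ 2))
  rw [← mul_pow]
  gcongr
  exact (T l).le_opNorm φ

theorem Observable.summable_re_inner_apply (F : Observable α L) {v : ι → L}
    (hv : Summable fun l => ‖v l‖ ^ 2) {Z : ℕ → Set α} (hZ : ∀ n, MeasurableSet (Z n))
    (hd : Pairwise (Function.onFun Disjoint Z)) :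
    Summable fun p : ι × ℕ => (inner ℂ (v p.1) (F (Z p.2) (v p.1))).re := by
  have hnonneg : ∀ p : ι × ℕ, 0 ≤ (inner ℂ (v p.1) (F (Z p.2) (v p.1))).re := fun p =>
    (F.isPositive _ (hZ p.2)).re_inner_nonneg_right (v p.1)
  have hrow : ∀ l, HasSum (fun n => (inner ℂ (v l) (F (Z n) (v l))).re)
      (inner ℂ (v l) (F (⋃ n, Z n) (v l))).re := fun l =>
    Complex.hasSum_re (F.hasSum_iUnion Z hZ hd (v l) (v l))
  rw [summable_prod_of_nonneg hnonneg]
  refine ⟨fun l => (hrow l).summable, ?_⟩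
  simp only [(hrow _).tsum_eq]
  refine Summable.of_nonneg_of_le (fun l => ?_) (fun l => ?_) hv
  · exact (F.isPositive _ (.iUnion hZ)).re_inner_nonneg_right (v l)
  · rw [F.inner_eq_measure _ (.iUnion hZ), Complex.ofReal_re, ← F.measureReal_univ (v l)]
    exact measureReal_mono (Set.subset_univ _)

theorem hasSum_of_hasSum_rows {E κ : Type*} [AddCommMonoid E] [TopologicalSpace E]
    [ContinuousAdd E] [T3Space E] {f : ι × κ → E} (hf : Summable f) {a : ι → E} {b : κ → E} {s : E}
    (ha : ∀ i, HasSum (fun k => f (i, k)) (a i)) (hs : HasSum a s)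
    (hb : ∀ k, HasSum (fun i => f (i, k)) (b k)) : HasSum b s := by
  obtain ⟨t, ht⟩ := hf
  rw [hs.unique (ht.prod_fiberwise ha)]
  exact ((Equiv.prodComm κ ι).hasSum_iff.2 ht).prod_fiberwise hb

variable [CompleteSpace K] [CompleteSpace L]

theorem norm_inner_apply_le_add {S : L →L[ℂ] L} (hS : S.IsPositive) (x y : L) :
    ‖inner ℂ x (S y)‖ ≤ (inner ℂ x (S x)).re + (inner ℂ y (S y)).re := by
  rw [← sqrt_apply_sqrt hS y, ← inner_sqrt_left, sqrt_apply_sqrt hS y,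
    inner_apply_self_eq_norm_sqrt_sq hS, inner_apply_self_eq_norm_sqrt_sq hS, Complex.ofReal_re,
    Complex.ofReal_re]
  refine (norm_inner_le_norm _ _).trans ?_
  nlinarith [two_mul_le_add_sq ‖CFC.sqrt S x‖ ‖CFC.sqrt S y‖, sq_nonneg ‖CFC.sqrt S x‖,
    sq_nonneg ‖CFC.sqrt S y‖]

/-- The operator `∑ₗ Tₗ* A Tₗ`. -/
def compression (T : ι → K →L[ℂ] L) (A : L →L[ℂ] L) : K →L[ℂ] K :=
  ∑' l, (ContinuousLinearMap.adjoint (T l)).comp (A.comp (T l))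

theorem hasSum_inner_compression {T : ι → K →L[ℂ] L} (hT : Summable fun l => ‖T l‖ ^ 2)
    (A : L →L[ℂ] L) (φ ψ : K) :
    HasSum (fun l => inner ℂ (T l φ) (A (T l ψ))) (inner ℂ φ (compression T A ψ)) := by
  have hsum : Summable fun l => (ContinuousLinearMap.adjoint (T l)).comp (A.comp (T l)) := by
    refine Summable.of_norm_bounded (hT.mul_left ‖A‖) fun l => ?_
    calc ‖(ContinuousLinearMap.adjoint (T l)).comp (A.comp (T l))‖
        ≤ ‖ContinuousLinearMap.adjoint (T l)‖ * (‖A‖ * ‖T l‖) :=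
          (ContinuousLinearMap.opNorm_comp_le _ _).trans
            (mul_le_mul_of_nonneg_left (ContinuousLinearMap.opNorm_comp_le _ _) (norm_nonneg _))
      _ = ‖A‖ * ‖T l‖ ^ 2 := by rw [LinearIsometryEquiv.norm_map]; ring
  have h := (hsum.hasSum.mapL (ContinuousLinearMap.apply ℂ K ψ)).mapL (innerSL ℂ φ)
  exact h.congr_fun fun l => (ContinuousLinearMap.adjoint_inner_right (T l) _ _).symm

theorem isPositive_compression {T : ι → K →L[ℂ] L} (hT : Summable fun l => ‖T l‖ ^ 2)
    {A : L →L[ℂ] L} (hA : A.IsPositive) : (compression T A).IsPositive := by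
  refine isPositive_of_hasSum_inner (c := fun ψ l => ‖CFC.sqrt A (T l ψ)‖ ^ 2)
    (fun _ _ => by positivity) fun ψ => ?_
  simp only [← inner_apply_self_eq_norm_sqrt_sq hA]
  exact hasSum_inner_compression hT A ψ ψ

theorem Observable.hasSum_inner_compression_iUnion (F : Observable α L) {T : ι → K →L[ℂ] L}
    (hT : Summable fun l => ‖T l‖ ^ 2) {Z : ℕ → Set α} (hZ : ∀ n, MeasurableSet (Z n))
    (hd : Pairwise (Function.onFun Disjoint Z)) (φ ψ : K) :
    HasSum (fun n => inner ℂ φ (compression T (F (Z n)) ψ))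
      (inner ℂ φ (compression T (F (⋃ n, Z n)) ψ)) := by
  have hdiag : ∀ φ, Summable fun p : ι × ℕ =>
      (inner ℂ (T p.1 φ) (F (Z p.2) (T p.1 φ))).re := fun φ =>
    F.summable_re_inner_apply (summable_norm_apply_sq_of_summable_norm_sq hT φ) hZ hd
  have hsum : Summable fun p : ι × ℕ => inner ℂ (T p.1 φ) (F (Z p.2) (T p.1 ψ)) :=
    Summable.of_norm_bounded ((hdiag φ).add (hdiag ψ)) fun p =>
      norm_inner_apply_le_add (F.isPositive _ (hZ p.2)) _ _
  exact hasSum_of_hasSum_rows hsum (fun l => F.hasSum_iUnion Z hZ hd (T l φ) (T l ψ))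
    (hasSum_inner_compression hT (F (⋃ n, Z n)) φ ψ)
    fun n => hasSum_inner_compression hT (F (Z n)) φ ψ

/-- The observable `Z ↦ ∑ₗ Tₗ* F(Z) Tₗ`, where `∑ₗ Tₗ* Tₗ = 1`. -/
def Observable.compress (F : Observable α L) (T : ι → K →L[ℂ] L) (hT : Summable fun l => ‖T l‖ ^ 2)
    (hone : ∀ φ ψ, HasSum (fun l => inner ℂ (T l φ) (T l ψ)) (inner ℂ φ ψ)) :
    Observable α K where
  toFun Z := compression T (F Z)
  isPositive Z hZ := isPositive_compression hT (F.isPositive Z hZ)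
  map_univ := by
    ext1 ψ
    refine ext_inner_left ℂ fun φ => (hasSum_inner_compression hT _ φ ψ).unique ?_
    rw [F.map_univ]
    exact hone φ ψ
  hasSum_iUnion Z hZ hd φ ψ := F.hasSum_inner_compression_iUnion hT hZ hd φ ψ
  not_measurable Z hZ := by
    rw [F.not_measurable Z hZ, compression]
    simp

end Compression

/-! ### Termwise integration -/

section Density

variable {α ι : Type*} [MeasurableSpace α] {μ : Measure α}

theorem integrable_norm_sq (f : Lp ℂ 2 μ) : Integrable (fun x => ‖f x‖ ^ 2) μ :=
  (memLp_two_iff_integrable_sq_norm (Lp.aestronglyMeasurable f)).1 (Lp.memLp f)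

theorem integral_norm_sq (f : Lp ℂ 2 μ) : ∫ x, ‖f x‖ ^ 2 ∂μ = ‖f‖ ^ 2 := by
  have h := inner_indicatorOp_self (μ := μ) MeasurableSet.univ f
  rw [show indicatorOp μ Set.univ = 1 from (indicatorObservable μ).map_univ, one_apply_eq_self,
    inner_self_eq_norm_sq_to_K, setIntegral_univ] at h
  refine Complex.ofReal_injective (h.symm.trans ?_)
  push_cast
  rfl

theorem integral_norm_inner_le (f g : Lp ℂ 2 μ) :
    ∫ x, ‖(inner ℂ (f x) (g x) : ℂ)‖ ∂μ ≤ ‖f‖ ^ 2 + ‖g‖ ^ 2 := by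
  rw [← integral_norm_sq, ← integral_norm_sq,
    ← integral_add (integrable_norm_sq f) (integrable_norm_sq g)]
  refine integral_mono (L2.integrable_inner f g).norm
    ((integrable_norm_sq f).add (integrable_norm_sq g)) fun x => ?_
  refine (norm_inner_le_norm _ _).trans ?_
  nlinarith [two_mul_le_add_sq ‖f x‖ ‖g x‖, sq_nonneg ‖f x‖, sq_nonneg ‖g x‖]

theorem summable_integral_norm_inner {f g : ι → Lp ℂ 2 μ} (hf : Summable fun l => ‖f l‖ ^ 2)
    (hg : Summable fun l => ‖g l‖ ^ 2) :
    Summable fun l => ∫ x, ‖(inner ℂ (f l x) (g l x) : ℂ)‖ ∂μ :=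
  Summable.of_nonneg_of_le (fun _ => integral_nonneg fun _ => norm_nonneg _)
    (fun l => integral_norm_inner_le (f l) (g l)) (hf.add hg)

variable [Countable ι]

theorem integrable_of_ae_hasSum {E : Type*} [NormedAddCommGroup E] {f : ι → α → E} {F : α → E}
    (hf : ∀ i, Integrable (f i) μ) (hsum : Summable fun i => ∫ x, ‖f i x‖ ∂μ)
    (hF : ∀ᵐ x ∂μ, HasSum (fun i => f i x) (F x)) : Integrable F μ := by
  refine ⟨aestronglyMeasurable_of_tendsto_ae Filter.atTop (f := fun s x => ∑ i ∈ s, f i x)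
    (fun s => (integrable_finsetSum s fun i _ => hf i).aestronglyMeasurable) hF, ?_⟩
  have hfin : ∫⁻ x, ∑' i, ‖f i x‖ₑ ∂μ < ⊤ := by
    rw [lintegral_tsum fun i => (hf i).aestronglyMeasurable.enorm]
    simp only [← ofReal_integral_norm_eq_lintegral_enorm (hf _)]
    exact hsum.tsum_ofReal_lt_top
  refine (lintegral_mono_ae ?_).trans_lt hfin
  filter_upwards [hF] with x hx
  rw [← hx.tsum_eq]
  exact enorm_tsum_le_tsum_enorm

variable {f g : ι → Lp ℂ 2 μ} {F : α → ℂ}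

theorem integrable_of_ae_hasSum_inner (hf : Summable fun l => ‖f l‖ ^ 2)
    (hg : Summable fun l => ‖g l‖ ^ 2)
    (hF : ∀ᵐ x ∂μ, HasSum (fun l => inner ℂ (f l x) (g l x)) (F x)) : Integrable F μ :=
  integrable_of_ae_hasSum (fun l => L2.integrable_inner (f l) (g l))
    (summable_integral_norm_inner hf hg) hF

theorem hasSum_inner_indicatorOp (hf : Summable fun l => ‖f l‖ ^ 2)
    (hg : Summable fun l => ‖g l‖ ^ 2)
    (hF : ∀ᵐ x ∂μ, HasSum (fun l => inner ℂ (f l x) (g l x)) (F x)) {X : Set α}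
    (hX : MeasurableSet X) :
    HasSum (fun l => inner ℂ (f l) (indicatorOp μ X (g l))) (∫ x in X, F x ∂μ) := by
  have hintegrable : ∀ l, Integrable (fun x => inner ℂ (f l x) (g l x)) μ := fun l =>
    L2.integrable_inner (f l) (g l)
  have hsum := hasSum_integral_of_summable_integral_norm (μ := μ.restrict X)
    (fun l => (hintegrable l).integrableOn)
    (Summable.of_nonneg_of_le (fun _ => integral_nonneg fun _ => norm_nonneg _)
      (fun l => setIntegral_le_integral (hintegrable l).norm (.of_forall fun _ => norm_nonneg _))
      (summable_integral_norm_inner hf hg))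
  simp only [← inner_indicatorOp hX] at hsum
  rwa [integral_congr_ae ((ae_restrict_of_ae hF).mono fun x hx => hx.tsum_eq)] at hsum

end Density

/-! ### The high-amplitude limit observable -/

/-- The map `φ ↦ φ ⊗ w`, in the representation `homodyneRep` of the two-mode space. -/
def homodyneSlice (θ : ℝ) (w : Mode) : Mode →L[ℂ] PlaneL2 :=
  (homodyneRep θ).comp (tensorVecL.flip w)

theorem homodyneSlice_apply (θ : ℝ) (w φ : Mode) :
    homodyneSlice θ w φ = homodyneRep θ (tensorVec φ w) := rfl

theorem inner_homodyneSlice (θ : ℝ) (w φ ψ : Mode) :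
    inner ℂ (homodyneSlice θ w φ) (homodyneSlice θ w ψ) = ((‖w‖ ^ 2 : ℝ) : ℂ) * inner ℂ φ ψ := by
  rw [homodyneSlice_apply, homodyneSlice_apply, inner_homodyneRep, inner_tensorVec, mul_comm,
    inner_self_eq_norm_sq_to_K]
  push_cast
  rfl

theorem norm_homodyneSlice_apply (θ : ℝ) (w φ : Mode) : ‖homodyneSlice θ w φ‖ = ‖φ‖ * ‖w‖ := by
  rw [homodyneSlice_apply, ← norm_tensorVec, norm_eq_sqrt_re_inner (𝕜 := ℂ),
    norm_eq_sqrt_re_inner (𝕜 := ℂ), inner_homodyneRep]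

theorem norm_homodyneSlice_le (θ : ℝ) (w : Mode) : ‖homodyneSlice θ w‖ ≤ ‖w‖ :=
  ContinuousLinearMap.opNorm_le_bound _ (norm_nonneg _) fun φ => by
    rw [norm_homodyneSlice_apply, mul_comm]

section Homodyne

variable {ι : Type*} {w : ι → Mode}

theorem summable_norm_homodyneSlice_sq (θ : ℝ) (hw : Summable fun l => ‖w l‖ ^ 2) :
    Summable fun l => ‖homodyneSlice θ (w l)‖ ^ 2 :=
  Summable.of_nonneg_of_le (fun _ => by positivity)
    (fun l => pow_le_pow_left₀ (norm_nonneg _) (norm_homodyneSlice_le θ (w l)) 2) hw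

/-- The observable `Z ↦ ∑ₗ ⟨· ⊗ wₗ, U* (Q ⊗ Q_θ)(Z/√2) U (· ⊗ wₗ)⟩` measured when the parameter
field has the ensemble `w`. -/
def homodyneObservable (θ : ℝ) (hw : HasSum (fun l => ‖w l‖ ^ 2) 1) : Observable (ℝ × ℝ) Mode :=
  ((indicatorObservable volume).compress (fun l => homodyneSlice θ (w l))
    (summable_norm_homodyneSlice_sq θ hw.summable) (fun φ ψ => by
      simpa only [inner_homodyneSlice, Complex.ofReal_one, one_mul]
        using (Complex.hasSum_ofReal.2 hw).mul_right (inner ℂ φ ψ))).map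
    (MeasurableEquiv.smul₀ √2 (by positivity))

theorem hasSum_inner_homodyneObservable (θ : ℝ) (hw : HasSum (fun l => ‖w l‖ ^ 2) 1)
    (Z : Set (ℝ × ℝ)) (φ ψ : Mode) :
    HasSum (fun l => inner ℂ (homodyneSlice θ (w l) φ)
      (indicatorOp volume ((fun p : ℝ × ℝ => √2 • p) ⁻¹' Z) (homodyneSlice θ (w l) ψ)))
      (inner ℂ φ (homodyneObservable θ hw Z ψ)) :=
  hasSum_inner_compression (summable_norm_homodyneSlice_sq θ hw.summable) _ φ ψ

variable [Countable ι] {θ : ℝ} {S : Mode →L[ℂ] Mode}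

theorem ae_hasSum_inner_homodyneSlice (hθ : θ ∈ Set.Ioo (-Real.pi) 0 ∪ Set.Ioo 0 Real.pi)
    (hS : IsEnsemble S fun l => tiltUnitary θ (conjugation (w l))) (φ ψ : Mode) :
    ∀ᵐ p : ℝ × ℝ, HasSum (fun l => inner ℂ (homodyneSlice θ (w l) φ p) (homodyneSlice θ (w l) ψ p))
      (((1 / (Real.pi * |Real.sin θ|) : ℝ) : ℂ) * inner ℂ φ
        ((tiltedWeyl θ (√2 • p) * S * ContinuousLinearMap.adjoint (tiltedWeyl θ (√2 • p))) ψ)) := by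
  have hslice : ∀ φ, ∀ᵐ p : ℝ × ℝ, ∀ l, homodyneSlice θ (w l) φ p = (homodyneFactor θ p)⁻¹ *
      inner ℂ (tiltedWeyl θ (√2 • p) (tiltUnitary θ (conjugation (w l)))) φ := fun φ =>
    ae_all_iff.2 fun l => homodyneRep_tensorVec hθ φ (w l)
  filter_upwards [hslice φ, hslice ψ] with p hφ hψ
  have hfactor : (homodyneFactor θ p)⁻¹ * starRingEnd ℂ (homodyneFactor θ p)⁻¹ =
      ((1 / (Real.pi * |Real.sin θ|) : ℝ) : ℂ) := by
    rw [Complex.mul_conj', norm_inv, ← Complex.ofReal_pow, inv_pow, norm_homodyneFactor_sq, one_div]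
  refine (((hS.conj (tiltedWeyl θ (√2 • p))).hasSum_inner φ ψ).mul_left _).congr_fun fun l => ?_
  rw [hφ, hψ, RCLike.inner_apply, map_mul, inner_conj_symm, ← hfactor]
  ring

theorem isGeneratedBy_homodyneObservable (hθ : θ ∈ Set.Ioo (-Real.pi) 0 ∪ Set.Ioo 0 Real.pi)
    (hw : HasSum (fun l => ‖w l‖ ^ 2) 1)
    (hS : IsEnsemble S fun l => tiltUnitary θ (conjugation (w l))) :
    IsGeneratedBy θ S (homodyneObservable θ hw) := by
  intro Z hZ φ ψ
  set d : ℝ × ℝ → ℂ := fun z =>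
    inner ℂ φ ((tiltedWeyl θ z * S * ContinuousLinearMap.adjoint (tiltedWeyl θ z)) ψ)
  have hslice : ∀ φ, Summable fun l => ‖homodyneSlice θ (w l) φ‖ ^ 2 :=
    summable_norm_apply_sq_of_summable_norm_sq (summable_norm_homodyneSlice_sq θ hw.summable)
  have hd : ∀ᵐ p : ℝ × ℝ, HasSum
      (fun l => inner ℂ (homodyneSlice θ (w l) φ p) (homodyneSlice θ (w l) ψ p))
      (((1 / (Real.pi * |Real.sin θ|) : ℝ) : ℂ) * d (√2 • p)) :=
    ae_hasSum_inner_homodyneSlice hθ hS φ ψ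
  have hsqrt : (0 : ℝ) < √2 := by positivity
  have hconst : IsUnit ((1 / (Real.pi * |Real.sin θ|) : ℝ) : ℂ) := by
    have := Real.pi_pos
    have := abs_pos.2 (sin_ne_zero_of_mem hθ)
    exact isUnit_iff_ne_zero.2 (Complex.ofReal_ne_zero.2 (by positivity))
  have hpre : MeasurableSet ((fun p : ℝ × ℝ => √2 • p) ⁻¹' Z) := measurable_const_smul √2 hZ
  have himage : √2 • ((fun p : ℝ × ℝ => √2 • p) ⁻¹' Z) = Z := by
    rw [Set.preimage_smul₀ hsqrt.ne', smul_inv_smul₀ hsqrt.ne']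
  constructor
  · have hintegrable := integrable_of_ae_hasSum_inner (hslice φ) (hslice ψ) hd
    rw [integrable_const_mul_iff hconst, integrable_comp_smul_iff volume d hsqrt.ne'] at hintegrable
    exact hintegrable.integrableOn
  · rw [(hasSum_inner_homodyneObservable θ hw Z φ ψ).unique
        (hasSum_inner_indicatorOp (hslice φ) (hslice ψ) hd hpre), integral_const_mul,
      Measure.setIntegral_comp_smul_of_pos volume d _ hsqrt, himage, Module.finrank_prod,
      Module.finrank_self, Real.sq_sqrt zero_le_two, Complex.real_smul, ← mul_assoc,
      ← Complex.ofReal_mul]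
    congr 2
    field_simp

end Homodyne

/-! ### The generating operator -/

theorem inner_conjugation_right (φ ψ : Mode) :
    inner ℂ φ (conjugation ψ) = inner ℂ ψ (conjugation φ) := by
  rw [← inner_conj_symm, inner_conjugation_left, inner_conj_symm]

theorem IsEnsemble.conjugate {ι : Type*} {σ : Mode →L[ℂ] Mode} {w : ι → Mode}
    (h : IsEnsemble σ w) : IsEnsemble (conjugate σ) fun l => conjugation (w l) where
  summable_norm_sq := by simpa only [LinearIsometryEquiv.norm_map] using h.summable_norm_sq
  hasSum_inner x y := by
    change HasSum _ (inner ℂ x (conjugation (σ (conjugation y))))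
    rw [inner_conjugation_right, ← inner_conj_symm]
    refine ((h.hasSum_inner (conjugation x) (conjugation y)).map (starRingEnd ℂ)
      Complex.continuous_conj).congr_fun fun l => ?_
    rw [Function.comp_apply, map_mul, inner_conj_symm, inner_conj_symm, inner_conjugation_right x,
      inner_conjugation_left (w l)]

theorem IsEnsemble.generator {ι : Type*} {σ : Mode →L[ℂ] Mode} {w : ι → Mode}
    (h : IsEnsemble σ w) (θ : ℝ) :
    IsEnsemble (generator θ σ) fun l => tiltUnitary θ (conjugation (w l)) :=
  h.conjugate.conj (tiltUnitary θ)

theorem IsState.generator {θ : ℝ} (hθ : Real.sin θ ≠ 0) {σ : Mode →L[ℂ] Mode} (hσ : IsState σ) :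
    IsState (generator θ σ) := by
  obtain ⟨w, hw⟩ := hσ.exists_isEnsemble numberBasis
  refine (hw.generator θ).isState_iff.2 ?_
  simpa only [norm_tiltUnitary_apply hθ, LinearIsometryEquiv.norm_map] using hw.isState_iff.1 hσ

/-! ### Covariance -/

theorem tiltInv_add (θ : ℝ) (a b : ℝ × ℝ) : tiltInv θ (a + b) = tiltInv θ a + tiltInv θ b := by
  ext
  · rfl
  · simp only [tiltInv, Prod.snd_add, Prod.fst_add]
    ring

theorem exists_adjoint_tiltedWeyl_apply_adjoint_tiltedWeyl (θ : ℝ) (z z₀ : ℝ × ℝ) :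
    ∃ c : ℂ, ‖c‖ = 1 ∧ ∀ χ : Mode, ContinuousLinearMap.adjoint (tiltedWeyl θ z)
      (ContinuousLinearMap.adjoint (tiltedWeyl θ z₀) χ) =
        c • ContinuousLinearMap.adjoint (tiltedWeyl θ (z + z₀)) χ := by
  simp only [tiltedWeyl, adjoint_weyl, weyl_apply_weyl, tiltInv_add, neg_add]
  refine ⟨_, ?_, fun χ => rfl⟩
  rw [mul_comm]
  exact_mod_cast Complex.norm_exp_ofReal_mul_I _

theorem inner_adjoint_tiltedWeyl_conj_tiltedWeyl (θ : ℝ) (S : Mode →L[ℂ] Mode) (z z₀ : ℝ × ℝ)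
    (φ ψ : Mode) :
    inner ℂ (ContinuousLinearMap.adjoint (tiltedWeyl θ z₀) φ)
      ((tiltedWeyl θ z * S * ContinuousLinearMap.adjoint (tiltedWeyl θ z))
        (ContinuousLinearMap.adjoint (tiltedWeyl θ z₀) ψ)) =
    inner ℂ φ ((tiltedWeyl θ (z + z₀) * S *
      ContinuousLinearMap.adjoint (tiltedWeyl θ (z + z₀))) ψ) := by
  obtain ⟨c, hc, hmul⟩ := exists_adjoint_tiltedWeyl_apply_adjoint_tiltedWeyl θ z z₀
  simp only [mul_apply_eq_comp]
  rw [← ContinuousLinearMap.adjoint_inner_left (tiltedWeyl θ z),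
    ← ContinuousLinearMap.adjoint_inner_left (tiltedWeyl θ (z + z₀)), hmul, hmul, map_smul,
    inner_smul_left, inner_smul_right, ← mul_assoc, Complex.conj_mul', hc]
  simp

theorem IsGeneratedBy.isCovariant {θ : ℝ} {S : Mode →L[ℂ] Mode} {E : Observable (ℝ × ℝ) Mode}
    (h : IsGeneratedBy θ S E) : IsCovariant θ E := by
  intro Z hZ z₀
  have hemb : MeasurableEmbedding fun w : ℝ × ℝ => w + z₀ := measurableEmbedding_addRight z₀
  ext1 ψ
  refine ext_inner_left ℂ fun φ => ?_
  rw [(h _ (hemb.measurableSet_image.2 hZ) φ ψ).2,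
    (measurePreserving_add_right volume z₀).setIntegral_image_emb hemb]
  simp only [← inner_adjoint_tiltedWeyl_conj_tiltedWeyl]
  rw [← (h Z hZ _ _).2, ContinuousLinearMap.adjoint_inner_left]
  rfl

/-! ### The defining property of the high-amplitude limit -/

theorem inner_tensorOp_spectralMeasure (θ : ℝ) {X Y : Set ℝ} (hX : MeasurableSet X)
    (hY : MeasurableSet Y) (t : TwoModes) :
    inner ℂ (beamSplitter t) (tensorOp (spectralMeasure (quadrature 0) X)
      (spectralMeasure (quadrature θ) Y) (beamSplitter t)) =
    inner ℂ (homodyneRep θ t) (indicatorOp volume (X ×ˢ Y) (homodyneRep θ t)) := by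
  have hQ : spectralMeasure (quadrature 0) X = 1 * indicatorOp volume X * 1 := by
    ext1 ψ
    rw [spectralMeasure_quadrature, quadratureObservable_apply, neg_zero, phaseShifter_zero,
      phaseShifter_zero]
    rfl
  have hQθ : spectralMeasure (quadrature θ) Y = (phaseShifter θ : Mode →L[ℂ] Mode) *
      indicatorOp volume Y * (phaseShifter (-θ) : Mode →L[ℂ] Mode) := by
    ext1 ψ
    rw [spectralMeasure_quadrature, quadratureObservable_apply]
    rfl
  have hadj : ContinuousLinearMap.adjoint (tensorOp 1 (phaseShifter (-θ) : Mode →L[ℂ] Mode)) =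
      tensorOp 1 (phaseShifter θ : Mode →L[ℂ] Mode) := by
    rw [adjoint_tensorOp, adjoint_phaseShifter, neg_neg, ContinuousLinearMap.adjoint_one]
  rw [hQ, hQθ, ← tensorOp_mul, ← tensorOp_mul, mul_apply_eq_comp, mul_apply_eq_comp, ← hadj,
    ContinuousLinearMap.adjoint_inner_right, homodyneRep_apply,
    ← planeRep_tensorOp_indicatorOp hX hY, LinearIsometry.inner_map_map]

theorem preimage_sqrt_two_smul_prod (X Y : Set ℝ) :
    (fun p : ℝ × ℝ => √2 • p) ⁻¹' (X ×ˢ Y) = ((1 / √2 : ℝ) • X) ×ˢ ((1 / √2 : ℝ) • Y) := by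
  have hsqrt : (√2 : ℝ) ≠ 0 := by positivity
  ext p
  simp only [Set.mem_preimage, Set.mem_prod, one_div, Set.mem_inv_smul_set_iff₀ hsqrt,
    Prod.smul_fst, Prod.smul_snd]

theorem isHighAmplitudeLimit_homodyneObservable (θ : ℝ) {ι : Type*} {σ : Mode →L[ℂ] Mode}
    {w : ι → Mode} (hσ : IsEnsemble σ w) (hw : HasSum (fun l => ‖w l‖ ^ 2) 1) :
    IsHighAmplitudeLimit θ σ (homodyneObservable θ hw) := by
  intro ρ hρ X Y hX hY
  obtain ⟨v, hv⟩ := hρ.exists_isEnsemble numberBasis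
  have houter := hv.hasSum_trace_mul (homodyneObservable θ hw (X ×ˢ Y))
  have hjoint := ((isEnsemble_tensorOp hv hσ).conj
    (beamSplitter : TwoModes →L[ℂ] TwoModes)).hasSum_trace_mul
    (tensorOp (spectralMeasure (quadrature 0) ((1 / √2 : ℝ) • X))
      (spectralMeasure (quadrature θ) ((1 / √2 : ℝ) • Y)))
  refine houter.unique (hjoint.prod_fiberwise fun k => ?_)
  refine (hasSum_inner_homodyneObservable θ hw (X ×ˢ Y) (v k) (v k)).congr_fun fun l => ?_
  rw [preimage_sqrt_two_smul_prod, homodyneSlice_apply]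
  exact inner_tensorOp_spectralMeasure θ (hX.const_smul₀ _) (hY.const_smul₀ _) _

theorem trace_rankOne_mul {K : Type*} [NormedAddCommGroup K] [InnerProductSpace ℂ K]
    [CompleteSpace K] (ψ : K) (A : K →L[ℂ] K) :
    trace (InnerProductSpace.rankOne ℂ ψ ψ * A) = inner ℂ ψ (A ψ) :=
  ((isEnsemble_rankOne ψ).hasSum_trace_mul A).unique (hasSum_unique _)

theorem inner_apply_self_eq_of_norm_one {K : Type*} [NormedAddCommGroup K] [InnerProductSpace ℂ K]
    {S T : K →L[ℂ] K} (h : ∀ ψ : K, ‖ψ‖ = 1 → inner ℂ ψ (S ψ) = inner ℂ ψ (T ψ)) (ψ : K) :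
    inner ℂ ψ (S ψ) = inner ℂ ψ (T ψ) := by
  rcases eq_or_ne ψ 0 with rfl | hψ
  · simp
  · have hunit := h (((‖ψ‖ : ℝ) : ℂ)⁻¹ • ψ) (norm_smul_inv_norm hψ)
    simp only [map_smul, inner_smul_left, inner_smul_right] at hunit
    have hne : ((‖ψ‖ : ℝ) : ℂ)⁻¹ ≠ 0 := by simpa using hψ
    exact mul_left_cancel₀ ((_root_.map_ne_zero (starRingEnd ℂ)).2 hne)
      (mul_left_cancel₀ hne hunit)

theorem IsHighAmplitudeLimit.unique {θ : ℝ} {σ : Mode →L[ℂ] Mode} {E F : Observable (ℝ × ℝ) Mode}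
    (hE : IsHighAmplitudeLimit θ σ E) (hF : IsHighAmplitudeLimit θ σ F) : E = F := by
  refine Observable.ext_of_measure fun ψ => Measure.ext_prod fun {X Y} hX hY => ?_
  rw [Observable.measure_apply _ _ (hX.prod hY), Observable.measure_apply _ _ (hX.prod hY)]
  refine congrArg (fun c : ℂ => ENNReal.ofReal c.re)
    (inner_apply_self_eq_of_norm_one (fun φ hφ => ?_) ψ)
  have htrace := (hE _ (isState_rankOne hφ) X Y hX hY).trans
    (hF _ (isState_rankOne hφ) X Y hX hY).symm
  rwa [trace_rankOne_mul, trace_rankOne_mul] at htrace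

end EightPort

end

theorem mainTheorem1 (θ : ℝ) (hθ : θ ∈ Set.Ioo (-Real.pi) 0 ∪ Set.Ioo 0 Real.pi)
    (σ : EightPort.Mode →L[ℂ] EightPort.Mode) (hσ : EightPort.IsState σ) :
    EightPort.IsState (EightPort.generator θ σ) ∧
    ∃ E : EightPort.Observable (ℝ × ℝ) EightPort.Mode,
      (∀ E' : EightPort.Observable (ℝ × ℝ) EightPort.Mode,
        EightPort.IsHighAmplitudeLimit θ σ E' ↔ E' = E) ∧
      EightPort.IsCovariant θ E ∧
      EightPort.IsGeneratedBy θ (EightPort.generator θ σ) E := by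
  obtain ⟨w, hw⟩ := hσ.exists_isEnsemble EightPort.numberBasis
  have hone : HasSum (fun n => ‖w n‖ ^ 2) 1 := hw.isState_iff.1 hσ
  have hlim : EightPort.IsHighAmplitudeLimit θ σ (EightPort.homodyneObservable θ hone) :=
    EightPort.isHighAmplitudeLimit_homodyneObservable θ hw hone
  have hgen : EightPort.IsGeneratedBy θ (EightPort.generator θ σ)
      (EightPort.homodyneObservable θ hone) :=
    EightPort.isGeneratedBy_homodyneObservable hθ hone (hw.generator θ)
  exact ⟨hσ.generator (EightPort.sin_ne_zero_of_mem hθ), EightPort.homodyneObservable θ hone,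
    fun E' => ⟨fun hE' => hE'.unique hlim, fun hE' => hE' ▸ hlim⟩, hgen.isCovariant, hgen⟩
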